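/- A domain is a relational structure $\mathcal A$ with carrier set $A$. An embedding of $\mathcal A$ is an injective map $\iota:A\to A$ that preserves and reflects all relations. For a field $\mathbb K$, embeddings act on the polynomial ring $\mathbb K[\mathcal A]$ (variables from $A$) by renaming variables, and the equivariant ideal generated by $B\subseteq\mathbb K[\mathcal A]$ is the ideal generated by $\{\iota(g) : g\in B,\ \iota \text{ an embedding of } \mathcal A\}$. The problem Ideal-memb in $\mathbb K[\mathcal A]$ is: given a polynomial $f\in\mathbb K[\mathcal A]$ and a finite list $B$ of polynomials in $\mathbb K[\mathcal A]$, does $f$ belong to the equivariant ideal generated by $B$? Here elements of $\mathbb K$ and of $A$ are finitely represented, and polynomials are given as lists of terms. The lexicographic product $\mathcal A\otimes\mathcal A'$ has carrier $A\times A'$ and the disjoint union of the relation symbols of $\mathcal A$ and $\mathcal A'$: a relation $r$ of $\mathcal A$ relates $((a_1,a_1'),\dots,(a_k,a_k'))$ iff $r(a_1,\dots,a_k)$, and a relation $r'$ of $\mathcal A'$ relates this tuple iff $a_1=\dots=a_k$ and $r'(a_1',\dots,a_k')$. Write $\mathcal A^{\otimes\ell}$ for the $\ell$-fold product $\mathcal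 A\otimes\dots\otimes\mathcal A$. Let $\mathcal Q$ be the set of rational numbers with its order $\le$ (a rational number is represented by a fraction), let $\omega^2$ be the ordinal $\omega^2$ with its order (the element $\omega\cdot a+b$ is represented by the pair $(a,b)\in\mathbb N^2$), and let $\mathbf d$ be the finite order $0<1<\dots<d-1$. Corollary. Let $\mathbb K$ be a computable field, that is, a field whose elements are finitely represented in such a way that the field operations are computable. For all $d,\ell\ge 1$, Ideal-memb in $\mathbb K[\mathcal Q^{\otimes\ell}\otimes\mathbf d]$ is many-one reducible, by a computable function, to Ideal-memb in $\mathbb K[(\omega^2)^{\otimes\ell}\otimes\mathbf d]$; and Ideal-memb in $\mathbb K[\mathcal Q^{\otimes\ell}\otimes\mathbf d]$ is decidable. -/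

import Mathlib

/-- A domain of variables: a relational structure (a structure over a relational first-order
language), together with a finite representation of its elements: every element is denoted by at
least one code. -/
structure Domain where
  /-- The carrier set. -/
  Carrier : Type
  /-- The relation symbols. -/
  lang : FirstOrder.Language.{0, 0}
  relational : lang.IsRelational
  /-- The interpretation of the relation symbols. -/
  str : lang.Structure Carrier
  /-- The codes. -/
  Code : Type
  primcodable : Primcodable Code
  /-- The element denoted by a code. -/
  val : Code → Carrier
  val_surjective : Function.Surjective val

namespace Domain

attribute [instance] Domain.relational Domain.str Domain.primcodable

/-- Embeddings of a domain into itself: (injective) maps preserving and reflecting all relations. -/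
abbrev Emb (A : Domain) : Type :=
  FirstOrder.Language.Embedding A.lang A.Carrier A.Carrier

/-- The relations of the lexicographic product: a relation of the first factor looks only at first
coordinates; a relation of the second factor holds for a tuple if all its first coordinates are
equal and the relation holds for the second coordinates. -/
abbrev lexStructure (L L' : FirstOrder.Language.{0, 0}) (A A' : Type) [L.IsRelational] [L'.IsRelational]
    [L.Structure A] [L'.Structure A'] : (L.sum L').Structure (A × A') where
  funMap := fun f => isEmptyElim f
  RelMap := fun r x =>
    match r with
    | Sum.inl r => FirstOrder.Language.Structure.RelMap r (fun i => (x i).1)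
    | Sum.inr r => (∀ i j, (x i).1 = (x j).1) ∧ FirstOrder.Language.Structure.RelMap r (fun i => (x i).2)

/-- The lexicographic product `A ⊗ A'`; a pair is represented by a pair of codes. -/
def lexProd (A A' : Domain) : Domain where
  Carrier := A.Carrier × A'.Carrier
  lang := A.lang.sum A'.lang
  relational := inferInstance
  str := lexStructure A.lang A'.lang A.Carrier A'.Carrier
  Code := A.Code × A'.Code
  primcodable := inferInstance
  val := Prod.map A.val A'.val
  val_surjective := A.val_surjective.prodMap A'.val_surjective

/-- The finite order `0 < 1 < ⋯ < d - 1`. -/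
def fin (d : ℕ) : Domain where
  Carrier := Fin d
  lang := FirstOrder.Language.order
  relational := inferInstance
  str := FirstOrder.Language.orderStructure (Fin d)
  Code := Fin d
  primcodable := inferInstance
  val := id
  val_surjective := Function.surjective_id

/-- The order of the rational numbers; the code `(p, n)` denotes the fraction `p / (n + 1)`. -/
def rat : Domain where
  Carrier := ℚ
  lang := FirstOrder.Language.order
  relational := inferInstance
  str := FirstOrder.Language.orderStructure ℚ
  Code := ℤ × ℕ
  primcodable := inferInstance
  val := fun c => (c.1 : ℚ) / ((c.2 : ℚ) + 1)
  val_surjective := fun q => ⟨(q.num, q.den - 1), by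
    have h : (((q.den - 1 : ℕ) : ℚ) + 1) = (q.den : ℚ) := by
      exact_mod_cast Nat.sub_add_cancel q.pos
    simp only [h]
    exact q.num_div_den⟩

/-- The ordinal `ω²`, as the set of pairs of natural numbers ordered lexicographically: the pair
`(a, b)` is the ordinal `ω · a + b`. -/
def omegaSq : Domain where
  Carrier := ℕ ×ₗ ℕ
  lang := FirstOrder.Language.order
  relational := inferInstance
  str := FirstOrder.Language.orderStructure (ℕ ×ₗ ℕ)
  Code := ℕ × ℕ
  primcodable := inferInstance
  val := toLex
  val_surjective := toLex.surjective

/-- The order on the carrier of `omegaSq` has order type `ω²`. -/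
theorem type_omegaSq :
    Ordinal.type ((· < ·) : ℕ ×ₗ ℕ → ℕ ×ₗ ℕ → Prop) = Ordinal.omega0 ^ 2 := by
  have h := Ordinal.type_prod_lex ((· < ·) : ℕ → ℕ → Prop) ((· < ·) : ℕ → ℕ → Prop)
  rw [Ordinal.type_nat_lt, ← pow_two] at h
  exact h

/-- The `ℓ`-fold lexicographic power `A ⊗ ⋯ ⊗ A` for `ℓ ≥ 1`
(the value for `ℓ = 0`, a one-point order, is not used). -/
def lexPow (A : Domain) : ℕ → Domain
  | 0 => fin 1
  | 1 => A
  | n + 2 => lexProd (lexPow A (n + 1)) A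

end Domain

/-- A field whose elements are finitely represented (through `Primcodable K`) is computable if the
field operations are computable functions on representations. -/
structure ComputableField (K : Type*) [Field K] [Primcodable K] : Prop where
  add : Computable₂ (fun x y : K => x + y)
  neg : Computable (fun x : K => -x)
  mul : Computable₂ (fun x y : K => x * y)
  inv : Computable (fun x : K => x⁻¹)

/-- A finite representation of a polynomial over `K` with variables from `A`: a list of terms, each
consisting of a coefficient and a list of powers of (codes of) variables. -/
abbrev PolyCode (K : Type*) (A : Domain) : Type _ := List (K × List (A.Code × ℕ))

/-- The polynomial denoted by a representation. -/
noncomputable def PolyCode.toPoly {K : Type*} [Field K] {A : Domain} (p : PolyCode K A) :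
    MvPolynomial A.Carrier K :=
  (p.map fun t =>
    MvPolynomial.C t.1 * (t.2.map fun v => MvPolynomial.X (A.val v.1) ^ v.2).prod).sum

/-- The equivariant ideal generated by a set `B` of polynomials: the ideal generated by all
polynomials obtained from those in `B` by renaming variables according to an embedding. -/
noncomputable def eqIdealGen {K : Type*} [Field K] {A : Domain}
    (B : Set (MvPolynomial A.Carrier K)) : Ideal (MvPolynomial A.Carrier K) :=
  Ideal.span {f | ∃ (ι : A.Emb) (g : MvPolynomial A.Carrier K),
    g ∈ B ∧ f = MvPolynomial.rename (fun a => ι a) g}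

/-- The ideal membership problem in the polynomial ring over `K` with variables from `A`. An
instance is a polynomial and a finite list of polynomials which generates an equivariant ideal; it
is a positive instance if the polynomial belongs to the equivariant ideal. -/
def IdealMemb (K : Type*) [Field K] (A : Domain) (x : PolyCode K A × List (PolyCode K A)) : Prop :=
  x.1.toPoly ∈ eqIdealGen {g | ∃ b ∈ x.2, g = PolyCode.toPoly b}

/-! The proof moves the problem from the dense order to a well-ordered one, where Gröbner bases
exist, and decides the resulting instances there.

Reduction. A membership over ℚ involves only finitely many rationals. After scaling by a common
multiple `N` of the weights of the codes and shifting by `N * N`, every rational of an instance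
becomes a natural number `k`. The variables of the generators are put at `(0, k)`, in the bottom
copy of ω. Every increasing map from a finite initial segment of ω² into ω² extends to an embedding,
so the renamings of such generators are all the increasing ones, as over ℚ. The variables of `f` are
put at `(k + 1, 0)`: above each of these positions and below the lowest of them there are infinitely
many points, enough for whatever rationals occur in a representation of `f`. Conversely, ω² embeds
into ℚ with `(k + 1, 0)` going back to the original rational, and increasing sequences of rationals
are interpolated to embeddings of ℚ. This is `Reduction.mem_orbitIdeal_iff`.

Decidability. An `Arena` abstracts what is needed of ω²: a well-order with finite windows from which
increasing maps extend, into which finite sets compress, and whose labelled versions are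
well-quasi-ordered (Higman's lemma). Exponent vectors, compared colexicographically, are
well-ordered compatibly with embeddings, and well-quasi-ordering yields finite Gröbner bases
(`exists_groebner`). No completion procedure is run. Membership is semidecidable by enumerating
representations. Non-membership is semidecidable by enumerating certificates: a finite set
satisfying Buchberger's criterion whose ideal contains the generators, and a nonzero remainder of
`f` whose leading monomial is divisible by no renamed leading monomial. Compression leaves only
finitely many pairs of renamings to check (`overlapsResolve_of_window`). Soundness and completeness
are `not_mem_of_refutes` and `exists_refutes`.

Products. An embedding of a lexicographic product is an embedding of the base together with an
independent embedding in each fibre. All ingredients (comparisons, arenas, reductions) are therefore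
closed under products, and only ℚ, ω² and the finite orders need separate treatment. -/

section Computability

/-! ### Computable list operations, decidable and semidecidable predicates. -/

variable {α β σ : Type*} [Primcodable α] [Primcodable β] [Primcodable σ]

theorem Computable.list_foldl {f : α → List β} {g : α → σ} {h : α → σ × β → σ}
    (hf : Computable f) (hg : Computable g) (hh : Computable₂ h) :
    Computable fun a => (f a).foldl (fun s b => h a (s, b)) (g a) := by
  have step : Computable₂ fun (a : α) (p : ℕ × σ) =>
      Option.casesOn (motive := fun _ => σ) ((f a)[p.1]?) p.2 (fun b => h a (p.2, b)) := by
    refine Computable.option_casesOn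
      (Computable.list_getElem?.comp (hf.comp Computable.fst) (Computable.fst.comp Computable.snd))
      (Computable.snd.comp Computable.snd) ?_
    exact hh.comp (Computable.fst.comp Computable.fst)
      ((Computable.snd.comp (Computable.snd.comp Computable.fst)).pair Computable.snd)
  refine (Computable.nat_rec (Computable.list_length.comp hf) hg step).of_eq fun a => ?_
  have key : ∀ n, (Nat.rec (g a) (fun y IH => Option.casesOn (motive := fun _ => σ) ((f a)[y]?) IH
      (fun b => h a (IH, b))) n : σ) = ((f a).take n).foldl (fun s b => h a (s, b)) (g a) := by
    intro n
    induction n with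
    | zero => simp
    | succ n ih =>
      simp only [ih, List.take_add_one, List.foldl_append]
      cases (f a)[n]? <;> simp
  simpa using key (f a).length

theorem Computable.list_map {f : α → List β} {g : α → β → σ}
    (hf : Computable f) (hg : Computable₂ g) : Computable fun a => (f a).map (g a) := by
  have := Computable.list_foldl (g := fun _ => ([] : List σ))
    (h := fun a p => p.1 ++ [g a p.2]) hf (Computable.const _)
    (Computable.list_concat.comp (Computable.fst.comp Computable.snd)
      (hg.comp Computable.fst (Computable.snd.comp Computable.snd)))
  refine this.of_eq fun a => ?_
  have : ∀ (l : List β) (s : List σ), l.foldl (fun s b => s ++ [g a b]) s = s ++ l.map (g a) := by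
    intro l; induction l with
    | nil => simp
    | cons b l ih => intro s; simp [ih]
  simpa using this (f a) []

theorem Computable.list_flatMap {f : α → List β} {g : α → β → List σ}
    (hf : Computable f) (hg : Computable₂ g) : Computable fun a => (f a).flatMap (g a) := by
  have := Computable.list_foldl (g := fun _ => ([] : List σ))
    (h := fun a p => p.1 ++ g a p.2) hf (Computable.const _)
    (Computable.list_append.comp (Computable.fst.comp Computable.snd)
      (hg.comp Computable.fst (Computable.snd.comp Computable.snd)))
  refine this.of_eq fun a => ?_
  have : ∀ (l : List β) (s : List σ), l.foldl (fun s b => s ++ g a b) s = s ++ l.flatMap (g a) := by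
    intro l; induction l with
    | nil => simp
    | cons b l ih => intro s; simp [ih]
  simpa using this (f a) []

theorem ComputablePred.comp {p : β → Prop} {f : α → β} (hp : ComputablePred p)
    (hf : Computable f) : ComputablePred fun a => p (f a) := by
  obtain ⟨_, hp⟩ := hp
  exact ⟨fun a => inferInstance, hp.comp hf⟩

theorem ComputablePred.and {p q : α → Prop} (hp : ComputablePred p) (hq : ComputablePred q) :
    ComputablePred fun a => p a ∧ q a := by
  obtain ⟨_, hp⟩ := hp
  obtain ⟨_, hq⟩ := hq
  exact ⟨fun a => inferInstance, (Primrec.and.to_comp.comp hp hq).of_eq fun a => by simp⟩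

theorem ComputablePred.or {p q : α → Prop} (hp : ComputablePred p) (hq : ComputablePred q) :
    ComputablePred fun a => p a ∨ q a := by
  obtain ⟨_, hp⟩ := hp
  obtain ⟨_, hq⟩ := hq
  exact ⟨fun a => inferInstance, (Primrec.or.to_comp.comp hp hq).of_eq fun a => by simp⟩

theorem ComputablePred.forall_mem {f : α → List β} {p : α → β → Prop} (hf : Computable f)
    (hp : ComputablePred fun x : α × β => p x.1 x.2) :
    ComputablePred fun a => ∀ b ∈ f a, p a b := by
  classical
  replace hp := hp.decide
  refine ⟨fun a => inferInstance, ?_⟩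
  have := Computable.list_foldl (g := fun _ => true) (h := fun a q => q.1 && decide (p a q.2)) hf
    (Computable.const _) (Primrec.and.to_comp.comp (Computable.fst.comp Computable.snd)
      (hp.comp (Computable.fst.pair (Computable.snd.comp Computable.snd))))
  refine this.of_eq fun a => ?_
  have : ∀ (l : List β) (s : Bool), l.foldl (fun s b => s && decide (p a b)) s =
      (s && decide (∀ b ∈ l, p a b)) := by
    intro l; induction l with
    | nil => simp
    | cons b l ih => intro s; simp [ih, Bool.and_assoc]
  simpa using this (f a) true

theorem ComputablePred.exists_mem {f : α → List β} {p : α → β → Prop} (hf : Computable f)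
    (hp : ComputablePred fun x : α × β => p x.1 x.2) :
    ComputablePred fun a => ∃ b ∈ f a, p a b :=
  (ComputablePred.forall_mem (p := fun a b => ¬ p a b) hf hp.not).not.of_eq fun a => by
    push Not; rfl

theorem ComputablePred.eq {f g : α → β} (hf : Computable f) (hg : Computable g) :
    ComputablePred fun a => f a = g a := by
  classical
  exact (Primrec.eq (α := β)).computablePred.comp (hf.pair hg)

/-- Semi-decidable predicates, presented as projections of decidable ones. -/
def Semidecidable (p : α → Prop) : Prop :=
  ∃ c : α → ℕ → Prop, (ComputablePred fun x : α × ℕ => c x.1 x.2) ∧ ∀ a, p a ↔ ∃ k, c a k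

namespace Semidecidable

theorem of_eq {p q : α → Prop} (hp : Semidecidable p) (h : ∀ a, p a ↔ q a) : Semidecidable q := by
  obtain rfl : p = q := funext fun a => propext (h a)
  exact hp

theorem of_computable {p : α → Prop} (hp : ComputablePred p) : Semidecidable p :=
  ⟨fun a _ => p a, hp.comp Computable.fst, fun a => by simp⟩

/-- A witness and the stage confirming it are packed into one natural number; numbers that decode to
no witness contribute nothing. -/
theorem exists_ {p : α → β → Prop} (hp : Semidecidable fun x : α × β => p x.1 x.2) :
    Semidecidable fun a => ∃ b, p a b := by
  obtain ⟨c, hc, h⟩ := hp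
  refine ⟨fun a k => ∃ b ∈ (Encodable.decode (α := β) k.unpair.1).toList, c (a, b) k.unpair.2, ?_, ?_⟩
  · have hu : Computable fun x : α × ℕ => x.2.unpair := Computable.unpair.comp Computable.snd
    refine ComputablePred.exists_mem (p := fun (x : α × ℕ) b => c (x.1, b) x.2.unpair.2) ?_ ?_
    · exact Primrec.optionToList.to_comp.comp (Computable.decode.comp (Computable.fst.comp hu))
    · exact hc.comp (((Computable.fst.comp Computable.fst).pair Computable.snd).pair
        (Computable.snd.comp (hu.comp Computable.fst)))
  · intro a
    constructor
    · rintro ⟨b, hb⟩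
      obtain ⟨k, hk⟩ := (h (a, b)).1 hb
      exact ⟨Nat.pair (Encodable.encode b) k, b, by simp, by simpa using hk⟩
    · rintro ⟨k, b, -, hk⟩
      exact ⟨b, (h (a, b)).2 ⟨_, hk⟩⟩

theorem and {p q : α → Prop} (hp : Semidecidable p) (hq : Semidecidable q) :
    Semidecidable fun a => p a ∧ q a := by
  obtain ⟨c, hc, h⟩ := hp
  obtain ⟨c', hc', h'⟩ := hq
  have hp : Semidecidable fun x : α × ℕ × ℕ => c x.1 x.2.1 ∧ c' x.1 x.2.2 :=
    of_computable ((hc.comp (Computable.fst.pair (Computable.fst.comp Computable.snd))).and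
      (hc'.comp (Computable.fst.pair (Computable.snd.comp Computable.snd))))
  refine (exists_ (p := fun a (k : ℕ × ℕ) => c a k.1 ∧ c' a k.2) hp).of_eq fun a => ?_
  rw [h, h']
  exact ⟨fun ⟨k, h1, h2⟩ => ⟨⟨_, h1⟩, ⟨_, h2⟩⟩, fun ⟨⟨k, h1⟩, ⟨l, h2⟩⟩ => ⟨(k, l), h1, h2⟩⟩

theorem forall_mem {f : α → List β} {p : α → β → Prop} (hf : Computable f)
    (hp : Semidecidable fun x : α × β => p x.1 x.2) : Semidecidable fun a => ∀ b ∈ f a, p a b := by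
  obtain ⟨c, hc, h⟩ := hp
  refine ⟨fun a k => ∀ b ∈ f a, ∃ i ∈ List.range k, c (a, b) i, ?_, fun a => ?_⟩
  · refine ComputablePred.forall_mem (p := fun (x : α × ℕ) b => ∃ i ∈ List.range x.2, c (x.1, b) i)
      (hf.comp Computable.fst) ?_
    refine ComputablePred.exists_mem
      (p := fun (x : (α × ℕ) × β) i => c (x.1.1, x.2) i)
      (Primrec.list_range.to_comp.comp (Computable.snd.comp Computable.fst)) ?_
    exact hc.comp (((Computable.fst.comp (Computable.fst.comp Computable.fst)).pair
      (Computable.snd.comp Computable.fst)).pair Computable.snd)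
  · simp only [h (a, _)]
    constructor
    · intro H
      choose! k hk using fun b hb => (H b hb)
      classical
      -- The list is finite, so one bound exceeds all confirming stages.
      refine ⟨(f a).toFinset.sup k + 1, fun b hb => ⟨k b, ?_, hk b hb⟩⟩
      have : k b ≤ (f a).toFinset.sup k := Finset.le_sup (by simpa using hb)
      simp; omega
    · rintro ⟨k, H⟩ b hb
      obtain ⟨i, -, hi⟩ := H b hb
      exact ⟨i, hi⟩

theorem imp {p q : α → Prop} (hp : ComputablePred p) (hq : Semidecidable q) :
    Semidecidable fun a => p a → q a := by
  obtain ⟨c, hc, h⟩ := hq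
  refine ⟨fun a k => ¬ p a ∨ c a k, ((hp.comp Computable.fst).not).or hc, fun a => ?_⟩
  change (p a → q a) ↔ ∃ k, ¬ p a ∨ c a k
  rw [h]
  by_cases ha : p a <;> simp [ha]

theorem rePred {p : α → Prop} (hp : Semidecidable p) : REPred p := by
  classical
  obtain ⟨c, hc, h⟩ := hp
  replace hc := hc.decide
  have := Partrec.rfind (p := fun (a : α) (k : ℕ) => Part.some (decide (c a k))) hc.partrec
  refine this.dom_re.of_eq fun a => ?_
  rw [h]
  refine Nat.rfind_dom.trans ?_
  constructor
  · rintro ⟨n, hn, -⟩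
    exact ⟨n, by simpa using hn⟩
  · rintro ⟨n, hn⟩
    exact ⟨n, by simpa using hn, fun _ => trivial⟩

/-- Post's theorem. -/
theorem computablePred {p : α → Prop} (hp : Semidecidable p) (hn : Semidecidable fun a => ¬ p a) :
    ComputablePred p :=
  ComputablePred.computable_iff_re_compl_re'.2 ⟨hp.rePred, hn.rePred⟩

end Semidecidable

end Computability

/-! ### Comparisons, their homomorphisms and their lexicographic products. -/

/-- A comparison on `X`: `code x y` records how `x` and `y` are related. -/
structure Cmp (X : Type*) where
  code : X → X → ℕ
  code_eq_zero : ∀ x y, code x y = 0 ↔ x = y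

namespace Cmp

variable {X Y Z X' Z' : Type*}

/-- The comparison of a linear order: `1` for less, `0` for equal, `2` for greater. -/
def ofOrder (X : Type*) [LinearOrder X] : Cmp X where
  code x y := if x < y then 1 else if x = y then 0 else 2
  code_eq_zero x y := by
    split_ifs with h h'
    · simp [h.ne]
    · simp [h']
    · simp [h']

/-- The comparison pulled back along an injection. -/
def comap (C : Cmp Z) (f : X → Z) (hf : Function.Injective f) : Cmp X where
  code x y := C.code (f x) (f y)
  code_eq_zero x y := by rw [C.code_eq_zero, hf.eq_iff]

open Classical in
/-- The lexicographic product of two comparisons. -/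
noncomputable def prod (C : Cmp X) (D : Cmp Z) : Cmp (X × Z) where
  -- The residue modulo 3 tells whether the first coordinates agree. The parity is that of the
  -- deciding factor's code, so odd codes keep meaning "less".
  code p q := if p.1 = q.1 then 3 * D.code p.2 q.2 else 3 * C.code p.1 q.1 + 2
  code_eq_zero p q := by
    have := D.code_eq_zero p.2 q.2
    split_ifs with h
    · simp only [Prod.ext_iff, h, true_and, ← this]; omega
    · simp [Prod.ext_iff, h]

theorem prod_code_of_eq (C : Cmp X) (D : Cmp Z) {p q : X × Z} (h : p.1 = q.1) :
    (C.prod D).code p q = 3 * D.code p.2 q.2 := if_pos h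

theorem prod_code_of_ne (C : Cmp X) (D : Cmp Z) {p q : X × Z} (h : p.1 ≠ q.1) :
    (C.prod D).code p q = 3 * C.code p.1 q.1 + 2 := if_neg h

theorem code_self (C : Cmp X) (x : X) : C.code x x = 0 := (C.code_eq_zero x x).2 rfl

/-- `h` preserves the comparison on `S`. -/
def HomOn (C : Cmp X) (D : Cmp Z) (S : Set X) (h : X → Z) : Prop :=
  ∀ x ∈ S, ∀ y ∈ S, D.code (h x) (h y) = C.code x y

theorem HomOn.mono {C : Cmp X} {D : Cmp Z} {S T : Set X} {h : X → Z} (hh : HomOn C D T h)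
    (hST : S ⊆ T) : HomOn C D S h := fun x hx y hy => hh x (hST hx) y (hST hy)

theorem HomOn.comp {C : Cmp X} {D : Cmp Y} {E : Cmp Z} {S : Set X} {T : Set Y} {g : Y → Z}
    {h : X → Y} (hg : HomOn D E T g) (hh : HomOn C D S h) (hST : Set.MapsTo h S T) :
    HomOn C E S (g ∘ h) := fun x hx y hy =>
  (hg _ (hST hx) _ (hST hy)).trans (hh x hx y hy)

theorem HomOn.comp_univ {C : Cmp X} {D : Cmp Y} {E : Cmp Z} {S : Set X} {g : Y → Z}
    {h : X → Y} (hg : HomOn D E Set.univ g) (hh : HomOn C D S h) : HomOn C E S (g ∘ h) :=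
  hg.comp hh (Set.mapsTo_univ _ _)

theorem HomOn.congr {C : Cmp X} {D : Cmp Z} {S : Set X} {g h : X → Z} (hh : HomOn C D S h)
    (hgh : ∀ x ∈ S, g x = h x) : HomOn C D S g := fun x hx y hy => by
  rw [hgh x hx, hgh y hy, hh x hx y hy]

theorem homOn_id (C : Cmp X) (S : Set X) : HomOn C C S id := fun _ _ _ _ => rfl

theorem HomOn.eq_iff {C : Cmp X} {D : Cmp Z} {S : Set X} {h : X → Z} (hh : HomOn C D S h)
    {x y : X} (hx : x ∈ S) (hy : y ∈ S) : h x = h y ↔ x = y := by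
  rw [← D.code_eq_zero, hh x hx y hy, C.code_eq_zero]

theorem HomOn.injective {C : Cmp X} {D : Cmp Z} {h : X → Z} (hh : HomOn C D Set.univ h) :
    Function.Injective h := fun _ _ hxy => (hh.eq_iff (Set.mem_univ _) (Set.mem_univ _)).1 hxy

theorem HomOn.of_leftInverse {C : Cmp X} {D : Cmp Z} {S : Set X} {c : X → Z} {σ : Z → X}
    (hσ : HomOn D C Set.univ σ) (h : ∀ s ∈ S, σ (c s) = s) : HomOn C D S c := fun x hx y hy => by
  rw [← hσ _ (Set.mem_univ _) _ (Set.mem_univ _), h x hx, h y hy]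

theorem homOn_ofOrder_iff [LinearOrder X] [LinearOrder Z] {S : Set X} {h : X → Z} :
    HomOn (ofOrder X) (ofOrder Z) S h ↔ StrictMonoOn h S := by
  constructor
  · intro H x hx y hy hxy
    have := H x hx y hy
    simp only [ofOrder, if_pos hxy] at this
    split_ifs at this with h1 h2
    · exact h1
    · omega
  · intro H x hx y hy
    simp only [ofOrder, H.lt_iff_lt hx hy, H.injOn.eq_iff hx hy]

/-- The fibre map `ρ x` may depend on `x`, because second coordinates are only ever compared within
one fibre. -/
theorem HomOn.prod {C : Cmp X} {D : Cmp Z} {C' : Cmp X'} {D' : Cmp Z'} {U : Set (X × Z)}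
    {S : Set X} {T : X → Set Z} {π : X → X'} {ρ : X → Z → Z'} (hπ : HomOn C C' S π)
    (hρ : ∀ x ∈ S, HomOn D D' (T x) (ρ x)) (hU : ∀ p ∈ U, p.1 ∈ S ∧ p.2 ∈ T p.1) :
    HomOn (C.prod D) (C'.prod D') U (fun p => (π p.1, ρ p.1 p.2)) := by
  intro p hp q hq
  obtain ⟨hp1, hp2⟩ := hU p hp
  obtain ⟨hq1, hq2⟩ := hU q hq
  by_cases h : p.1 = q.1
  · rw [prod_code_of_eq _ _ h, prod_code_of_eq _ _ (by simp [h])]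
    simp only [h] at hp2 ⊢
    rw [hρ _ hq1 _ hp2 _ hq2]
  · rw [prod_code_of_ne _ _ h, prod_code_of_ne _ _ (by simpa [hπ.eq_iff hp1 hq1] using h),
      hπ _ hp1 _ hq1]

section fibers

variable {C : Cmp X} {D : Cmp Z} {C' : Cmp X'} {D' : Cmp Z'} {S : Set X} {T : Set Z}
  {h : X × Z → X' × Z'}

/-- The residue of a product code modulo 3 is preserved. With `HomOn.fst` and `HomOn.snd` this
splits a homomorphism on a box into a base map and fibre maps, a converse to `HomOn.prod`. -/
theorem HomOn.fst_eq_iff (hh : HomOn (C.prod D) (C'.prod D') (S ×ˢ T) h) {p q : X × Z}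
    (hp : p ∈ S ×ˢ T) (hq : q ∈ S ×ˢ T) : (h p).1 = (h q).1 ↔ p.1 = q.1 := by
  have := hh p hp q hq
  by_cases h1 : p.1 = q.1 <;> by_cases h2 : (h p).1 = (h q).1
  · simp [h1, h2]
  · rw [prod_code_of_eq _ _ h1, prod_code_of_ne _ _ h2] at this; omega
  · rw [prod_code_of_ne _ _ h1, prod_code_of_eq _ _ h2] at this; omega
  · simp [h1, h2]

theorem HomOn.fst (hh : HomOn (C.prod D) (C'.prod D') (S ×ˢ T) h) {t : Z} (ht : t ∈ T) :
    HomOn C C' S (fun x => (h (x, t)).1) := by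
  intro x hx y hy
  have := hh (x, t) ⟨hx, ht⟩ (y, t) ⟨hy, ht⟩
  have h1 := hh.fst_eq_iff (p := (x, t)) (q := (y, t)) ⟨hx, ht⟩ ⟨hy, ht⟩
  by_cases hxy : x = y
  · subst hxy; rw [code_self, code_self]
  · rw [prod_code_of_ne C D (p := (x, t)) (q := (y, t)) hxy,
      prod_code_of_ne C' D' (by rwa [Ne, h1])] at this
    dsimp only at this ⊢
    omega

theorem HomOn.snd (hh : HomOn (C.prod D) (C'.prod D') (S ×ˢ T) h) {x : X} (hx : x ∈ S) :
    HomOn D D' T (fun z => (h (x, z)).2) := by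
  intro y hy z hz
  have := hh (x, y) ⟨hx, hy⟩ (x, z) ⟨hx, hz⟩
  rw [prod_code_of_eq C D (p := (x, y)) (q := (x, z)) rfl, prod_code_of_eq C' D'
    ((hh.fst_eq_iff (p := (x, y)) (q := (x, z)) ⟨hx, hy⟩ ⟨hx, hz⟩).2 rfl)] at this
  dsimp only at this ⊢
  omega

end fibers

end Cmp

/-! ### Arenas: finite orders and lexicographic products. -/

open Cmp

/-- Domination between labelled windows: an embedding carries the points of the first window to
points of the second one with larger labels. -/
def WindowLE {X W : Type} (C : Cmp X) (win : ℕ → List X) (R : W → W → Prop)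
    (a b : ℕ × (X → W)) : Prop :=
  ∃ κ, HomOn C C Set.univ κ ∧ ∀ x ∈ win a.1, κ x ∈ win b.1 ∧ R (a.2 x) (b.2 (κ x))

/-- Being a preorder, window domination can itself be the relation on labels; the
well-quasi-ordering of a product is obtained by this nesting. -/
instance WindowLE.isPreorder {X W : Type} (C : Cmp X) (win : ℕ → List X) (R : W → W → Prop)
    [IsPreorder W R] : IsPreorder (ℕ × (X → W)) (WindowLE C win R) where
  refl a := ⟨id, homOn_id _ _, fun x hx => ⟨hx, refl_of R _⟩⟩
  trans := by
    rintro a b c ⟨κ, hκ, h⟩ ⟨τ, hτ, h'⟩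
    exact ⟨τ ∘ κ, hτ.comp_univ hκ, fun x hx => ⟨(h' _ (h x hx).1).1,
      trans_of R (h x hx).2 (h' _ (h x hx).1).2⟩⟩

/-- A well-ordered set of variables with its monoid of embeddings, exhibited by finite windows
which are computably enumerated. -/
structure Arena {X : Type} [Primcodable X] (C : Cmp X) where
  /-- The windows. -/
  win : ℕ → List X
  /-- Values which suffice for embeddings of a window hitting given points. -/
  cand : ℕ → List X → List X
  code_primrec : Primrec₂ C.code
  win_primrec : Primrec win
  cand_primrec : Primrec₂ cand
  -- An odd code stands for "less"; the fields `wf`, `trans` and `tri` make this a well-order.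
  wf : WellFounded fun x y => C.code x y % 2 = 1
  trans : ∀ x y z, C.code x y % 2 = 1 → C.code y z % 2 = 1 → C.code x z % 2 = 1
  tri : ∀ x y, C.code x y % 2 = 1 ∨ x = y ∨ C.code y x % 2 = 1
  win_mono : ∀ m n, m ≤ n → ∀ x ∈ win m, x ∈ win n
  -- For polynomials in a window, embeddings matter only through their finite tables on it. By this
  -- field every order-preserving table is allowed, so the relevant tables form a decidable set.
  ext : ∀ (n : ℕ) (φ : X → X), HomOn C C {x | x ∈ win n} φ →
    ∃ κ : X → X, HomOn C C Set.univ κ ∧ ∀ x ∈ win n, κ x = φ x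
  -- Finitely many points anywhere are the image under an embedding of points in a window whose
  -- index depends only on their number.
  compress : ∀ S : Finset X, ∃ c σ : X → X, HomOn C C Set.univ σ ∧
    ∀ s ∈ S, c s ∈ win S.card ∧ σ (c s) = s
  -- Makes divisibility by a renamed monomial a finite search: with `V` the variables of the
  -- dividend, only the values of `κ` inside `V` matter, and the others can be replaced by members
  -- of a computable list.
  cand_spec : ∀ (r : ℕ) (V : List X) (κ : X → X), HomOn C C Set.univ κ →
    ∃ κ' : X → X, HomOn C C {x | x ∈ win r} κ' ∧
    ∀ x ∈ win r, κ' x ∈ cand r V ∧ (κ x ∈ V → κ' x = κ x)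
  wqo : ∀ {W : Type} (R : W → W → Prop) [IsPreorder W R], WellQuasiOrdered R →
    WellQuasiOrdered (WindowLE C win R)

namespace Arena

/-- The arena of a finite order, with all points in every window. -/
def fin (d : ℕ) : Arena (Cmp.ofOrder (Fin d)) where
  win _ := List.finRange d
  cand _ _ := List.finRange d
  code_primrec := by
    refine Primrec.ite (c := fun p : Fin d × Fin d => p.1 < p.2) ?_ (Primrec.const 1)
      (Primrec.ite (Primrec.eq (α := Fin d)) (Primrec.const 0) (Primrec.const 2))
    exact (Primrec.nat_lt.comp (Primrec.fin_val.comp Primrec.fst)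
      (Primrec.fin_val.comp Primrec.snd)).of_eq fun _ => Iff.rfl
  win_primrec := Primrec.const _
  cand_primrec := Primrec.const _
  wf := by
    refine Subrelation.wf (r := (· < ·)) (fun {x y} h => ?_) wellFounded_lt
    simp only [ofOrder] at h
    split_ifs at h with h1
    exact h1
  trans x y z h1 h2 := by
    simp only [ofOrder] at h1 h2 ⊢
    split_ifs at h1 h2 with h3 h4
    simp [h3.trans h4]
  tri x y := by
    rcases lt_trichotomy x y with h | h | h <;> simp [ofOrder, h]
  win_mono _ _ _ _ h := h
  ext n φ h := ⟨φ, h.mono (by simp), fun _ _ => rfl⟩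
  compress S := ⟨id, id, homOn_id _ _, by simp⟩
  cand_spec r V κ h := ⟨κ, h.mono (by simp), by simp⟩
  wqo {W} R _ hR := by
    intro f
    -- Finite products of well-quasi-orders are well-quasi-ordered, so the identity embedding
    -- suffices.
    obtain ⟨m, n, hmn, h⟩ := WellQuasiOrdered.pi (fun _ : Fin d => hR) fun n => (f n).2
    exact ⟨m, n, hmn, id, homOn_id _ _, fun x _ => ⟨by simp, h x⟩⟩

/-- The lexicographic product of two arenas. -/
noncomputable def prod {X Z : Type} [Primcodable X] [Primcodable Z] {C : Cmp X} {D : Cmp Z}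
    (A : Arena C) (B : Arena D) : Arena (C.prod D) where
  win n := A.win n ×ˢ B.win n
  cand r V := A.cand r (V.map Prod.fst) ×ˢ B.cand r (V.map Prod.snd)
  code_primrec := by
    classical
    refine Primrec.ite (c := fun p : (X × Z) × (X × Z) => p.1.1 = p.2.1)
      (Primrec.eq.comp (Primrec.fst.comp Primrec.fst) (Primrec.fst.comp Primrec.snd)) ?_ ?_
    · exact Primrec.nat_mul.comp (Primrec.const 3)
        (B.code_primrec.comp (Primrec.snd.comp Primrec.fst) (Primrec.snd.comp Primrec.snd))
    · exact Primrec.nat_add.comp (Primrec.nat_mul.comp (Primrec.const 3)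
        (A.code_primrec.comp (Primrec.fst.comp Primrec.fst) (Primrec.fst.comp Primrec.snd)))
        (Primrec.const 2)
  win_primrec := by
    refine Primrec.list_flatMap A.win_primrec ?_
    exact Primrec.list_map (B.win_primrec.comp Primrec.fst)
      ((Primrec.snd.comp Primrec.fst).pair Primrec.snd)
  cand_primrec := by
    have h1 : Primrec fun p : ℕ × List (X × Z) => A.cand p.1 (p.2.map Prod.fst) :=
      A.cand_primrec.comp Primrec.fst
        (Primrec.list_map Primrec.snd (Primrec.fst.comp Primrec.snd))
    have h2 : Primrec fun p : ℕ × List (X × Z) => B.cand p.1 (p.2.map Prod.snd) :=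
      B.cand_primrec.comp Primrec.fst
        (Primrec.list_map Primrec.snd (Primrec.snd.comp Primrec.snd))
    refine Primrec.list_flatMap h1 ?_
    exact Primrec.list_map (h2.comp Primrec.fst) ((Primrec.snd.comp Primrec.fst).pair Primrec.snd)
  wf := by
    refine Subrelation.wf (fun {p q} h => ?_) (WellFounded.prod_lex A.wf B.wf)
    by_cases h1 : p.1 = q.1
    · rw [prod_code_of_eq _ _ h1] at h
      obtain ⟨a, b⟩ := p
      obtain ⟨a', b'⟩ := q
      obtain rfl : a = a' := h1
      exact Prod.Lex.right _ (by dsimp only at h; omega)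
    · rw [prod_code_of_ne _ _ h1] at h
      exact Prod.lex_iff.2 (Or.inl (by omega))
  trans p q r h1 h2 := by
    have ha := A.trans p.1 q.1 r.1
    have hb := B.trans p.2 q.2 r.2
    have hw : ∀ x y, C.code x y % 2 = 1 → ¬ C.code y x % 2 = 1 :=
      fun x y => A.wf.asymm.asymm x y
    by_cases h3 : p.1 = q.1 <;> by_cases h4 : q.1 = r.1
    · rw [prod_code_of_eq _ _ h3] at h1
      rw [prod_code_of_eq _ _ h4] at h2
      rw [prod_code_of_eq _ _ (h3.trans h4)]
      omega
    · rw [prod_code_of_ne _ _ h4] at h2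
      rw [prod_code_of_ne _ _ (h3.trans_ne h4), h3]
      omega
    · rw [prod_code_of_ne _ _ h3] at h1
      rw [prod_code_of_ne _ _ (h4 ▸ h3), ← h4]
      omega
    · rw [prod_code_of_ne _ _ h3] at h1
      rw [prod_code_of_ne _ _ h4] at h2
      have h5 : p.1 ≠ r.1 := fun h5 => hw p.1 q.1 (by omega) (by rw [h5]; omega)
      rw [prod_code_of_ne _ _ h5]
      omega
  tri p q := by
    by_cases h : p.1 = q.1
    · rw [prod_code_of_eq _ _ h, prod_code_of_eq _ _ h.symm, Prod.ext_iff]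
      simp only [h, true_and]
      rcases B.tri p.2 q.2 with h | h | h
      · exact Or.inl (by omega)
      · exact Or.inr (Or.inl h)
      · exact Or.inr (Or.inr (by omega))
    · rw [prod_code_of_ne _ _ h, prod_code_of_ne _ _ (Ne.symm h)]
      rcases A.tri p.1 q.1 with h' | h' | h'
      · exact Or.inl (by omega)
      · exact (h h').elim
      · exact Or.inr (Or.inr (by omega))
  win_mono m n hmn p hp := by
    rw [List.mem_product] at hp ⊢
    exact ⟨A.win_mono m n hmn _ hp.1, B.win_mono m n hmn _ hp.2⟩
  ext n φ hφ := by
    classical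
    by_cases hne : ∃ t, t ∈ B.win n
    · obtain ⟨t, ht⟩ := hne
      have hφ' : HomOn (C.prod D) (C.prod D) ({x | x ∈ A.win n} ×ˢ {z | z ∈ B.win n}) φ :=
        hφ.mono fun p hp => List.mem_product.2 hp
      obtain ⟨π, hπ, hπ'⟩ := A.ext n _ (hφ'.fst ht)
      have : Nonempty (Z → Z) := ⟨id⟩
      choose! ρ hρ hρ' using fun (x : X) (hx : x ∈ A.win n) => B.ext n _ (hφ'.snd hx)
      -- Fibres outside the window are unconstrained and receive the identity.
      refine ⟨fun p => (π p.1, (if p.1 ∈ A.win n then ρ p.1 else id) p.2),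
        hπ.prod (ρ := fun x => if x ∈ A.win n then ρ x else id) (T := fun _ => Set.univ)
          (fun x _ => ?_) (fun p _ => ⟨trivial, trivial⟩), ?_⟩
      · split_ifs with h
        · exact hρ x h
        · exact homOn_id _ _
      · rintro ⟨x, z⟩ hp
        rw [List.mem_product] at hp
        refine Prod.ext ?_ ?_
        · dsimp only
          rw [hπ' x hp.1]
          exact (hφ'.fst_eq_iff (p := (x, t)) (q := (x, z)) ⟨hp.1, ht⟩ hp).2 rfl
        · simp only [if_pos hp.1]
          exact hρ' x hp.1 z hp.2
    · exact ⟨id, homOn_id _ _, fun x hx => (hne ⟨x.2, (List.mem_product.1 hx).2⟩).elim⟩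
  compress S := by
    classical
    obtain ⟨c, σ, hσ, hc⟩ := A.compress (S.image Prod.fst)
    choose c' σ' hσ' hc' using fun x => B.compress ((S.filter fun p => p.1 = x).image Prod.snd)
    -- Each fibre is compressed separately. Decompression has to use the fibre of the original first
    -- coordinate, which is recovered as `σ p.1`.
    refine ⟨fun p => (c p.1, c' p.1 p.2), fun p => (σ p.1, σ' (σ p.1) p.2),
      hσ.prod (ρ := fun x => σ' (σ x)) (T := fun _ => Set.univ) (fun x _ => hσ' _)
        (fun p _ => ⟨trivial, trivial⟩), ?_⟩
    intro s hs
    have h1 := hc s.1 (Finset.mem_image_of_mem _ hs)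
    have h2 := hc' s.1 s.2 (Finset.mem_image.2 ⟨s, by simp [hs], rfl⟩)
    refine ⟨List.mem_product.2 ⟨A.win_mono _ _ Finset.card_image_le _ h1.1,
      B.win_mono _ _ (Finset.card_image_le.trans (Finset.card_filter_le _ _)) _ h2.1⟩, ?_⟩
    dsimp only
    rw [h1.2, h2.2]
  cand_spec r V κ hκ := by
    by_cases hne : ∃ t, t ∈ B.win r
    · obtain ⟨t, ht⟩ := hne
      rw [← Set.univ_prod_univ] at hκ
      obtain ⟨π, hπ, hπ'⟩ := A.cand_spec r (V.map Prod.fst) _ (hκ.fst (Set.mem_univ t))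
      choose ρ hρ hρ' using fun (x : X) =>
        B.cand_spec r (V.map Prod.snd) _ (hκ.snd (Set.mem_univ x))
      refine ⟨fun p => (π p.1, ρ p.1 p.2), hπ.prod (T := fun _ => {z | z ∈ B.win r})
          (fun x _ => hρ x) (fun p hp => List.mem_product.1 hp), ?_⟩
      rintro ⟨x, z⟩ hp
      rw [List.mem_product] at hp
      have h1 := hπ' x hp.1
      have h2 := hρ' x z hp.2
      -- The base map was read off along the slice at `t`, but the first coordinate of `κ (x, z)`
      -- does not depend on `z`.
      have h3 : (κ (x, t)).1 = (κ (x, z)).1 :=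
        (hκ.fst_eq_iff (p := (x, t)) (q := (x, z)) (by simp) (by simp)).2 rfl
      refine ⟨List.mem_product.2 ⟨h1.1, h2.1⟩, fun hV => Prod.ext ?_ ?_⟩
      · exact (h1.2 (by rw [h3]; exact List.mem_map_of_mem hV)).trans h3
      · exact h2.2 (List.mem_map_of_mem hV)
    · exact ⟨id, homOn_id _ _, fun x hx => (hne ⟨x.2, (List.mem_product.1 hx).2⟩).elim⟩
  wqo {W} R _ hR := by
    classical
    intro f
    -- The label of a base point is the labelled `B`-window lying over it.
    obtain ⟨m, n, hmn, π, hπ, h⟩ := A.wqo _ (B.wqo R hR)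
      fun n => ((f n).1, fun x => ((f n).1, fun z => (f n).2 (x, z)))
    have : Nonempty (Z → Z) := ⟨id⟩
    choose! ρ hρ using fun (x : X) (hx : x ∈ A.win (f m).1) => (h x hx).2
    refine ⟨m, n, hmn, fun p => (π p.1, (if p.1 ∈ A.win (f m).1 then ρ p.1 else id) p.2),
        hπ.prod (ρ := fun x => if x ∈ A.win (f m).1 then ρ x else id) (T := fun _ => Set.univ)
          (fun x _ => ?_) (fun p _ => ⟨trivial, trivial⟩), ?_⟩
    · split_ifs with hx
      · exact (hρ x hx).1
      · exact homOn_id _ _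
    · rintro ⟨x, z⟩ hp
      rw [List.mem_product] at hp
      have := (hρ x hp.1).2 z hp.2
      simp only [if_pos hp.1]
      exact ⟨List.mem_product.2 ⟨(h x hp.1).1, this.1⟩, this.2⟩

end Arena

/-! ### The arena of ω². -/

namespace Arena

/-- The comparison of pairs of natural numbers as elements of `ω²`. -/
def lexCmp : Cmp (ℕ × ℕ) := (Cmp.ofOrder (ℕ ×ₗ ℕ)).comap toLex toLex.injective

theorem homOn_lexCmp_iff {S : Set (ℕ × ℕ)} {h : ℕ × ℕ → ℕ × ℕ} :
    HomOn lexCmp lexCmp S h ↔ ∀ x ∈ S, ∀ y ∈ S, toLex x < toLex y → toLex (h x) < toLex (h y) := by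
  have : HomOn lexCmp lexCmp S h ↔ HomOn (Cmp.ofOrder (ℕ ×ₗ ℕ)) (Cmp.ofOrder (ℕ ×ₗ ℕ))
      {x | ofLex x ∈ S} (fun x => toLex (h (ofLex x))) := Iff.rfl
  rw [this, homOn_ofOrder_iff]
  rfl

theorem lexCmp_code_odd {x y : ℕ × ℕ} : lexCmp.code x y % 2 = 1 ↔ toLex x < toLex y := by
  simp only [lexCmp, comap, ofOrder]
  split_ifs with h h' <;> simp [h]

theorem toLex_pair_lt {a b c d : ℕ} : toLex (a, b) < toLex (c, d) ↔ a < c ∨ a = c ∧ b < d :=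
  Prod.Lex.lt_iff

/-- The first `n` points of `ω²`. -/
def initial (n : ℕ) : List (ℕ × ℕ) := (List.range n).map fun b => (0, b)

theorem mem_initial {n : ℕ} {x : ℕ × ℕ} : x ∈ initial n ↔ x.1 = 0 ∧ x.2 < n := by
  obtain ⟨a, b⟩ := x
  simp [initial, eq_comm, and_comm]

/-- The image of the finite segment lies below some ω · A. All remaining points are moved up by `A`
rows, past this image. -/
theorem exists_extension_lexCmp (n : ℕ) (φ : ℕ × ℕ → ℕ × ℕ)
    (hφ : HomOn lexCmp lexCmp {x | x ∈ initial n} φ) :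
    ∃ κ : ℕ × ℕ → ℕ × ℕ, HomOn lexCmp lexCmp Set.univ κ ∧ ∀ x ∈ initial n, κ x = φ x := by
  classical
  set A := (Finset.range n).sup (fun b => (φ (0, b)).1) + 1 with hA
  have hA' : ∀ x ∈ initial n, (φ x).1 < A := by
    rintro ⟨a, b⟩ hx
    rw [mem_initial] at hx
    obtain ⟨rfl, hb⟩ := hx
    exact Nat.lt_succ_of_le (Finset.le_sup (f := fun b => (φ (0, b)).1) (Finset.mem_range.2 hb))
  refine ⟨fun x => if x ∈ initial n then φ x else (A + x.1, x.2), ?_, fun x hx => if_pos hx⟩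
  rw [homOn_lexCmp_iff] at hφ ⊢
  rintro x - y - hxy
  by_cases hx : x ∈ initial n <;> by_cases hy : y ∈ initial n
  · simpa only [if_pos hx, if_pos hy] using hφ x hx y hy hxy
  · simp only [if_pos hx, if_neg hy]
    exact Prod.Lex.lt_iff.2 (Or.inl ((hA' x hx).trans_le (Nat.le_add_right _ _)))
  · exfalso
    rw [mem_initial] at hx hy
    have := Prod.Lex.lt_iff.1 hxy
    simp only [ofLex_toLex] at this
    omega
  · simp only [if_neg hx, if_neg hy]
    have := Prod.Lex.lt_iff.1 hxy
    simp only [ofLex_toLex] at this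
    exact toLex_pair_lt.2 (by omega)

/-- The increasing enumeration of `S` is a map from an initial segment, which extends to `σ`; `c`
sends a point to its rank in `S`. -/
theorem exists_compression_lexCmp (S : Finset (ℕ × ℕ)) :
    ∃ c σ : ℕ × ℕ → ℕ × ℕ, HomOn lexCmp lexCmp Set.univ σ ∧
      ∀ s ∈ S, c s ∈ initial S.card ∧ σ (c s) = s := by
  classical
  let S' : Finset (ℕ ×ₗ ℕ) := S.map toLex.toEmbedding
  have hS' : S'.card = S.card := Finset.card_map _
  let e := S'.orderIsoOfFin hS'
  obtain ⟨σ, hσ, h⟩ := exists_extension_lexCmp S.card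
    (fun x => if h : x.2 < S.card then ofLex (e ⟨x.2, h⟩ : ℕ ×ₗ ℕ) else x) (by
      rw [homOn_lexCmp_iff]
      rintro ⟨a, b⟩ hx ⟨a', b'⟩ hy hxy
      obtain ⟨rfl, hx⟩ := mem_initial.1 hx
      obtain ⟨rfl, hy⟩ := mem_initial.1 hy
      simp only [dif_pos hx, dif_pos hy, toLex_ofLex]
      rw [toLex_pair_lt] at hxy
      have : (⟨b, hx⟩ : Fin S.card) < ⟨b', hy⟩ := by simpa using hxy
      exact e.strictMono this)
  have hmem : ∀ s ∈ S, toLex s ∈ S' := fun s hs => Finset.mem_map_of_mem _ hs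
  refine ⟨fun s => if hs : s ∈ S then (0, (e.symm ⟨toLex s, hmem s hs⟩ : Fin S.card)) else s, σ, hσ,
    fun s hs => ?_⟩
  simp only [dif_pos hs]
  have hw : ((0, ((e.symm ⟨toLex s, hmem s hs⟩ : Fin S.card) : ℕ)) : ℕ × ℕ) ∈ initial S.card :=
    mem_initial.2 ⟨rfl, Fin.is_lt _⟩
  refine ⟨hw, ?_⟩
  rw [h _ hw]
  simp

/-- A greedy choice: keep the value of `κ` when it lies in `V`, otherwise take the successor of the
preceding value, starting from zero. The greedy values never exceed those of `κ`, so returning to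
`κ` at the next hit keeps the sequence increasing. Each value lies fewer than `r` steps above zero
or a point of `V`. -/
theorem exists_candidate_lexCmp (r : ℕ) (V : List (ℕ × ℕ)) (κ : ℕ × ℕ → ℕ × ℕ)
    (hκ : HomOn lexCmp lexCmp Set.univ κ) :
    ∃ κ' : ℕ × ℕ → ℕ × ℕ, HomOn lexCmp lexCmp {x | x ∈ initial r} κ' ∧ ∀ x ∈ initial r,
      κ' x ∈ ((0, 0) :: V).flatMap (fun v => (List.range (r + 1)).map fun j => (v.1, v.2 + j)) ∧
        (κ x ∈ V → κ' x = κ x) := by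
  classical
  rw [homOn_lexCmp_iff] at hκ
  have hlt : ∀ b, toLex (κ (0, b)) < toLex (κ (0, b + 1)) := fun b =>
    hκ _ trivial _ trivial (toLex_pair_lt.2 (by omega))
  let f : ℕ → ℕ × ℕ := fun b => Nat.rec (if κ (0, 0) ∈ V then κ (0, 0) else (0, 0))
    (fun b p => if κ (0, b + 1) ∈ V then κ (0, b + 1) else (p.1, p.2 + 1)) b
  have f0 : f 0 = if κ (0, 0) ∈ V then κ (0, 0) else (0, 0) := rfl
  have fs : ∀ b, f (b + 1) = if κ (0, b + 1) ∈ V then κ (0, b + 1) else ((f b).1, (f b).2 + 1) :=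
    fun b => rfl
  have hV : ∀ b, κ (0, b) ∈ V → f b = κ (0, b) := by
    rintro (_ | b) hb
    · rw [f0, if_pos hb]
    · rw [fs, if_pos hb]
  have hle : ∀ b, toLex (f b) ≤ toLex (κ (0, b)) := by
    intro b
    induction b with
    | zero =>
      rw [f0]
      split_ifs
      · exact le_rfl
      · exact Prod.Lex.le_iff.2 (by simp only [ofLex_toLex]; omega)
    | succ b ih =>
      rw [fs]
      split_ifs
      · exact le_rfl
      · have := Prod.Lex.lt_iff.1 (ih.trans_lt (hlt b))
        refine Prod.Lex.le_iff.2 ?_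
        simp only [ofLex_toLex] at this ⊢
        omega
  have hmono : StrictMono fun b => toLex (f b) := by
    refine strictMono_nat_of_lt_succ fun b => ?_
    rw [fs]
    split_ifs with h
    · exact (hle b).trans_lt (hlt b)
    · exact Prod.Lex.lt_iff.2 (Or.inr ⟨rfl, Nat.lt_succ_self _⟩)
  have hmem : ∀ b, ∃ v ∈ (0, 0) :: V, ∃ j ≤ b, f b = (v.1, v.2 + j) := by
    intro b
    induction b with
    | zero =>
      rw [f0]
      split_ifs with h
      · exact ⟨_, List.mem_cons_of_mem _ h, 0, le_rfl, rfl⟩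
      · exact ⟨_, List.mem_cons_self, 0, le_rfl, rfl⟩
    | succ b ih =>
      rw [fs]
      split_ifs with h
      · exact ⟨_, List.mem_cons_of_mem _ h, 0, by omega, rfl⟩
      · obtain ⟨v, hv, j, hj, h⟩ := ih
        exact ⟨v, hv, j + 1, by omega, by rw [h]; rfl⟩
  refine ⟨fun x => f x.2, ?_, ?_⟩
  · rw [homOn_lexCmp_iff]
    rintro ⟨a, b⟩ hx ⟨a', b'⟩ hy hxy
    obtain ⟨rfl, hx⟩ := mem_initial.1 hx
    obtain ⟨rfl, hy⟩ := mem_initial.1 hy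
    rw [toLex_pair_lt] at hxy
    exact hmono (by simpa using hxy)
  · rintro ⟨a, b⟩ hx
    obtain ⟨rfl, hx⟩ := mem_initial.1 hx
    obtain ⟨v, hv, j, hj, h⟩ := hmem b
    refine ⟨?_, hV b⟩
    rw [List.mem_flatMap]
    refine ⟨v, hv, List.mem_map.2 ⟨j, ?_, h.symm⟩⟩
    dsimp only at hx
    rw [List.mem_range]; omega

/-- Higman's lemma: a labelled initial segment is a word, and the positions of a dominating subword
form an increasing map which extends to ω². -/
theorem wellQuasiOrdered_windowLE_lexCmp {W : Type} (R : W → W → Prop) [IsPreorder W R]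
    (hR : WellQuasiOrdered R) : WellQuasiOrdered (WindowLE lexCmp initial R) := by
  classical
  intro f
  have H := Set.PartiallyWellOrderedOn.partiallyWellOrderedOn_sublistForall₂ R
    (Set.partiallyWellOrderedOn_univ_iff.2 hR)
  simp only [Set.mem_univ, implies_true, Set.ofPred_true] at H
  rw [Set.partiallyWellOrderedOn_univ_iff] at H
  obtain ⟨m, n, hmn, h⟩ := H fun n => List.ofFn fun i : Fin (f n).1 => (f n).2 (0, i)
  refine ⟨m, n, hmn, ?_⟩
  obtain ⟨l, h1, h2⟩ := List.sublistForall₂_iff.1 h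
  obtain ⟨g, hg⟩ := List.sublist_iff_exists_fin_orderEmbedding_get_eq.1 h2
  rw [List.forall₂_iff_get] at h1
  obtain ⟨hl, h1⟩ := h1
  rw [List.length_ofFn] at hl
  have hlen : (List.ofFn fun i : Fin (f n).1 => (f n).2 (0, i)).length = (f n).1 :=
    List.length_ofFn
  obtain ⟨κ, hκ, hκ'⟩ := exists_extension_lexCmp (f m).1
    (fun x => if h : x.2 < l.length then (0, (g ⟨x.2, h⟩ : ℕ)) else x) (by
      rw [homOn_lexCmp_iff]
      rintro ⟨a, b⟩ hx ⟨a', b'⟩ hy hxy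
      obtain ⟨rfl, hx⟩ := mem_initial.1 hx
      obtain ⟨rfl, hy⟩ := mem_initial.1 hy
      dsimp only at hx hy
      rw [hl] at hx hy
      simp only [dif_pos hx, dif_pos hy]
      rw [toLex_pair_lt] at hxy ⊢
      have : (⟨b, hx⟩ : Fin l.length) < ⟨b', hy⟩ := by simpa using hxy
      exact Or.inr ⟨rfl, g.strictMono this⟩)
  refine ⟨κ, hκ, ?_⟩
  rintro ⟨a, b⟩ hx
  rw [hκ' _ hx]
  obtain ⟨rfl, hx⟩ := mem_initial.1 hx
  dsimp only at hx
  have hb : b < l.length := hl ▸ hx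
  simp only [dif_pos hb]
  refine ⟨mem_initial.2 ⟨rfl, (g ⟨b, hb⟩).is_lt.trans_eq hlen⟩, ?_⟩
  have h3 := h1 b (by simpa using hx) hb
  rw [hg ⟨b, hb⟩] at h3
  simpa using h3

/-- The arena of the ordinal `ω²`, with finite initial segments as windows. -/
def omegaSq : Arena lexCmp where
  win := initial
  cand r V := ((0, 0) :: V).flatMap fun v => (List.range (r + 1)).map fun j => (v.1, v.2 + j)
  code_primrec := by
    have h : ∀ i : Fin 4, Primrec fun p : (ℕ × ℕ) × (ℕ × ℕ) => ![p.1.1, p.1.2, p.2.1, p.2.2] i := by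
      intro i
      fin_cases i
      · exact Primrec.fst.comp Primrec.fst
      · exact Primrec.snd.comp Primrec.fst
      · exact Primrec.fst.comp Primrec.snd
      · exact Primrec.snd.comp Primrec.snd
    refine Primrec.ite (c := fun p : (ℕ × ℕ) × (ℕ × ℕ) => toLex p.1 < toLex p.2) ?_
      (Primrec.const 1) (Primrec.ite (Primrec.eq (α := ℕ × ℕ)) (Primrec.const 0) (Primrec.const 2))
    refine (PrimrecPred.or (Primrec.nat_lt.comp (h 0) (h 2)) (PrimrecPred.and
      (Primrec.eq.comp (h 0) (h 2)) (Primrec.nat_lt.comp (h 1) (h 3)))).of_eq fun p => ?_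
    rw [Prod.Lex.lt_iff]
    rfl
  win_primrec := Primrec.list_map Primrec.list_range ((Primrec.const 0).pair Primrec.snd)
  cand_primrec := by
    refine Primrec.list_flatMap (Primrec.list_cons.comp (Primrec.const _) Primrec.snd) ?_
    refine Primrec.list_map
      (Primrec.list_range.comp (Primrec.succ.comp (Primrec.fst.comp Primrec.fst))) ?_
    have hv : Primrec fun x : ((ℕ × List (ℕ × ℕ)) × ℕ × ℕ) × ℕ => x.1.2 :=
      Primrec.snd.comp Primrec.fst
    exact (Primrec.fst.comp hv).pair (Primrec.nat_add.comp (Primrec.snd.comp hv) Primrec.snd)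
  wf := by
    refine Subrelation.wf (fun {x y} h => ?_) (InvImage.wf toLex (wellFounded_lt (α := ℕ ×ₗ ℕ)))
    exact lexCmp_code_odd.1 h
  trans x y z h1 h2 := lexCmp_code_odd.2 ((lexCmp_code_odd.1 h1).trans (lexCmp_code_odd.1 h2))
  tri x y := by
    rw [lexCmp_code_odd, lexCmp_code_odd]
    exact lt_trichotomy (toLex x) (toLex y)
  win_mono m n hmn x hx := by
    rw [mem_initial] at hx ⊢
    exact ⟨hx.1, hx.2.trans_le hmn⟩
  ext := exists_extension_lexCmp
  compress := exists_compression_lexCmp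
  cand_spec := exists_candidate_lexCmp
  wqo := wellQuasiOrdered_windowLE_lexCmp

end Arena

/-! ### Relational structures described by comparisons. -/

/-- The relations of `D` on the image of `f` amount to the comparison `C`. -/
def Cmp.Realizes {Z : Type} (C : Cmp Z) (D : Domain) (f : Z → D.Carrier) : Prop :=
  -- Arbitrary families are allowed so that, in a product, the condition can be applied to a
  -- subfamily lying in a single fibre.
  ∀ {I : Type} (u v : I → Z),
    (∀ (n : ℕ) (r : D.lang.Relations n) (i : Fin n → I),
      FirstOrder.Language.Structure.RelMap r (fun j => f (u (i j))) ↔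
        FirstOrder.Language.Structure.RelMap r (fun j => f (v (i j)))) ↔
    ∀ i j, C.code (u i) (u j) = C.code (v i) (v j)

/-- The condition is applied to the families `id` and `κ`. -/
theorem Cmp.Realizes.exists_emb {Z : Type} {C : Cmp Z} {D : Domain} {f : Z → D.Carrier}
    (h : C.Realizes D f) (hf : Function.Bijective f) (κ : Z → Z) :
    HomOn C C Set.univ κ ↔ ∃ ι : D.Emb, ∀ z, ι (f z) = f (κ z) := by
  let e := Equiv.ofBijective f hf
  have hfe : ∀ x, f (e.symm x) = x := e.apply_symm_apply
  constructor
  · intro H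
    have H' := (h id κ).2 fun i j => (H i trivial j trivial).symm
    refine ⟨⟨⟨fun x => f (κ (e.symm x)), hf.1.comp (H.injective.comp e.symm.injective)⟩, ?_, ?_⟩, ?_⟩
    · intro n g
      exact isEmptyElim g
    · intro n r x
      have := H' n r (fun j => e.symm (x j))
      simp only [id, hfe] at this
      exact this.symm
    · intro z
      change f (κ (e.symm (e z))) = _
      rw [e.symm_apply_apply]
  · rintro ⟨ι, hι⟩ x - y -
    refine ((h id κ).1 ?_ x y).symm
    intro n r i
    simp only [← hι, id]
    exact (ι.map_rel r _).symm

theorem Cmp.realizes_order {Z O : Type} [LinearOrder O] (C : Cmp Z) (f : Z → O)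
    (hC : ∀ x y, C.code x y = (Cmp.ofOrder O).code (f x) (f y)) {I : Type} (u v : I → Z) :
    letI := FirstOrder.Language.orderStructure O
    (∀ (n : ℕ) (r : FirstOrder.Language.order.Relations n) (i : Fin n → I),
      FirstOrder.Language.Structure.RelMap r (fun j => f (u (i j))) ↔
        FirstOrder.Language.Structure.RelMap r (fun j => f (v (i j)))) ↔
    ∀ i j, C.code (u i) (u j) = C.code (v i) (v j) := by
  let := FirstOrder.Language.orderStructure O
  have key : (∀ (n : ℕ) (r : FirstOrder.Language.order.Relations n) (i : Fin n → I),
      FirstOrder.Language.Structure.RelMap r (fun j => f (u (i j))) ↔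
        FirstOrder.Language.Structure.RelMap r (fun j => f (v (i j)))) ↔
      ∀ i j, f (u i) ≤ f (u j) ↔ f (v i) ≤ f (v j) := by
    constructor
    · intro H i j
      exact H 2 FirstOrder.Language.leSymb ![i, j]
    · intro H n r i
      cases r
      exact H (i 0) (i 1)
  rw [key]
  simp only [hC, ofOrder]
  constructor
  · intro H i j
    have h1 := H i j
    have h2 := H j i
    simp only [← not_le, le_antisymm_iff, h1, h2]
  · intro H i j
    have := H i j
    split_ifs at this <;> grind

/-- Relations of the first factor determine the comparison of first coordinates, hence the fibres;
relations of the second factor then determine the comparison inside each fibre. Injectivity of `f`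
lets equality of first coordinates be read in the domain. -/
theorem Cmp.Realizes.prod {Z Z' : Type} {C : Cmp Z} {C' : Cmp Z'} {D D' : Domain}
    {f : Z → D.Carrier} {f' : Z' → D'.Carrier} (h : C.Realizes D f) (h' : C'.Realizes D' f')
    (hf : Function.Injective f) :
    (C.prod C').Realizes (D.lexProd D') (Prod.map f f') := by
  intro I u v
  have hfst : (∀ i j, C.code (u i).1 (u j).1 = C.code (v i).1 (v j).1) →
      ∀ i j, (u i).1 = (u j).1 ↔ (v i).1 = (v j).1 := fun H i j => by
    rw [← C.code_eq_zero, H, C.code_eq_zero]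
  constructor
  · intro H
    have h1 : ∀ i j, C.code (u i).1 (u j).1 = C.code (v i).1 (v j).1 :=
      (h (fun i => (u i).1) fun i => (v i).1).1 fun n r i => H n (Sum.inl r) i
    have h2 := hfst h1
    intro i j
    by_cases hij : (u i).1 = (u j).1
    · rw [prod_code_of_eq _ _ hij, prod_code_of_eq _ _ ((h2 i j).1 hij)]
      -- The subfamily of all indices over the first coordinate of `u i`.
      have := (h' (I := {k // (u k).1 = (u i).1}) (fun k => (u k).2) fun k => (v k).2).1 ?_
        ⟨i, rfl⟩ ⟨j, hij.symm⟩
      · rw [this]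
      · intro n r k
        have h3 := H n (Sum.inr r) (fun j => (k j).1)
        have hu : ∀ a b, (u (k a)).1 = (u (k b)).1 := fun a b => (k a).2.trans (k b).2.symm
        have hv : ∀ a b, (v (k a)).1 = (v (k b)).1 := fun a b => (h2 _ _).1 (hu a b)
        refine Iff.trans ?_ (h3.trans ?_)
        · exact ⟨fun h => ⟨fun a b => congrArg f (hu a b), h⟩, fun h => h.2⟩
        · exact ⟨fun h => h.2, fun h => ⟨fun a b => congrArg f (hv a b), h⟩⟩
    · rw [prod_code_of_ne _ _ hij, prod_code_of_ne _ _ (by rwa [Ne, ← h2]), h1]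
  · intro H
    have h2 : ∀ i j, (u i).1 = (u j).1 ↔ (v i).1 = (v j).1 := by
      intro i j
      have := H i j
      by_cases h1 : (u i).1 = (u j).1 <;> by_cases h2 : (v i).1 = (v j).1
      · simp [h1, h2]
      · rw [prod_code_of_eq _ _ h1, prod_code_of_ne _ _ h2] at this; omega
      · rw [prod_code_of_ne _ _ h1, prod_code_of_eq _ _ h2] at this; omega
      · simp [h1, h2]
    have h1 : ∀ i j, C.code (u i).1 (u j).1 = C.code (v i).1 (v j).1 := by
      intro i j
      by_cases hij : (u i).1 = (u j).1
      · rw [hij, (h2 i j).1 hij, code_self, code_self]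
      · have := H i j
        rw [prod_code_of_ne _ _ hij, prod_code_of_ne _ _ (by rwa [Ne, ← h2])] at this
        omega
    intro n r i
    rcases r with r | r
    · exact (h (fun i => (u i).1) fun i => (v i).1).2 h1 n r i
    · change ((∀ a b, f (u (i a)).1 = f (u (i b)).1) ∧ _) ↔
        ((∀ a b, f (v (i a)).1 = f (v (i b)).1) ∧ _)
      simp only [hf.eq_iff, h2]
      refine and_congr_right fun hv => ?_
      refine (h' (fun a => (u (i a)).2) fun a => (v (i a)).2).2 (fun a b => ?_) n r id
      have := H (i a) (i b)
      rw [prod_code_of_eq _ _ (hv a b), prod_code_of_eq _ _ ((h2 _ _).2 (hv a b))] at this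
      omega

/-! ### Reductions to arenas: finite orders and products. -/

/-- The data reducing a dense domain `D` to an arena: scaled by a common multiple `N` of the
weights of the codes, points of `D` are placed at finite positions (`low`) or at positions with
infinitely much room in between (`high`). -/
structure Reduction (D : Domain) (Q : Cmp D.Carrier) {X : Type} [Primcodable X] {C : Cmp X}
    (A : Arena C) where
  wt : D.Code → ℕ
  low : ℕ → D.Code → X
  high : ℕ → D.Code → X
  sec : ℕ → X → D.Carrier
  wt_pos : ∀ c, 0 < wt c
  wt_primrec : Primrec wt
  low_primrec : Primrec₂ low
  high_primrec : Primrec₂ high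
  low_mem : ∀ N c, 0 < N → wt c ∣ N → ∃ n, low N c ∈ A.win n
  sec_low : ∀ N c, 0 < N → wt c ∣ N → sec N (low N c) = D.val c
  sec_hom : ∀ N, 0 < N → ∀ n, HomOn C Q {x | x ∈ A.win n} (sec N)
  -- One embedding `σ` has to work for all windows simultaneously; `sec` turns low positions back
  -- into points of `D`.
  ext : ∀ N, 0 < N → ∀ e : X → D.Carrier, HomOn C Q Set.univ e →
    ∃ σ : D.Carrier → D.Carrier, HomOn Q Q Set.univ σ ∧ ∀ n, ∀ x ∈ A.win n, σ (sec N x) = e x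
  -- Carries a membership in the arena to one over `D`, restoring the variables of the high
  -- polynomial.
  up : ∀ N, 0 < N → ∃ J : X → D.Carrier, HomOn C Q Set.univ J ∧
    ∀ c, wt c ∣ N → J (high N c) = D.val c
  -- The opposite direction, where `t` need preserve the comparison only on the finitely many points
  -- occurring in a representation.
  down : ∀ N, 0 < N → ∀ F : Finset D.Carrier, ∃ t : D.Carrier → X,
    HomOn Q C (F : Set D.Carrier) t ∧ ∀ c, wt c ∣ N → t (D.val c) = high N c

namespace Reduction

/-- The reduction of a finite order to itself. -/
def fin (d : ℕ) : Reduction (Domain.fin d) (Cmp.ofOrder (Fin d)) (Arena.fin d) where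
  wt _ := 1
  low _ c := c
  high _ c := c
  sec _ c := c
  wt_pos _ := one_pos
  wt_primrec := Primrec.const 1
  low_primrec := Primrec.snd
  high_primrec := Primrec.snd
  low_mem _ c _ _ := ⟨0, List.mem_finRange (n := d) c⟩
  sec_low _ _ _ _ := rfl
  sec_hom _ _ _ := homOn_id _ _
  ext _ _ e he := ⟨e, he, fun _ _ _ => rfl⟩
  up _ _ := ⟨id, homOn_id _ _, fun _ _ => rfl⟩
  down _ _ _ := ⟨id, homOn_id _ _, fun _ _ => rfl⟩

/-- The lexicographic product of two reductions. -/
noncomputable def prod {D D' : Domain} {Q : Cmp D.Carrier} {Q' : Cmp D'.Carrier} {X X' : Type}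
    [Primcodable X] [Primcodable X'] {C : Cmp X} {C' : Cmp X'} {A : Arena C} {A' : Arena C'}
    (ρ : Reduction D Q A) (ρ' : Reduction D' Q' A') :
    Reduction (D.lexProd D') (Q.prod Q') (A.prod A') where
  wt c := ρ.wt c.1 * ρ'.wt c.2
  low N c := (ρ.low N c.1, ρ'.low N c.2)
  high N c := (ρ.high N c.1, ρ'.high N c.2)
  sec N x := (ρ.sec N x.1, ρ'.sec N x.2)
  wt_pos c := Nat.mul_pos (ρ.wt_pos _) (ρ'.wt_pos _)
  wt_primrec := Primrec.nat_mul.comp (ρ.wt_primrec.comp Primrec.fst)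
    (ρ'.wt_primrec.comp Primrec.snd)
  low_primrec := (ρ.low_primrec.comp Primrec.fst (Primrec.fst.comp Primrec.snd)).pair
    (ρ'.low_primrec.comp Primrec.fst (Primrec.snd.comp Primrec.snd))
  high_primrec := (ρ.high_primrec.comp Primrec.fst (Primrec.fst.comp Primrec.snd)).pair
    (ρ'.high_primrec.comp Primrec.fst (Primrec.snd.comp Primrec.snd))
  low_mem N c hN hc := by
    obtain ⟨m, hm⟩ := ρ.low_mem N c.1 hN (dvd_of_mul_right_dvd hc)
    obtain ⟨n, hn⟩ := ρ'.low_mem N c.2 hN (dvd_of_mul_left_dvd hc)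
    exact ⟨max m n, List.mem_product.2 ⟨A.win_mono _ _ (le_max_left _ _) _ hm,
      A'.win_mono _ _ (le_max_right _ _) _ hn⟩⟩
  sec_low N c hN hc := Prod.ext (ρ.sec_low N c.1 hN (dvd_of_mul_right_dvd hc))
    (ρ'.sec_low N c.2 hN (dvd_of_mul_left_dvd hc))
  sec_hom N hN n := (ρ.sec_hom N hN n).prod (ρ := fun _ => ρ'.sec N)
    (T := fun _ => {x | x ∈ A'.win n}) (fun _ _ => ρ'.sec_hom N hN n)
    (fun p hp => List.mem_product.1 hp)
  ext N hN e he := by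
    classical
    rcases isEmpty_or_nonempty X' with hX | ⟨⟨t⟩⟩
    · exact ⟨id, homOn_id _ _, fun n x => isEmptyElim x.2⟩
    rw [← Set.univ_prod_univ] at he
    obtain ⟨π, hπ, hπ'⟩ := ρ.ext N hN _ (he.fst (Set.mem_univ t))
    choose τ hτ hτ' using fun x => ρ'.ext N hN _ (he.snd (Set.mem_univ x))
    -- The fibre maps must be indexed by points of `D`. As `sec` is injective on the union of the
    -- windows, the arena point behind `q` is determined.
    let T : D.Carrier → D'.Carrier → D'.Carrier := fun q =>
      if h : ∃ n, ∃ x ∈ A.win n, ρ.sec N x = q then τ h.choose_spec.choose else id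
    have hT : ∀ n, ∀ x ∈ A.win n, T (ρ.sec N x) = τ x := by
      intro n x hx
      have h : ∃ m, ∃ y ∈ A.win m, ρ.sec N y = ρ.sec N x := ⟨n, x, hx, rfl⟩
      have h1 := h.choose_spec.choose_spec
      have h2 : h.choose_spec.choose = x := by
        refine ((ρ.sec_hom N hN (max n h.choose)).eq_iff ?_ ?_).1 h1.2
        · exact A.win_mono _ _ (le_max_right _ _) _ h1.1
        · exact A.win_mono _ _ (le_max_left _ _) _ hx
      simp only [T]
      rw [dif_pos h, h2]
    refine ⟨fun q => (π q.1, T q.1 q.2), hπ.prod (ρ := T) (T := fun _ => Set.univ) (fun q _ => ?_)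
      (fun _ _ => ⟨trivial, trivial⟩), ?_⟩
    · simp only [T]
      split_ifs
      · exact hτ _
      · exact homOn_id _ _
    · rintro n ⟨x, x'⟩ hx
      obtain ⟨hx, hx'⟩ := List.mem_product.1 hx
      simp only [hT n x hx, hπ' n x hx, hτ' x n x' hx']
      exact Prod.ext ((he.fst_eq_iff (p := (x, t)) (q := (x, x')) (by simp) (by simp)).2 rfl) rfl
  up N hN := by
    obtain ⟨J, hJ, h⟩ := ρ.up N hN
    obtain ⟨J', hJ', h'⟩ := ρ'.up N hN
    exact ⟨fun p => (J p.1, J' p.2), hJ.prod (ρ := fun _ => J') (T := fun _ => Set.univ)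
      (fun _ _ => hJ') (fun _ _ => ⟨trivial, trivial⟩), fun c hc =>
        Prod.ext (h c.1 (dvd_of_mul_right_dvd hc)) (h' c.2 (dvd_of_mul_left_dvd hc))⟩
  down N hN F := by
    classical
    obtain ⟨t, ht, h⟩ := ρ.down N hN (Finset.image Prod.fst F)
    obtain ⟨t', ht', h'⟩ := ρ'.down N hN (Finset.image Prod.snd F)
    refine ⟨fun p => (t p.1, t' p.2), ht.prod (ρ := fun _ => t')
      (T := fun _ => ((Finset.image Prod.snd F : Finset D'.Carrier) : Set D'.Carrier))
      (fun _ _ => ht') (fun p hp => ⟨Finset.mem_image_of_mem _ hp,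
        Finset.mem_image_of_mem _ hp⟩), fun c hc =>
        Prod.ext (h c.1 (dvd_of_mul_right_dvd hc)) (h' c.2 (dvd_of_mul_left_dvd hc))⟩

end Reduction

/-! ### The reduction of ℚ to ω². -/

/-- Makes sign and absolute value primitive recursive: parity gives the sign, and half of the
successor of the code gives the absolute value. -/
theorem Int.encode_eq (p : ℤ) :
    Encodable.encode p = if 0 ≤ p then 2 * p.natAbs else 2 * p.natAbs - 1 := by
  rcases p with n | n
  · have : Encodable.encode (Int.ofNat n) = 2 * n := rfl
    rw [this, if_pos (show (0 : ℤ) ≤ Int.ofNat n from Int.natCast_nonneg n)]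
    rfl
  · have : Encodable.encode (Int.negSucc n) = 2 * n + 1 := rfl
    rw [this, if_neg (by simp)]
    simp only [Int.natAbs_negSucc]
    omega

theorem Primrec.int_natAbs : Primrec Int.natAbs := by
  refine (Primrec.nat_div.comp (Primrec.succ.comp Primrec.encode) (Primrec.const 2)).of_eq
    fun p => ?_
  rw [Int.encode_eq]
  split_ifs <;> simp only [Nat.succ_eq_add_one] <;> omega

theorem PrimrecPred.int_nonneg : PrimrecPred fun p : ℤ => 0 ≤ p := by
  refine (Primrec.eq.comp (Primrec.nat_mod.comp Primrec.encode (Primrec.const 2))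
    (Primrec.const 0)).of_eq fun p => ?_
  rw [Int.encode_eq]
  split_ifs <;> omega

namespace Reduction

/-- The rational number `p / (n + 1)` scaled by `N` and shifted to the natural numbers. -/
def scale (N : ℕ) (c : ℤ × ℕ) : ℕ :=
  if 0 ≤ c.1 then N * N + c.1.natAbs * (N / (c.2 + 1)) else N * N - c.1.natAbs * (N / (c.2 + 1))

theorem scale_primrec : Primrec₂ scale := by
  have h1 : Primrec fun p : ℕ × ℤ × ℕ => p.1 * p.1 := Primrec.nat_mul.comp Primrec.fst Primrec.fst
  have h2 : Primrec fun p : ℕ × ℤ × ℕ => p.2.1.natAbs * (p.1 / (p.2.2 + 1)) :=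
    Primrec.nat_mul.comp (Primrec.int_natAbs.comp (Primrec.fst.comp Primrec.snd))
      (Primrec.nat_div.comp Primrec.fst (Primrec.succ.comp (Primrec.snd.comp Primrec.snd)))
  exact Primrec.ite (PrimrecPred.int_nonneg.comp (Primrec.fst.comp Primrec.snd))
    (Primrec.nat_add.comp h1 h2) (Primrec.nat_sub.comp h1 h2)

/-- Divisibility by `c.2 + 1` makes the natural division exact, and `|p| < N` makes the shift `N *
N` large enough that the subtraction is not truncated. -/
theorem scale_cast {N : ℕ} {c : ℤ × ℕ} (hN : 0 < N) (hc : (c.2 + 1) * (c.1.natAbs + 1) ∣ N) :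
    (scale N c : ℚ) = (c.1 : ℚ) / ((c.2 : ℚ) + 1) * N + N * N := by
  obtain ⟨p, n⟩ := c
  dsimp only at hc
  have h1 : n + 1 ∣ N := dvd_of_mul_right_dvd hc
  have h2 : p.natAbs + 1 ≤ N := Nat.le_of_dvd hN (dvd_of_mul_left_dvd hc)
  have h3 : p.natAbs * (N / (n + 1)) ≤ N * N :=
    Nat.mul_le_mul (by omega) (Nat.div_le_self _ _)
  have h4 : ((N / (n + 1) : ℕ) : ℚ) = N / (n + 1) := by
    rw [Nat.cast_div h1 (by positivity)]
    push_cast; rfl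
  simp only [scale]
  split_ifs with h
  · have h5 : (p.natAbs : ℚ) = p := by
      rw [← Int.cast_natCast, Int.natAbs_of_nonneg h]
    push_cast [h4, h5]
    ring
  · have h5 : (p.natAbs : ℚ) = -p := by
      rw [← Int.cast_natCast, Int.ofNat_natAbs_of_nonpos (not_le.1 h).le, Int.cast_neg]
    push_cast [Nat.cast_sub h3, h4, h5]
    ring

/-- An interpolation of a strictly monotone sequence of rational numbers. -/
theorem exists_strictMono_interpolation (g : ℕ → ℚ) (hg : StrictMono g) :
    ∃ h : ℚ → ℚ, StrictMono h ∧ ∀ m : ℕ, h m = g m := by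
  -- Linear between consecutive natural numbers, with slope one to the left of zero.
  refine ⟨fun z => if z < 0 then g 0 + z else
    g ⌊z⌋₊ + (z - ⌊z⌋₊) * (g (⌊z⌋₊ + 1) - g ⌊z⌋₊), ?_, fun m => by simp⟩
  have hpos : ∀ m, 0 < g (m + 1) - g m := fun m => sub_pos.2 (hg (Nat.lt_succ_self m))
  intro z w hzw
  dsimp only
  by_cases hw : w < 0
  · rw [if_pos hw, if_pos (hzw.trans hw)]
    linarith
  rw [if_neg hw]
  push Not at hw
  have hw' := Nat.floor_le hw
  by_cases hz : z < 0
  · rw [if_pos hz]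
    have h1 : g 0 ≤ g ⌊w⌋₊ := hg.monotone (Nat.zero_le _)
    have h2 : 0 ≤ (w - ⌊w⌋₊) * (g (⌊w⌋₊ + 1) - g ⌊w⌋₊) :=
      mul_nonneg (by linarith) (hpos _).le
    linarith
  rw [if_neg hz]
  push Not at hz
  rcases (Nat.floor_mono hzw.le).lt_or_eq with h | h
  · have h1 : g (⌊z⌋₊ + 1) ≤ g ⌊w⌋₊ := hg.monotone h
    have h2 : 0 ≤ (w - ⌊w⌋₊) * (g (⌊w⌋₊ + 1) - g ⌊w⌋₊) :=
      mul_nonneg (by linarith) (hpos _).le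
    have h3 : (z - ⌊z⌋₊) * (g (⌊z⌋₊ + 1) - g ⌊z⌋₊) < 1 * (g (⌊z⌋₊ + 1) - g ⌊z⌋₊) :=
      mul_lt_mul_of_pos_right (by linarith [Nat.lt_floor_add_one z]) (hpos _)
    linarith
  · rw [h]
    have := mul_lt_mul_of_pos_right (sub_lt_sub_right hzw (⌊w⌋₊ : ℚ)) (hpos ⌊w⌋₊)
    linarith

/-- The reduction of the rational numbers to `ω²`. -/
def rat : Reduction Domain.rat (Cmp.ofOrder ℚ) Arena.omegaSq where
  wt c := (c.2 + 1) * (c.1.natAbs + 1)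
  low N c := (0, scale N c)
  -- The `+ 1` keeps row 0 free for rationals below the scaled range.
  high N c := (scale N c + 1, 0)
  sec N x := (((x.2 : ℚ) - N * N) / N : ℚ)
  wt_pos c := by positivity
  wt_primrec := Primrec.nat_mul.comp (Primrec.succ.comp Primrec.snd)
    (Primrec.succ.comp (Primrec.int_natAbs.comp Primrec.fst))
  low_primrec := (Primrec.const 0).pair scale_primrec
  high_primrec := (Primrec.succ.comp scale_primrec).pair (Primrec.const 0)
  low_mem N c _ _ := ⟨scale N c + 1, Arena.mem_initial.2 ⟨rfl, Nat.lt_succ_self _⟩⟩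
  sec_low N c hN hc := by
    change (((scale N c : ℚ) - N * N) / N : ℚ) = (c.1 : ℚ) / ((c.2 : ℚ) + 1)
    rw [scale_cast hN hc]
    field_simp
    ring
  sec_hom N hN n := by
    rintro ⟨a, b⟩ hx ⟨a', b'⟩ hy
    obtain ⟨rfl, -⟩ := Arena.mem_initial.1 hx
    obtain ⟨rfl, -⟩ := Arena.mem_initial.1 hy
    have hN' : (0 : ℚ) < N := by exact_mod_cast hN
    have h1 : ((b : ℚ) - N * N) / N < ((b' : ℚ) - N * N) / N ↔ b < b' := by
      rw [div_lt_div_iff_of_pos_right hN', sub_lt_sub_iff_right, Nat.cast_lt]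
    have h2 : ((b : ℚ) - N * N) / N = ((b' : ℚ) - N * N) / N ↔ b = b' := by
      rw [div_left_inj' hN'.ne', sub_left_inj, Nat.cast_inj]
    simp only [Arena.lexCmp, comap, ofOrder, Arena.toLex_pair_lt, h1, h2]
    simp
  ext N hN e he := by
    change ℕ × ℕ → ℚ at e
    have hg : StrictMono fun m : ℕ => e (0, m) := by
      intro m n hmn
      have h := he (0, m) trivial (0, n) trivial
      have h1 : Arena.lexCmp.code (0, m) (0, n) % 2 = 1 :=
        Arena.lexCmp_code_odd.2 (Arena.toLex_pair_lt.2 (Or.inr ⟨rfl, hmn⟩))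
      rw [← h] at h1
      simp only [ofOrder] at h1
      split_ifs at h1 with h2
      exact h2
    obtain ⟨h, hh, hm⟩ := exists_strictMono_interpolation _ hg
    have hN' : (0 : ℚ) < N := by exact_mod_cast hN
    refine ⟨fun q : ℚ => h (q * N + N * N), (homOn_ofOrder_iff (X := ℚ) (Z := ℚ)).2 ?_, ?_⟩
    · intro x _ y _ hxy
      exact hh (add_lt_add_left (mul_lt_mul_of_pos_right hxy hN') _)
    · rintro n ⟨a, b⟩ hx
      obtain ⟨rfl, -⟩ := Arena.mem_initial.1 hx
      have : ((b : ℚ) - N * N) / N * N + N * N = b := by field_simp; ring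
      change h (((b : ℚ) - N * N) / N * N + N * N) = _
      rw [this, hm]
  up N hN := by
    have hN' : (0 : ℚ) < N := by exact_mod_cast hN
    -- Before shifting and scaling back, row `a` is squeezed into `[a - 1, a)` by `b ↦ b / (b + 1)`,
    -- so column 0 goes to the integer `a - 1`.
    refine ⟨fun x => (((x.1 : ℚ) - 1 + x.2 / (x.2 + 1) - N * N) / N : ℚ), ?_, ?_⟩
    · have key : StrictMono fun x : ℕ ×ₗ ℕ =>
          ((((ofLex x).1 : ℚ) - 1 + (ofLex x).2 / ((ofLex x).2 + 1) - N * N) / N : ℚ) := by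
        intro x y hxy
        have hlt : ∀ b : ℕ, (b : ℚ) / (b + 1) < 1 := fun b => by
          rw [div_lt_one (by positivity)]; linarith
        have hnn : ∀ b : ℕ, 0 ≤ (b : ℚ) / (b + 1) := fun b => by positivity
        refine div_lt_div_of_pos_right (sub_lt_sub_right ?_ _) hN'
        rcases Prod.Lex.lt_iff.1 hxy with h | ⟨h, h'⟩
        · have h1 : ((ofLex x).1 : ℚ) + 1 ≤ (ofLex y).1 := by exact_mod_cast h
          linarith [hlt (ofLex x).2, hnn (ofLex y).2]
        · rw [h]
          have h1 : ((ofLex x).2 : ℚ) < (ofLex y).2 := by exact_mod_cast h'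
          have : ((ofLex x).2 : ℚ) / ((ofLex x).2 + 1) < (ofLex y).2 / ((ofLex y).2 + 1) := by
            rw [div_lt_div_iff₀ (by positivity) (by positivity)]
            linarith
          linarith
      intro x _ y _
      exact homOn_ofOrder_iff.2 (key.strictMonoOn Set.univ) (toLex x) trivial (toLex y) trivial
    · intro c hc
      change ((((scale N c + 1 : ℕ) : ℚ) - 1 + (0 : ℕ) / ((0 : ℕ) + 1) - N * N) / N : ℚ) =
        (c.1 : ℚ) / ((c.2 : ℚ) + 1)
      push_cast
      rw [scale_cast hN hc]
      field_simp
      ring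
  down N hN F := by
    classical
    have hN' : (0 : ℚ) < N := by exact_mod_cast hN
    let F' : Finset ℚ := F
    let z : ℚ → ℚ := fun q => q * N + N * N
    -- The number of points of `F` below `q`, strictly increasing on `F`, serves to order the points
    -- sharing a row.
    let k : ℚ → ℕ := fun q => (F'.filter (· < q)).card
    have hk : ∀ q ∈ F', ∀ q', q < q' → k q < k q' := by
      intro q hq q' hqq'
      refine Finset.card_lt_card (Finset.ssubset_iff_of_subset ?_ |>.2 ⟨q, ?_, ?_⟩)
      · intro x hx
        rw [Finset.mem_filter] at hx ⊢
        exact ⟨hx.1, hx.2.trans hqq'⟩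
      · exact Finset.mem_filter.2 ⟨hq, hqq'⟩
      · simp
    -- The row is given by the integer part of the scaled value. Column 0 is reserved for exact
    -- integers, which include the rationals of the instance; the others lie strictly to its right.
    refine ⟨fun q : ℚ => if z q < 0 then (0, k q) else
      (⌊z q⌋₊ + 1, if z q = ⌊z q⌋₊ then 0 else k q + 1), ?_, ?_⟩
    · have key : StrictMonoOn (fun q : ℚ => toLex (if z q < 0 then (0, k q) else
          (⌊z q⌋₊ + 1, if z q = ⌊z q⌋₊ then 0 else k q + 1))) (F' : Set ℚ) := by
        intro q hq q' _ hqq'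
        have hk' := hk q hq q' hqq'
        have hz : z q < z q' := add_lt_add_left (mul_lt_mul_of_pos_right hqq' hN') _
        dsimp only
        by_cases h' : z q' < 0
        · rw [if_pos h', if_pos (hz.trans h'), Arena.toLex_pair_lt]
          exact Or.inr ⟨rfl, hk'⟩
        rw [if_neg h']
        by_cases h : z q < 0
        · rw [if_pos h, Arena.toLex_pair_lt]
          exact Or.inl (Nat.succ_pos _)
        rw [if_neg h, Arena.toLex_pair_lt]
        push Not at h h'
        rcases (Nat.floor_mono hz.le).lt_or_eq with h1 | h1
        · exact Or.inl (Nat.succ_lt_succ h1)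
        · have h2 : z q' ≠ ⌊z q'⌋₊ := by
            rw [← h1]
            exact ((Nat.floor_le h).trans_lt hz).ne'
          rw [if_neg h2]
          refine Or.inr ⟨by rw [h1], ?_⟩
          split_ifs <;> omega
      exact (homOn_ofOrder_iff (X := ℚ) (Z := ℕ ×ₗ ℕ)).2 key
    · intro c hc
      have h1 : z ((c.1 : ℚ) / ((c.2 : ℚ) + 1)) = scale N c := (scale_cast hN hc).symm
      have h2 : Domain.rat.val c = ((c.1 : ℚ) / ((c.2 : ℚ) + 1) : ℚ) := rfl
      simp only [h2, h1, Nat.floor_natCast]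
      rw [if_neg (by simp)]
      simp

end Reduction

theorem Cmp.realizes_rat : (Cmp.ofOrder ℚ).Realizes Domain.rat id :=
  Cmp.realizes_order _ id fun _ _ => rfl

theorem Cmp.realizes_fin (d : ℕ) : (Cmp.ofOrder (Fin d)).Realizes (Domain.fin d) id :=
  Cmp.realizes_order _ id fun _ _ => rfl

theorem Cmp.realizes_omegaSq : Arena.lexCmp.Realizes Domain.omegaSq Domain.omegaSq.val :=
  Cmp.realizes_order (O := ℕ ×ₗ ℕ) _ toLex fun _ _ => rfl

/-! ### The monomial order and Buchberger's criterion. -/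

namespace Arena

variable {X : Type} [Primcodable X] {C : Cmp X} (A : Arena C)

/-- The well-order underlying an arena. -/
noncomputable abbrev linearOrder : LinearOrder X :=
  haveI : IsStrictTotalOrder X fun x y => C.code x y % 2 = 1 :=
    { irrefl := fun x => by simp [code_self]
      trans := A.trans
      trichotomous := fun x y h1 h2 => by
        rcases A.tri x y with h | h | h
        · exact (h1 h).elim
        · exact h
        · exact (h2 h).elim }
  haveI := Classical.decRel fun x y => C.code x y % 2 = 1
  linearOrderOfSTO fun x y => C.code x y % 2 = 1

/-- The lexicographic order of exponent vectors, where larger variables dominate. -/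
def mlt (_ : Arena C) (u v : X →₀ ℕ) : Prop :=
  ∃ x, u x < v x ∧ ∀ y, C.code x y % 2 = 1 → u y = v y

theorem mlt_iff (u v : X →₀ ℕ) :
    A.mlt u v ↔ (letI := A.linearOrder; toColex u < toColex v) := by
  let := A.linearOrder
  rw [Finsupp.Colex.lt_iff]
  exact exists_congr fun x => and_comm

/-- Here the well-order on the variables is essential: over ℚ the single variables would already
give an infinite descent. -/
theorem mlt_wf : WellFounded A.mlt := by
  let := A.linearOrder
  have : WellFoundedLT X := ⟨A.wf⟩
  refine Subrelation.wf (fun {u v} h => ?_)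
    (InvImage.wf toColex (wellFounded_lt (α := Colex (X →₀ ℕ))))
  exact (A.mlt_iff u v).1 h

theorem mlt_trans {u v w : X →₀ ℕ} (h : A.mlt u v) (h' : A.mlt v w) : A.mlt u w := by
  let := A.linearOrder
  rw [mlt_iff] at *
  exact lt_trans h h'

theorem mlt_tri (u v : X →₀ ℕ) : A.mlt u v ∨ u = v ∨ A.mlt v u := by
  let := A.linearOrder
  rw [mlt_iff, mlt_iff]
  exact lt_trichotomy (toColex u) (toColex v)

theorem mlt_irrefl (u : X →₀ ℕ) : ¬ A.mlt u u := fun ⟨_, h, _⟩ => lt_irrefl _ h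

theorem mlt_add_left {u v : X →₀ ℕ} (w : X →₀ ℕ) (h : A.mlt u v) : A.mlt (w + u) (w + v) := by
  obtain ⟨x, h1, h2⟩ := h
  exact ⟨x, by simpa using h1, fun y hy => by simp [h2 y hy]⟩

/-- The deciding variable is transported by `κ`, and outside the range of `κ` both vectors vanish.
-/
theorem mlt_mapDomain {u v : X →₀ ℕ} {κ : X → X} (hκ : HomOn C C Set.univ κ) (h : A.mlt u v) :
    A.mlt (u.mapDomain κ) (v.mapDomain κ) := by
  obtain ⟨x, h1, h2⟩ := h
  have hi := hκ.injective
  refine ⟨κ x, by simpa only [Finsupp.mapDomain_apply hi] using h1, fun y hy => ?_⟩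
  by_cases hy' : y ∈ Set.range κ
  · obtain ⟨y, rfl⟩ := hy'
    rw [hκ x trivial y trivial] at hy
    simp only [Finsupp.mapDomain_apply hi, h2 y hy]
  · rw [Finsupp.mapDomain_of_notMem_range _ _ hy', Finsupp.mapDomain_of_notMem_range _ _ hy']

theorem exists_max (s : Finset (X →₀ ℕ)) (hs : s.Nonempty) :
    ∃ u ∈ s, ∀ v ∈ s, v = u ∨ A.mlt v u := by
  let := A.linearOrder
  obtain ⟨u, hu, h⟩ := Finset.exists_max_image s toColex hs
  refine ⟨u, hu, fun v hv => ?_⟩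
  rw [mlt_iff]
  exact (h v hv).eq_or_lt.imp (fun h => toColex.injective h) id

end Arena

open MvPolynomial

theorem MvPolynomial.rename_congr_vars {σ τ R : Type*} [CommRing R] {p : MvPolynomial σ R}
    {f g : σ → τ} (h : ∀ x ∈ p.vars, f x = g x) : rename f p = rename g p :=
  hom_congr_vars (f₁ := (rename f : MvPolynomial σ R →ₐ[R] MvPolynomial τ R).toRingHom)
    (f₂ := (rename g : MvPolynomial σ R →ₐ[R] MvPolynomial τ R).toRingHom)
    (by ext; simp) (fun i hi _ => by simp [h i hi]) rfl

/-- The ideal generated by the images of the polynomials in `B` under renamings in `E`. -/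
noncomputable def orbitIdeal {X Z K : Type*} [Field K] (E : Set (X → Z)) (B : Set (MvPolynomial X K)) :
    Ideal (MvPolynomial Z K) :=
  Ideal.span {f | ∃ e ∈ E, ∃ b ∈ B, f = rename e b}

namespace Arena

variable {X : Type} [Primcodable X] {C : Cmp X} (A : Arena C) {K : Type*} [Field K]

/-- The embeddings of an arena into itself. -/
def Emb (_ : Arena C) : Set (X → X) := {κ | HomOn C C Set.univ κ}

theorem rename_mem_orbitIdeal {B : Set (MvPolynomial X K)} {σ : X → X} (hσ : σ ∈ A.Emb)
    {p : MvPolynomial X K} (hp : p ∈ orbitIdeal A.Emb B) : rename σ p ∈ orbitIdeal A.Emb B := by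
  have : orbitIdeal A.Emb B ≤ (orbitIdeal A.Emb B).comap (rename σ : _ →ₐ[K] _) := by
    refine Ideal.span_le.2 ?_
    rintro _ ⟨e, he, b, hb, rfl⟩
    refine Ideal.subset_span ⟨σ ∘ e, HomOn.comp_univ hσ he, b, hb, ?_⟩
    exact rename_rename _ _ _
  exact this hp

/-- Membership in an equivariant ideal only involves finitely many variables. -/
theorem exists_finset_of_mem_orbitIdeal {Z : Type} {CZ : Cmp Z} {n : ℕ}
    {B : Set (MvPolynomial X K)} (hB : ∀ b ∈ B, ∀ x ∈ b.vars, x ∈ A.win n) {E : Set (X → Z)}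
    (hE : ∀ e ∈ E, HomOn C CZ {x | x ∈ A.win n} e) {h : MvPolynomial Z K}
    (hh : h ∈ orbitIdeal E B) :
    ∃ F : Finset Z, ∀ t : Z → X, HomOn CZ C (F : Set Z) t → rename t h ∈ orbitIdeal A.Emb B := by
  classical
  induction hh using Submodule.span_induction with
  | mem f hf =>
    obtain ⟨e, he, b, hb, rfl⟩ := hf
    -- If `t` is order-preserving on the image of the window, then `t ∘ e` is so on the window and
    -- extends to an embedding.
    refine ⟨(A.win n).toFinset.image e, fun t ht => ?_⟩
    have h1 : HomOn C C {x | x ∈ A.win n} (t ∘ e) := ht.comp (hE e he) fun x hx =>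
      Finset.mem_image_of_mem _ (List.mem_toFinset.2 hx)
    obtain ⟨κ, hκ, hκ'⟩ := A.ext n _ h1
    refine Ideal.subset_span ⟨κ, hκ, b, hb, ?_⟩
    rw [rename_rename]
    exact rename_congr_vars fun x hx => (hκ' x (hB b hb x hx)).symm
  | zero => exact ⟨∅, fun t _ => by simp⟩
  | add f g _ _ hf hg =>
    obtain ⟨F, hF⟩ := hf
    obtain ⟨G, hG⟩ := hg
    refine ⟨F ∪ G, fun t ht => ?_⟩
    rw [map_add]
    exact add_mem (hF t (ht.mono (by simp))) (hG t (ht.mono (by simp)))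
  | smul a f _ hf =>
    obtain ⟨F, hF⟩ := hf
    refine ⟨F, fun t ht => ?_⟩
    rw [smul_eq_mul, map_mul]
    exact Ideal.mul_mem_left _ _ (hF t ht)

/-- `u` is the leading exponent of `p`. -/
def IsLead (u : X →₀ ℕ) (p : MvPolynomial X K) : Prop :=
  p.coeff u ≠ 0 ∧ ∀ v ∈ p.support, v = u ∨ A.mlt v u

variable {A}

theorem exists_isLead {p : MvPolynomial X K} (hp : p ≠ 0) : ∃ u, A.IsLead u p := by
  obtain ⟨u, hu, h⟩ := A.exists_max p.support (by simpa [Finset.nonempty_iff_ne_empty] using hp)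
  exact ⟨u, mem_support_iff.1 hu, h⟩

theorem IsLead.ne_zero {u : X →₀ ℕ} {p : MvPolynomial X K} (h : A.IsLead u p) : p ≠ 0 := by
  rintro rfl
  exact h.1 (by simp)

theorem IsLead.rename {u : X →₀ ℕ} {p : MvPolynomial X K} (h : A.IsLead u p) {κ : X → X}
    (hκ : κ ∈ A.Emb) : A.IsLead (u.mapDomain κ) (rename κ p) := by
  classical
  have hi := HomOn.injective hκ
  refine ⟨by rw [coeff_rename_mapDomain _ hi]; exact h.1, fun v hv => ?_⟩
  rw [support_rename_of_injective hi, Finset.mem_image] at hv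
  obtain ⟨w, hw, rfl⟩ := hv
  exact (h.2 w hw).imp (congrArg _) (A.mlt_mapDomain hκ)

theorem IsLead.monomial_mul {u : X →₀ ℕ} {p : MvPolynomial X K} (h : A.IsLead u p)
    (m : X →₀ ℕ) : A.IsLead (m + u) (monomial m 1 * p) := by
  refine ⟨by rw [coeff_monomial_mul, one_mul]; exact h.1, fun v hv => ?_⟩
  rw [mem_support_iff, coeff_monomial_mul'] at hv
  split_ifs at hv with hm
  · rw [one_mul] at hv
    rcases h.2 _ (mem_support_iff.2 hv) with h1 | h1
    · exact Or.inl (by rw [← h1, add_tsub_cancel_of_le hm])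
    · exact Or.inr (by simpa [add_tsub_cancel_of_le hm] using A.mlt_add_left m h1)
  · exact (hv rfl).elim

variable (A)

/-- The span of the multiples of renamings of elements of `G` whose leading exponents satisfy `P`.
The elements of `G` are polynomials together with their leading exponents. -/
noncomputable def leadSpan (G : Set ((X →₀ ℕ) × MvPolynomial X K)) (P : (X →₀ ℕ) → Prop) :
    Submodule K (MvPolynomial X K) :=
  Submodule.span K {p | ∃ g ∈ G, ∃ κ ∈ A.Emb, ∃ m : X →₀ ℕ, P (m + g.1.mapDomain κ) ∧
    p = monomial m 1 * rename κ g.2}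

variable {A} {G : Set ((X →₀ ℕ) × MvPolynomial X K)} {P Q : (X →₀ ℕ) → Prop}

theorem leadSpan_mono (h : ∀ w, P w → Q w) : A.leadSpan G P ≤ A.leadSpan G Q :=
  Submodule.span_mono fun _ ⟨g, hg, κ, hκ, m, hm, hp⟩ => ⟨g, hg, κ, hκ, m, h _ hm, hp⟩

theorem map_mem_leadSpan {σ : X → X} (hσ : σ ∈ A.Emb) (k : X →₀ ℕ)
    (h : ∀ w, P w → Q (k + w.mapDomain σ)) {p : MvPolynomial X K} (hp : p ∈ A.leadSpan G P) :
    monomial k 1 * rename σ p ∈ A.leadSpan G Q := by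
  induction hp using Submodule.span_induction with
  | mem f hf =>
    obtain ⟨g, hg, κ, hκ, m, hm, rfl⟩ := hf
    refine Submodule.subset_span ⟨g, hg, σ ∘ κ, HomOn.comp_univ hσ hκ, k + m.mapDomain σ, ?_, ?_⟩
    · have := h _ hm
      rwa [Finsupp.mapDomain_add, ← Finsupp.mapDomain_comp, ← add_assoc] at this
    · rw [map_mul, rename_monomial, rename_rename, ← mul_assoc, monomial_mul, one_mul]
  | zero => rw [map_zero, mul_zero]; exact zero_mem _
  | add f g _ _ hf hg => rw [map_add, mul_add]; exact add_mem hf hg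
  | smul a f _ hf => rw [map_smul, mul_smul_comm]; exact Submodule.smul_mem _ _ hf

theorem mul_mem_leadSpan {p : MvPolynomial X K} (hp : p ∈ A.leadSpan G fun _ => True)
    (a : MvPolynomial X K) : a * p ∈ A.leadSpan G fun _ => True := by
  induction a using MvPolynomial.induction_on' with
  | monomial u c =>
    have h := map_mem_leadSpan (Q := fun _ => True) (homOn_id C _) u (fun _ _ => trivial) hp
    rw [rename_id_apply] at h
    have h' := Submodule.smul_mem _ c h
    rwa [← smul_mul_assoc, smul_monomial, smul_eq_mul, mul_one] at h'
  | add a b ha hb =>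
    rw [add_mul]
    exact add_mem ha hb

theorem mem_orbitIdeal_iff {p : MvPolynomial X K} :
    p ∈ orbitIdeal A.Emb (Prod.snd '' G) ↔ p ∈ A.leadSpan G fun _ => True := by
  constructor
  · intro h
    induction h using Submodule.span_induction with
    | mem f hf =>
      obtain ⟨κ, hκ, _, ⟨g, hg, rfl⟩, rfl⟩ := hf
      refine Submodule.subset_span ⟨g, hg, κ, hκ, 0, trivial, ?_⟩
      rw [monomial_zero', C_1, one_mul]
    | zero => exact zero_mem _
    | add f g _ _ hf hg => exact add_mem hf hg
    | smul a f _ hf => exact mul_mem_leadSpan hf a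
  · intro h
    have : A.leadSpan G (fun _ => True) ≤
        (orbitIdeal A.Emb (Prod.snd '' G)).restrictScalars K := by
      refine Submodule.span_le.2 ?_
      rintro _ ⟨g, hg, κ, hκ, m, -, rfl⟩
      exact Ideal.mul_mem_left _ _ (Ideal.subset_span ⟨κ, hκ, _, ⟨g, hg, rfl⟩, rfl⟩)
    exact this h

variable (A) in
/-- All elements of `G` are monic with the given leading exponents. -/
def IsMonic (G : Set ((X →₀ ℕ) × MvPolynomial X K)) : Prop :=
  ∀ g ∈ G, g.2.coeff g.1 = 1 ∧ A.IsLead g.1 g.2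

theorem support_of_mem_leadSpan (hG : A.IsMonic G) {p : MvPolynomial X K}
    (hp : p ∈ A.leadSpan G P) : ∀ v ∈ p.support, ∃ w, P w ∧ (v = w ∨ A.mlt v w) := by
  classical
  induction hp using Submodule.span_induction with
  | mem f hf =>
    obtain ⟨g, hg, κ, hκ, m, hm, rfl⟩ := hf
    exact fun v hv => ⟨_, hm, (((hG g hg).2.rename hκ).monomial_mul m).2 v hv⟩
  | zero => simp
  | add f g _ _ hf hg =>
    intro v hv
    rcases Finset.mem_union.1 (support_add hv) with h | h
    · exact hf v h
    · exact hg v h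
  | smul a f _ hf => exact fun v hv => hf v (support_smul hv)

/-- A representation is a finite sum, so its leading exponents have a maximum. This turns "all below
`μ`" into "all at most `ν`" with `ν` below `μ`, as well-founded induction requires. -/
theorem exists_bound_of_mem_leadSpan {p : MvPolynomial X K} (hp : p ∈ A.leadSpan G P) :
    p = 0 ∨ ∃ μ, P μ ∧ p ∈ A.leadSpan G fun w => w = μ ∨ A.mlt w μ := by
  induction hp using Submodule.span_induction with
  | mem f hf =>
    obtain ⟨g, hg, κ, hκ, m, hm, rfl⟩ := hf
    exact Or.inr ⟨_, hm, Submodule.subset_span ⟨g, hg, κ, hκ, m, Or.inl rfl, rfl⟩⟩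
  | zero => exact Or.inl rfl
  | add f g _ _ hf hg =>
    have key : ∀ μ ν, (μ = ν ∨ A.mlt μ ν) → ∀ f ∈ A.leadSpan G fun w => w = μ ∨ A.mlt w μ,
        f ∈ A.leadSpan G fun w => w = ν ∨ A.mlt w ν := by
      rintro μ ν (rfl | h) f hf
      · exact hf
      · refine leadSpan_mono (fun w hw => Or.inr ?_) hf
        rcases hw with rfl | hw
        · exact h
        · exact A.mlt_trans hw h
    rcases hf with rfl | ⟨μ, hμ, hf⟩
    · rwa [zero_add]
    rcases hg with rfl | ⟨ν, hν, hg⟩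
    · rw [add_zero]
      exact Or.inr ⟨μ, hμ, hf⟩
    rcases A.mlt_tri μ ν with h | rfl | h
    · exact Or.inr ⟨ν, hν, add_mem (key μ ν (Or.inr h) f hf) hg⟩
    · exact Or.inr ⟨μ, hμ, add_mem hf hg⟩
    · exact Or.inr ⟨μ, hμ, add_mem hf (key ν μ (Or.inr h) g hg)⟩
  | smul a f _ hf =>
    rcases hf with rfl | ⟨μ, hμ, hf⟩
    · exact Or.inl (smul_zero _)
    · exact Or.inr ⟨μ, hμ, Submodule.smul_mem _ _ hf⟩

variable (A) in
/-- The Buchberger criterion: all overlaps of leading exponents resolve. -/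
def OverlapsResolve (G : Set ((X →₀ ℕ) × MvPolynomial X K)) : Prop :=
  ∀ g ∈ G, ∀ g' ∈ G, ∀ κ ∈ A.Emb, ∀ κ' ∈ A.Emb, ∀ m m' : X →₀ ℕ,
    m + g.1.mapDomain κ = m' + g'.1.mapDomain κ' →
    monomial m 1 * rename κ g.2 - monomial m' 1 * rename κ' g'.2 ∈
      A.leadSpan G fun w => A.mlt w (m + g.1.mapDomain κ)

/-- Buchberger's argument, by induction on a bound `μ` for a representation. Resolved overlaps
replace all summands with leading exponent `μ` by scalar multiples of one of them. If the total
coefficient is nonzero, `μ` is the leading exponent of `h`; otherwise the bound drops. -/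
theorem exists_lead_of_mem_leadSpan (hG : A.IsMonic G) (H : A.OverlapsResolve G)
    {h : MvPolynomial X K} (hh : h ∈ A.leadSpan G fun _ => True) (h0 : h ≠ 0) :
    ∃ g ∈ G, ∃ κ ∈ A.Emb, ∃ m, A.IsLead (m + g.1.mapDomain κ) h := by
  obtain rfl | ⟨μ, -, hμ⟩ := exists_bound_of_mem_leadSpan hh
  · exact (h0 rfl).elim
  clear hh
  induction μ using A.mlt_wf.induction generalizing h with
  | _ μ ih =>
  have low : h ∈ A.leadSpan G (fun w => A.mlt w μ) →
      ∃ g ∈ G, ∃ κ ∈ A.Emb, ∃ m, A.IsLead (m + g.1.mapDomain κ) h := by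
    intro h'
    obtain rfl | ⟨ν, hν, h'⟩ := exists_bound_of_mem_leadSpan h'
    · exact (h0 rfl).elim
    · exact ih ν hν h0 h'
  by_cases hex : ∃ g ∈ G, ∃ κ ∈ A.Emb, ∃ m, m + g.1.mapDomain κ = μ
  · obtain ⟨g, hg, κ, hκ, m, hm⟩ := hex
    have hle : A.leadSpan G (fun w => w = μ ∨ A.mlt w μ) ≤
        Submodule.span K {monomial m 1 * rename κ g.2} ⊔ A.leadSpan G fun w => A.mlt w μ := by
      refine Submodule.span_le.2 ?_
      rintro _ ⟨g', hg', κ', hκ', m', hm' | hm', rfl⟩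
      · have := H g' hg' g hg κ' hκ' κ hκ m' m (hm'.trans hm.symm)
        rw [hm'] at this
        rw [← sub_add_cancel (monomial m' 1 * rename κ' g'.2) (monomial m 1 * rename κ g.2), add_comm]
        exact Submodule.add_mem_sup (Submodule.mem_span_singleton_self _) this
      · exact Submodule.mem_sup_right (Submodule.subset_span ⟨g', hg', κ', hκ', m', hm', rfl⟩)
    obtain ⟨_, hy, z, hz, hyz⟩ := Submodule.mem_sup.1 (hle hμ)
    obtain ⟨c, rfl⟩ := Submodule.mem_span_singleton.1 hy
    by_cases hc : c = 0
    · rw [hc, zero_smul, zero_add] at hyz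
      exact low (hyz ▸ hz)
    · refine ⟨g, hg, κ, hκ, m, ?_⟩
      have hl := ((hG g hg).2.rename hκ).monomial_mul m
      have hz' := support_of_mem_leadSpan hG hz
      have hlt : ∀ v ∈ z.support, A.mlt v μ := by
        intro v hv
        obtain ⟨w, hw, rfl | hv⟩ := hz' v hv
        · exact hw
        · exact A.mlt_trans hv hw
      have hμz : coeff μ z = 0 := by
        by_contra hne
        exact A.mlt_irrefl μ (hlt μ (mem_support_iff.2 hne))
      have hone : coeff (m + g.1.mapDomain κ) (monomial m 1 * rename κ g.2) = 1 := by
        rw [coeff_monomial_mul, coeff_rename_mapDomain _ (HomOn.injective hκ), (hG g hg).1, one_mul]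
      rw [hm] at hl hone ⊢
      subst hyz
      classical
      refine ⟨?_, fun v hv => ?_⟩
      · rw [coeff_add, coeff_smul, hone, hμz]
        simpa using hc
      · rcases Finset.mem_union.1 (support_add hv) with h | h
        · exact hl.2 v (support_smul h)
        · exact Or.inr (hlt v h)
  · refine low ?_
    have hle : A.leadSpan G (fun w => w = μ ∨ A.mlt w μ) ≤ A.leadSpan G fun w => A.mlt w μ := by
      refine Submodule.span_le.2 ?_
      rintro _ ⟨g', hg', κ', hκ', m', hm' | hm', rfl⟩
      · exact (hex ⟨g', hg', κ', hκ', m', hm'⟩).elim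
      · exact Submodule.subset_span ⟨g', hg', κ', hκ', m', hm', rfl⟩
    exact hle hμ

/-- It suffices to resolve the overlaps within a large window. -/
theorem overlapsResolve_of_window {r N : ℕ} (hN : 2 * (A.win r).length ≤ N)
    (hG : ∀ g ∈ G, (∀ x ∈ g.1.support, x ∈ A.win r) ∧ ∀ x ∈ g.2.vars, x ∈ A.win r)
    (H : ∀ g ∈ G, ∀ g' ∈ G, ∀ ι ι' : X → X, HomOn C C {x | x ∈ A.win r} ι →
      HomOn C C {x | x ∈ A.win r} ι' → (∀ x ∈ A.win r, ι x ∈ A.win N ∧ ι' x ∈ A.win N) →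
      ∃ n n' : X →₀ ℕ, n + g.1.mapDomain ι = n' + g'.1.mapDomain ι' ∧
        (∀ x, n x = 0 ∨ n' x = 0) ∧
        monomial n 1 * rename ι g.2 - monomial n' 1 * rename ι' g'.2 ∈
          A.leadSpan G fun w => A.mlt w (n + g.1.mapDomain ι)) :
    A.OverlapsResolve G := by
  classical
  intro g hg g' hg' κ hκ κ' hκ' m m' hm
  -- An overlap involves only the images of the window under both embeddings, so it is the image
  -- under some `σ` of an overlap inside a window of fixed size.
  let S : Finset X := (A.win r).toFinset.image κ ∪ (A.win r).toFinset.image κ'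
  have hS : S.card ≤ N := by
    refine (Finset.card_union_le _ _).trans ?_
    have h1 := (Finset.card_image_le (s := (A.win r).toFinset) (f := κ)).trans
      (List.toFinset_card_le _)
    have h2 := (Finset.card_image_le (s := (A.win r).toFinset) (f := κ')).trans
      (List.toFinset_card_le _)
    omega
  obtain ⟨c, σ, hσ, hc⟩ := A.compress S
  have hcS : HomOn C C (S : Set X) c := HomOn.of_leftInverse hσ fun s hs => (hc s hs).2
  have hS1 : ∀ x ∈ A.win r, κ x ∈ S := fun x hx =>
    Finset.mem_union_left _ (Finset.mem_image_of_mem _ (List.mem_toFinset.2 hx))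
  have hS2 : ∀ x ∈ A.win r, κ' x ∈ S := fun x hx =>
    Finset.mem_union_right _ (Finset.mem_image_of_mem _ (List.mem_toFinset.2 hx))
  obtain ⟨n, n', hn, hnn, hmem⟩ := H g hg g' hg' (c ∘ κ) (c ∘ κ')
    (hcS.comp (HomOn.mono hκ (Set.subset_univ _)) hS1)
    (hcS.comp (HomOn.mono hκ' (Set.subset_univ _)) hS2)
    fun x hx => ⟨A.win_mono _ _ hS _ (hc _ (hS1 x hx)).1, A.win_mono _ _ hS _ (hc _ (hS2 x hx)).1⟩
  have e1 : (g.1.mapDomain (c ∘ κ)).mapDomain σ = g.1.mapDomain κ := by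
    rw [← Finsupp.mapDomain_comp]
    exact Finsupp.mapDomain_congr fun x hx => (hc _ (hS1 x ((hG g hg).1 x hx))).2
  have e2 : (g'.1.mapDomain (c ∘ κ')).mapDomain σ = g'.1.mapDomain κ' := by
    rw [← Finsupp.mapDomain_comp]
    exact Finsupp.mapDomain_congr fun x hx => (hc _ (hS2 x ((hG g' hg').1 x hx))).2
  have e3 : rename σ (rename (c ∘ κ) g.2) = rename κ g.2 := by
    rw [rename_rename]
    exact rename_congr_vars fun x hx => (hc _ (hS1 x ((hG g hg).2 x hx))).2
  have e4 : rename σ (rename (c ∘ κ') g'.2) = rename κ' g'.2 := by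
    rw [rename_rename]
    exact rename_congr_vars fun x hx => (hc _ (hS2 x ((hG g' hg').2 x hx))).2
  have hn' := congrArg (Finsupp.mapDomain σ) hn
  rw [Finsupp.mapDomain_add, Finsupp.mapDomain_add, e1, e2] at hn'
  have hi := HomOn.injective hσ
  have hdis : ∀ x, n.mapDomain σ x = 0 ∨ n'.mapDomain σ x = 0 := by
    intro x
    by_cases hx : x ∈ Set.range σ
    · obtain ⟨x, rfl⟩ := hx
      simpa only [Finsupp.mapDomain_apply hi] using hnn x
    · exact Or.inl (Finsupp.mapDomain_of_notMem_range _ _ hx)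
  -- The cofactors `n`, `n'` have disjoint supports and so belong to the least common multiple. Any
  -- other pair of cofactors differs from their image under `σ` by a common monomial.
  have hk : ∀ x, (m - n.mapDomain σ) x + n.mapDomain σ x = m x ∧
      (m - n.mapDomain σ) x + n'.mapDomain σ x = m' x := by
    intro x
    have h1 := DFunLike.congr_fun hm x
    have h2 := DFunLike.congr_fun hn' x
    have h3 := hdis x
    simp only [Finsupp.add_apply, Finsupp.tsub_apply] at h1 h2 ⊢
    omega
  have hk1 : (m - n.mapDomain σ) + n.mapDomain σ = m := Finsupp.ext fun x => (hk x).1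
  have hk2 : (m - n.mapDomain σ) + n'.mapDomain σ = m' := Finsupp.ext fun x => (hk x).2
  generalize m - n.mapDomain σ = k at hk1 hk2
  have := map_mem_leadSpan (Q := fun w => A.mlt w (m + g.1.mapDomain κ)) hσ k (fun w hw => ?_) hmem
  · rw [map_sub, map_mul, map_mul, rename_monomial, rename_monomial, e3, e4, mul_sub, ← mul_assoc,
      ← mul_assoc, monomial_mul, monomial_mul, hk1, hk2, one_mul] at this
    exact this
  · have := A.mlt_add_left k (A.mlt_mapDomain hσ hw)
    rwa [Finsupp.mapDomain_add, e1, ← add_assoc, hk1] at this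

end Arena

/-! ### Standard representations, normal forms and finite Gröbner bases. -/

namespace Arena

variable {X : Type} [Primcodable X] {C : Cmp X} {A : Arena C} {K : Type*} [Field K]

/-- A set which exhausts `I` by leading exponents spans it, with control of leading exponents. -/
theorem mem_leadSpan_of_lead {G : Set ((X →₀ ℕ) × MvPolynomial X K)} (hG : A.IsMonic G)
    {I : Ideal (MvPolynomial X K)} (hGI : ∀ g ∈ G, ∀ κ ∈ A.Emb, rename κ g.2 ∈ I)
    (hI : ∀ h ∈ I, h ≠ 0 → ∃ g ∈ G, ∃ κ ∈ A.Emb, ∃ m, A.IsLead (m + g.1.mapDomain κ) h)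
    {P : (X →₀ ℕ) → Prop} (hP : ∀ v w, A.mlt v w → P w → P v) {h : MvPolynomial X K} (hh : h ∈ I)
    (hPh : ∀ v ∈ h.support, P v) : h ∈ A.leadSpan G P := by
  classical
  by_cases h0 : h = 0
  · rw [h0]; exact zero_mem _
  obtain ⟨u, hu⟩ := exists_isLead (A := A) h0
  induction u using A.mlt_wf.induction generalizing h with
  | _ u ih =>
  obtain ⟨g, hg, κ, hκ, m, hl⟩ := hI h hh h0
  have hPu : P (m + g.1.mapDomain κ) := hPh _ (mem_support_iff.2 hl.1)
  have hgl := ((hG g hg).2.rename hκ).monomial_mul m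
  have hone : coeff (m + g.1.mapDomain κ) (monomial m 1 * rename κ g.2) = 1 := by
    rw [coeff_monomial_mul, coeff_rename_mapDomain _ (HomOn.injective hκ), (hG g hg).1, one_mul]
  have hlu : m + g.1.mapDomain κ = u := by
    rcases hu.2 _ (mem_support_iff.2 hl.1) with h1 | h1
    · exact h1
    rcases hl.2 _ (mem_support_iff.2 hu.1) with h2 | h2
    · exact h2.symm
    · exact (A.mlt_irrefl _ (A.mlt_trans h1 h2)).elim
  have hmem : monomial m 1 * rename κ g.2 ∈ A.leadSpan G P :=
    Submodule.subset_span ⟨g, hg, κ, hκ, m, hPu, rfl⟩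
  have hmemI : monomial m 1 * rename κ g.2 ∈ I := Ideal.mul_mem_left _ _ (hGI g hg κ hκ)
  rw [hlu] at hgl hone hPu
  generalize monomial m 1 * rename κ g.2 = q at *
  set c := coeff u h
  have hlt : ∀ v ∈ (h - c • q).support, A.mlt v u := by
    intro v hv
    have hne : v ≠ u := by
      rintro rfl
      rw [mem_support_iff, coeff_sub, coeff_smul, hone] at hv
      exact hv (by simp [c])
    rcases Finset.mem_union.1 (support_sub _ _ _ hv) with h1 | h1
    · exact (hu.2 v h1).resolve_left hne
    · exact (hgl.2 v (support_smul h1)).resolve_left hne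
  have hsub : h - c • q ∈ A.leadSpan G P := by
    by_cases h0' : h - c • q = 0
    · rw [h0']; exact zero_mem _
    obtain ⟨u', hu'⟩ := exists_isLead (A := A) h0'
    refine ih u' (hlt u' (mem_support_iff.2 hu'.1)) ?_ (fun v hv => hP _ _ (hlt v hv) hPu) h0' hu'
    refine sub_mem hh ?_
    rw [smul_eq_C_mul]
    exact Ideal.mul_mem_left _ _ hmemI
  have := add_mem hsub (Submodule.smul_mem _ c hmem)
  rwa [sub_add_cancel] at this

/-- Polynomials outside of an ideal have nonzero normal forms. -/
theorem exists_normalForm (G : Set ((X →₀ ℕ) × MvPolynomial X K)) (hG : A.IsMonic G)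
    {I : Ideal (MvPolynomial X K)} (hGI : ∀ g ∈ G, ∀ κ ∈ A.Emb, rename κ g.2 ∈ I)
    {f : MvPolynomial X K} (hf : f ∉ I) :
    ∃ f₀ u, f - f₀ ∈ I ∧ A.IsLead u f₀ ∧ ¬ ∃ g ∈ G, ∃ κ ∈ A.Emb, ∃ m, m + g.1.mapDomain κ = u := by
  classical
  have h0 : f ≠ 0 := fun h => hf (h ▸ zero_mem _)
  obtain ⟨u, hu⟩ := exists_isLead (A := A) h0
  induction u using A.mlt_wf.induction generalizing f with
  | _ u ih =>
  by_cases hex : ∃ g ∈ G, ∃ κ ∈ A.Emb, ∃ m, m + g.1.mapDomain κ = u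
  · obtain ⟨g, hg, κ, hκ, m, hm⟩ := hex
    have hgl := ((hG g hg).2.rename hκ).monomial_mul m
    have hone : coeff (m + g.1.mapDomain κ) (monomial m 1 * rename κ g.2) = 1 := by
      rw [coeff_monomial_mul, coeff_rename_mapDomain _ (HomOn.injective hκ), (hG g hg).1, one_mul]
    have hmemI : coeff u f • (monomial m 1 * rename κ g.2) ∈ I := by
      rw [smul_eq_C_mul]
      exact Ideal.mul_mem_left _ _ (Ideal.mul_mem_left _ _ (hGI g hg κ hκ))
    rw [hm] at hgl hone
    generalize monomial m 1 * rename κ g.2 = q at *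
    have hf' : f - coeff u f • q ∉ I := fun h => hf (by simpa using add_mem h hmemI)
    have h0' : f - coeff u f • q ≠ 0 := fun h => hf' (h ▸ zero_mem _)
    obtain ⟨u', hu'⟩ := exists_isLead (A := A) h0'
    have hlt : A.mlt u' u := by
      have hv := mem_support_iff.2 hu'.1
      have hne : u' ≠ u := by
        rintro rfl
        rw [mem_support_iff, coeff_sub, coeff_smul, hone] at hv
        exact hv (by simp)
      rcases Finset.mem_union.1 (support_sub _ _ _ hv) with h1 | h1
      · exact (hu.2 _ h1).resolve_left hne
      · exact (hgl.2 _ (support_smul h1)).resolve_left hne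
    obtain ⟨f₀, v, h1, h2, h3⟩ := ih u' hlt hf' h0' hu'
    refine ⟨f₀, v, ?_, h2, h3⟩
    have := add_mem h1 hmemI
    rwa [sub_right_comm, sub_add_cancel] at this
  · exact ⟨f, u, by simp, hu, hex⟩

variable (A) in
/-- Equivariant ideals generated within a window have finite Gröbner bases. -/
theorem exists_groebner {n : ℕ} {B : Set (MvPolynomial X K)}
    (hB : ∀ b ∈ B, ∀ x ∈ b.vars, x ∈ A.win n) :
    ∃ (r : ℕ) (G : Finset ((X →₀ ℕ) × MvPolynomial X K)), A.IsMonic (G : Set ((X →₀ ℕ) × MvPolynomial X K)) ∧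
      (∀ g ∈ G, g.2 ∈ orbitIdeal A.Emb B ∧ (∀ x ∈ g.1.support, x ∈ A.win r) ∧
        ∀ x ∈ g.2.vars, x ∈ A.win r) ∧
      ∀ h ∈ orbitIdeal A.Emb B, h ≠ 0 →
        ∃ g ∈ G, ∃ κ ∈ A.Emb, ∃ m, A.IsLead (m + g.1.mapDomain κ) h := by
  classical
  set I := orbitIdeal A.Emb B
  let P : ℕ × (X →₀ ℕ) × MvPolynomial X K → Prop := fun a =>
    a.2.2 ∈ I ∧ (∀ x ∈ a.2.2.vars, x ∈ A.win a.1) ∧ a.2.2.coeff a.2.1 = 1 ∧ A.IsLead a.2.1 a.2.2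
  -- Domination of labelled windows makes a renaming of the first leading monomial divide the
  -- second.
  let le : ℕ × (X →₀ ℕ) × MvPolynomial X K → ℕ × (X →₀ ℕ) × MvPolynomial X K → Prop :=
    fun a b => WindowLE C A.win (· ≤ ·) (a.1, fun x => a.2.1 x) (b.1, fun x => b.2.1 x)
  have hfin : ∃ s : Finset (ℕ × (X →₀ ℕ) × MvPolynomial X K), (∀ a ∈ s, P a) ∧
      ∀ b, P b → ∃ a ∈ s, le a b := by
    by_contra hcon
    push Not at hcon
    obtain ⟨f, -, hf⟩ := exists_seq_of_forall_finset_exists P (fun a b => ¬ le a b) hcon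
    obtain ⟨i, j, hij, h⟩ := A.wqo (W := ℕ) (· ≤ ·) wellQuasiOrdered_le
      fun k => ((f k).1, fun x => (f k).2.1 x)
    exact hf i j hij h
  have hsupp : ∀ a, P a → ∀ x ∈ a.2.1.support, x ∈ A.win a.1 := fun a ha x hx =>
    ha.2.1 x ((mem_vars_iff_mem_support _).2 ⟨_, mem_support_iff.2 ha.2.2.2.1, hx⟩)
  obtain ⟨s, hs, hs'⟩ := hfin
  have hle : ∀ a ∈ s, a.1 ≤ s.sup Prod.fst := fun a ha => Finset.le_sup (f := Prod.fst) ha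
  refine ⟨s.sup Prod.fst, s.image Prod.snd, ?_, ?_, ?_⟩
  · intro g hg
    obtain ⟨a, ha, rfl⟩ := Finset.mem_image.1 (Finset.mem_coe.1 hg)
    exact (hs a ha).2.2
  · intro g hg
    obtain ⟨a, ha, rfl⟩ := Finset.mem_image.1 hg
    exact ⟨(hs a ha).1, fun x hx => A.win_mono _ _ (hle a ha) _ (hsupp a (hs a ha) x hx),
      fun x hx => A.win_mono _ _ (hle a ha) _ ((hs a ha).2.1 x hx)⟩
  · intro h hh h0
    -- `h` need not lie in a window. Compressing its variables alone could leave the ideal, so the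
    -- points used by a representation of `h` are compressed along with them.
    obtain ⟨F, hF⟩ := A.exists_finset_of_mem_orbitIdeal (CZ := C) hB (E := A.Emb)
      (fun e he => HomOn.mono he (Set.subset_univ _)) hh
    obtain ⟨c, σ, hσ, hc⟩ := A.compress (F ∪ h.vars)
    have hcF : HomOn C C ((F ∪ h.vars : Finset X) : Set X) c :=
      HomOn.of_leftInverse hσ fun x hx => (hc x hx).2
    have h1 : rename c h ∈ I := hF c (hcF.mono (by simp))
    have h2 : rename σ (rename c h) = h := by
      rw [rename_rename]
      conv_rhs => rw [← rename_id_apply h]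
      exact rename_congr_vars fun x hx => (hc x (Finset.mem_union_right _ hx)).2
    have h3 : rename c h ≠ 0 := fun h3 => h0 (by rw [← h2, h3, map_zero])
    obtain ⟨u, hu⟩ := exists_isLead (A := A) h3
    have hcu := hu.1
    have hP : P ((F ∪ h.vars).card, u, (coeff u (rename c h))⁻¹ • rename c h) := by
      refine ⟨?_, ?_, ?_, ?_, ?_⟩
      · dsimp only
        rw [smul_eq_C_mul]
        exact Ideal.mul_mem_left _ _ h1
      · intro x hx
        obtain ⟨d, hd, hx⟩ := (mem_vars_iff_mem_support _).1 hx
        have := vars_rename c h ((mem_vars_iff_mem_support _).2 ⟨d, support_smul hd, hx⟩)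
        obtain ⟨y, hy, rfl⟩ := Finset.mem_image.1 this
        exact (hc y (Finset.mem_union_right _ hy)).1
      · dsimp only
        rw [coeff_smul, smul_eq_mul, inv_mul_cancel₀ hcu]
      · dsimp only
        rw [coeff_smul, smul_eq_mul, inv_mul_cancel₀ hcu]
        exact one_ne_zero
      · exact fun v hv => hu.2 v (support_smul hv)
    obtain ⟨a, ha, κ, hκ, hle⟩ := hs' _ hP
    have hsub : a.2.1.mapDomain κ ≤ u := by
      intro x
      by_cases hx : x ∈ Set.range κ
      · obtain ⟨x, rfl⟩ := hx
        rw [Finsupp.mapDomain_apply hκ.injective]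
        by_cases hx : x ∈ a.2.1.support
        · exact (hle x (hsupp a (hs a ha) x hx)).2
        · rw [Finsupp.notMem_support_iff.1 hx]
          exact Nat.zero_le _
      · rw [Finsupp.mapDomain_of_notMem_range _ _ hx]
        exact Nat.zero_le _
    refine ⟨a.2, Finset.mem_image_of_mem _ ha, σ ∘ κ, HomOn.comp_univ hσ hκ,
      (u - a.2.1.mapDomain κ).mapDomain σ, ?_⟩
    rw [Finsupp.mapDomain_comp, ← Finsupp.mapDomain_add, tsub_add_cancel_of_le hsub]
    have := hu.rename hσ
    rwa [h2] at this

end Arena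

/-! ### Codes of monomials and polynomials; computability of their operations. -/

namespace Code

/-- Codes of monomials. -/
abbrev Mon (X : Type) : Type := List (X × ℕ)

/-- Codes of polynomials. -/
abbrev Poly (K : Type*) (X : Type) : Type _ := List (K × Mon X)

variable {X Z : Type} {K : Type*}

/-- The exponent vector of a monomial code. -/
noncomputable def mon (m : Mon X) : X →₀ ℕ := (m.map fun v => Finsupp.single v.1 v.2).sum

/-- Renaming of variables in monomial codes. -/
def renameMon (f : X → Z) (m : Mon X) : Mon Z := m.map fun v => (f v.1, v.2)

/-- Renaming of variables in polynomial codes. -/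
def renamePoly (f : X → Z) (p : Poly K X) : Poly K Z := p.map fun t => (t.1, renameMon f t.2)

variable [Field K]

/-- The polynomial denoted by a polynomial code. -/
noncomputable def poly (p : Poly K X) : MvPolynomial X K :=
  (p.map fun t => monomial (mon t.2) t.1).sum

/-- Multiplication of a polynomial code by a term. -/
def mulTerm (t : K × Mon X) (p : Poly K X) : Poly K X := p.map fun s => (t.1 * s.1, t.2 ++ s.2)

@[simp] theorem mon_nil : mon ([] : Mon X) = 0 := rfl

@[simp] theorem mon_cons (v : X × ℕ) (m : Mon X) :
    mon (v :: m) = Finsupp.single v.1 v.2 + mon m := by simp [mon]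

@[simp] theorem mon_append (m n : Mon X) : mon (m ++ n) = mon m + mon n := by simp [mon]

@[simp] theorem poly_nil : poly ([] : Poly K X) = 0 := rfl

@[simp] theorem poly_cons (t : K × Mon X) (p : Poly K X) :
    poly (t :: p) = monomial (mon t.2) t.1 + poly p := by simp [poly]

@[simp] theorem poly_append (p q : Poly K X) : poly (p ++ q) = poly p + poly q := by simp [poly]

@[simp] theorem mon_renameMon (f : X → Z) (m : Mon X) :
    mon (renameMon f m) = (mon m).mapDomain f := by
  induction m with
  | nil => simp [renameMon]
  | cons v m ih =>
    rw [mon_cons, Finsupp.mapDomain_add, Finsupp.mapDomain_single, ← ih]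
    exact mon_cons _ _

@[simp] theorem poly_renamePoly (f : X → Z) (p : Poly K X) :
    poly (renamePoly f p) = rename f (poly p) := by
  induction p with
  | nil => simp [renamePoly]
  | cons t p ih =>
    rw [poly_cons, map_add, rename_monomial, ← ih, ← mon_renameMon]
    exact poly_cons _ _

@[simp] theorem poly_mulTerm (t : K × Mon X) (p : Poly K X) :
    poly (mulTerm t p) = monomial (mon t.2) t.1 * poly p := by
  induction p with
  | nil => simp [mulTerm]
  | cons s p ih =>
    rw [poly_cons, mul_add, monomial_mul, ← ih, ← mon_append]
    exact poly_cons _ _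

theorem mem_of_mon_ne_zero {m : Mon X} {x : X} (h : mon m x ≠ 0) : ∃ v ∈ m, v.1 = x := by
  classical
  induction m with
  | nil => simp at h
  | cons v m ih =>
    by_cases hv : v.1 = x
    · exact ⟨v, List.mem_cons_self, hv⟩
    · rw [mon_cons, Finsupp.add_apply, Finsupp.single_apply, if_neg hv, zero_add] at h
      obtain ⟨w, hw, hx⟩ := ih h
      exact ⟨w, List.mem_cons_of_mem _ hw, hx⟩

theorem mem_of_mem_support {p : Poly K X} {u : X →₀ ℕ} (h : u ∈ (poly p).support) :
    ∃ t ∈ p, mon t.2 = u := by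
  classical
  induction p with
  | nil => simp at h
  | cons t p ih =>
    rw [poly_cons] at h
    rcases Finset.mem_union.1 (support_add h) with h | h
    · exact ⟨t, List.mem_cons_self, (Finset.mem_singleton.1 (support_monomial_subset h)).symm⟩
    · obtain ⟨s, hs, hu⟩ := ih h
      exact ⟨s, List.mem_cons_of_mem _ hs, hu⟩

theorem exists_mon (u : X →₀ ℕ) : ∃ m : Mon X, mon m = u ∧ ∀ v ∈ m, v.1 ∈ u.support := by
  classical
  refine ⟨u.support.toList.map fun x => (x, u x), ?_, by simp⟩
  have : mon (u.support.toList.map fun x => (x, u x)) =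
      (u.support.toList.map fun x => Finsupp.single x (u x)).sum := by
    simp [mon, Function.comp_def]
  rw [this, Finset.sum_map_toList]
  exact Finsupp.sum_single u

theorem exists_poly (p : MvPolynomial X K) : ∃ q : Poly K X, poly q = p ∧
    ∀ t ∈ q, mon t.2 ∈ p.support ∧ ∀ v ∈ t.2, v.1 ∈ p.vars := by
  classical
  choose c hc hc' using exists_mon (X := X)
  refine ⟨p.support.toList.map fun u => (coeff u p, c u), ?_, ?_⟩
  · have : poly (p.support.toList.map fun u => (coeff u p, c u)) =
        (p.support.toList.map fun u => monomial u (coeff u p)).sum := by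
      simp [poly, Function.comp_def, hc]
    rw [this, Finset.sum_map_toList]
    exact (as_sum p).symm
  · intro t ht
    obtain ⟨u, hu, rfl⟩ := List.mem_map.1 ht
    rw [Finset.mem_toList] at hu
    dsimp only
    rw [hc]
    exact ⟨hu, fun v hv => (mem_vars_iff_mem_support _).2 ⟨u, hu, hc' u v hv⟩⟩

/-- Codes are not normalized, so equality is tested by values; only listed variables can have
nonzero exponents. -/
theorem mon_eq_iff (m n : Mon X) : mon m = mon n ↔ ∀ v ∈ m ++ n, mon m v.1 = mon n v.1 := by
  refine ⟨fun h v _ => by rw [h], fun h => Finsupp.ext fun x => ?_⟩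
  by_contra hne
  have : mon m x ≠ 0 ∨ mon n x ≠ 0 := by omega
  rcases this with h1 | h1
  · obtain ⟨v, hv, rfl⟩ := mem_of_mon_ne_zero h1
    exact hne (h v (List.mem_append_left _ hv))
  · obtain ⟨v, hv, rfl⟩ := mem_of_mon_ne_zero h1
    exact hne (h v (List.mem_append_right _ hv))

section Computability

variable [Primcodable X] [Primcodable K] {α : Type*} [Primcodable α]

theorem computable_mon : Computable₂ fun (m : Mon X) (x : X) => mon m x := by
  classical
  have h : Computable₂ fun (a : Mon X × X) (p : ℕ × X × ℕ) =>
      if p.2.1 = a.2 then p.1 + p.2.2 else p.1 := by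
    refine Primrec.to_comp (Primrec.ite (Primrec.eq.comp (Primrec.fst.comp (Primrec.snd.comp
      Primrec.snd)) (Primrec.snd.comp Primrec.fst)) (Primrec.nat_add.comp
      (Primrec.fst.comp Primrec.snd) (Primrec.snd.comp (Primrec.snd.comp Primrec.snd)))
      (Primrec.fst.comp Primrec.snd))
  refine (Computable.list_foldl (f := Prod.fst) (g := fun _ => 0) Computable.fst
    (Computable.const 0) h).of_eq ?_
  rintro ⟨m, x⟩
  have : ∀ (m : Mon X) (s : ℕ),
      m.foldl (fun s v => if v.1 = x then s + v.2 else s) s = s + mon m x := by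
    intro m
    induction m with
    | nil => simp
    | cons v m ih =>
      intro s
      rw [List.foldl_cons, ih, mon_cons, Finsupp.add_apply, Finsupp.single_apply]
      split_ifs <;> ring
  simpa using this m 0

theorem computablePred_mon_eq {f g : α → Mon X} (hf : Computable f) (hg : Computable g) :
    ComputablePred fun a => mon (f a) = mon (g a) := by
  refine ComputablePred.of_eq (ComputablePred.forall_mem
    (p := fun a v => mon (f a) v.1 = mon (g a) v.1) (Computable.list_append.comp hf hg) ?_)
    fun a => (mon_eq_iff _ _).symm
  exact ComputablePred.eq
    (computable_mon.comp (hf.comp Computable.fst) (Computable.fst.comp Computable.snd))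
    (computable_mon.comp (hg.comp Computable.fst) (Computable.fst.comp Computable.snd))

theorem computablePred_mon_le {f g : α → Mon X} (hf : Computable f) (hg : Computable g) :
    ComputablePred fun a => mon (f a) ≤ mon (g a) := by
  refine ComputablePred.of_eq (ComputablePred.forall_mem
    (p := fun a v => mon (f a) v.1 ≤ mon (g a) v.1) hf ?_) fun a => ?_
  · exact (PrimrecPred.computablePred Primrec.nat_le).comp
      ((computable_mon.comp (hf.comp Computable.fst) (Computable.fst.comp Computable.snd)).pair
      (computable_mon.comp (hg.comp Computable.fst) (Computable.fst.comp Computable.snd)))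
  · refine ⟨fun h x => ?_, fun h v _ => h v.1⟩
    by_cases h1 : mon (f a) x = 0
    · rw [h1]; exact Nat.zero_le _
    · obtain ⟨v, hv, rfl⟩ := mem_of_mon_ne_zero h1
      exact h v hv

theorem computablePred_mlt {C : Cmp X} (A : Arena C) {f g : α → Mon X} (hf : Computable f)
    (hg : Computable g) : ComputablePred fun a => A.mlt (mon (f a)) (mon (g a)) := by
  have hfm : Computable₂ fun a x => mon (f a) x :=
    computable_mon.comp (hf.comp Computable.fst) Computable.snd
  have hgm : Computable₂ fun a x => mon (g a) x :=
    computable_mon.comp (hg.comp Computable.fst) Computable.snd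
  -- Both quantifiers over variables may be restricted to listed ones: the deciding variable has
  -- positive exponent in `g a`, and at unlisted variables both exponents vanish.
  refine ComputablePred.of_eq (ComputablePred.exists_mem
    (p := fun a v => mon (f a) v.1 < mon (g a) v.1 ∧ ∀ w ∈ f a ++ g a,
      ¬ C.code v.1 w.1 % 2 = 1 ∨ mon (f a) w.1 = mon (g a) w.1) hg ?_) fun a => ?_
  · refine ComputablePred.and ?_ ?_
    · exact (PrimrecPred.computablePred Primrec.nat_lt).comp
        ((hfm.comp Computable.fst (Computable.fst.comp Computable.snd)).pair
          (hgm.comp Computable.fst (Computable.fst.comp Computable.snd)))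
    · refine ComputablePred.forall_mem (p := fun (x : α × X × ℕ) w =>
        ¬ C.code x.2.1 w.1 % 2 = 1 ∨ mon (f x.1) w.1 = mon (g x.1) w.1)
        ((Computable.list_append.comp hf hg).comp Computable.fst) ?_
      refine ComputablePred.or (ComputablePred.not (ComputablePred.eq ?_ (Computable.const 1)))
        (ComputablePred.eq ?_ ?_)
      · exact Primrec.nat_mod.to_comp.comp (A.code_primrec.to_comp.comp
          (Computable.fst.comp (Computable.snd.comp Computable.fst))
          (Computable.fst.comp Computable.snd)) (Computable.const 2)
      · exact hfm.comp (Computable.fst.comp Computable.fst) (Computable.fst.comp Computable.snd)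
      · exact hgm.comp (Computable.fst.comp Computable.fst) (Computable.fst.comp Computable.snd)
  · constructor
    · rintro ⟨v, hv, h1, h2⟩
      refine ⟨v.1, h1, fun y hy => ?_⟩
      by_contra hne
      have : mon (f a) y ≠ 0 ∨ mon (g a) y ≠ 0 := by omega
      rcases this with h | h
      · obtain ⟨w, hw, rfl⟩ := mem_of_mon_ne_zero h
        exact (h2 w (List.mem_append_left _ hw)).elim (· hy) hne
      · obtain ⟨w, hw, rfl⟩ := mem_of_mon_ne_zero h
        exact (h2 w (List.mem_append_right _ hw)).elim (· hy) hne
    · rintro ⟨x, h1, h2⟩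
      obtain ⟨v, hv, rfl⟩ := mem_of_mon_ne_zero (Nat.ne_of_gt (Nat.zero_lt_of_lt h1))
      exact ⟨v, hv, h1, fun w _ => or_iff_not_imp_left.2 fun h => h2 _ (not_not.1 h)⟩

theorem computable_coeff (hK : ComputableField K) :
    Computable₂ fun (p : Poly K X) (m : Mon X) => coeff (mon m) (poly p) := by
  classical
  have h : Computable₂ fun (a : Poly K X × Mon X) (p : K × K × Mon X) =>
      bif decide (mon p.2.2 = mon a.2) then p.1 + p.2.1 else p.1 := by
    refine Computable.cond ?_ ?_ ?_
    · exact (computablePred_mon_eq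
        (f := fun x : (Poly K X × Mon X) × K × K × Mon X => x.2.2.2) (g := fun x => x.1.2)
        (Computable.snd.comp (Computable.snd.comp Computable.snd))
        (Computable.snd.comp Computable.fst)).decide
    · exact hK.add.comp (Computable.fst.comp Computable.snd)
        (Computable.fst.comp (Computable.snd.comp Computable.snd))
    · exact Computable.fst.comp Computable.snd
  refine (Computable.list_foldl (f := Prod.fst) (g := fun _ => 0) Computable.fst
    (Computable.const 0) h).of_eq ?_
  rintro ⟨p, m⟩
  have : ∀ (p : Poly K X) (s : K),
      p.foldl (fun s t => bif decide (mon t.2 = mon m) then s + t.1 else s) s =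
        s + coeff (mon m) (poly p) := by
    intro p
    induction p with
    | nil => simp
    | cons t p ih =>
      intro s
      rw [List.foldl_cons, ih, poly_cons, coeff_add, coeff_monomial]
      by_cases h : mon t.2 = mon m <;> simp [h, add_assoc]
  simpa using this p 0

theorem computablePred_poly_eq_zero (hK : ComputableField K) {f : α → Poly K X} (hf : Computable f) :
    ComputablePred fun a => poly (f a) = 0 := by
  refine ComputablePred.of_eq (ComputablePred.forall_mem
    (p := fun a t => coeff (mon t.2) (poly (f a)) = 0) hf ?_) fun a => ?_
  · exact ComputablePred.eq ((computable_coeff hK).comp (hf.comp Computable.fst)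
      (Computable.snd.comp Computable.snd)) (Computable.const 0)
  · refine ⟨fun h => ?_, fun h t _ => by rw [h, coeff_zero]⟩
    by_contra h0
    obtain ⟨u, hu⟩ := Finset.nonempty_iff_ne_empty.2 (fun h => h0 (support_eq_empty.1 h))
    obtain ⟨t, ht, rfl⟩ := mem_of_mem_support hu
    exact mem_support_iff.1 hu (h t ht)

theorem computable_mulTerm (hK : ComputableField K) {t : α → K × Mon X} {p : α → Poly K X} (ht : Computable t)
    (hp : Computable p) : Computable fun a => mulTerm (t a) (p a) := by
  refine Computable.list_map hp ?_
  exact (hK.mul.comp (Computable.fst.comp (ht.comp Computable.fst))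
    (Computable.fst.comp Computable.snd)).pair
    (Computable.list_append.comp (Computable.snd.comp (ht.comp Computable.fst))
      (Computable.snd.comp Computable.snd))

end Computability

end Code

/-! ### Tabulated renamings and semidecidability of membership in spans. -/

namespace Code

variable {X : Type} {K : Type*}

open Classical in
/-- The map given by a table, extended by the identity. -/
noncomputable def app (l : List (X × X)) (x : X) : X := (l.lookup x).getD x

/-- All tables of maps from `L` to `V`. -/
def tables (L V : List X) : List (List (X × X)) :=
  L.foldr (fun x acc => acc.flatMap fun l => V.map fun y => (x, y) :: l) [[]]

theorem app_map (f : X → X) {L : List X} {x : X} (hx : x ∈ L) :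
    app (L.map fun x => (x, f x)) x = f x := by
  classical
  induction L with
  | nil => simp at hx
  | cons y L ih =>
    unfold app
    by_cases h : x = y
    · simp [h]
    · rw [List.map_cons, List.lookup_cons, show (x == y) = false by simpa using h]
      exact ih ((List.mem_cons.1 hx).resolve_left h)

theorem map_mem_tables (f : X → X) {L V : List X} (h : ∀ x ∈ L, f x ∈ V) :
    (L.map fun x => (x, f x)) ∈ tables L V := by
  induction L with
  | nil => simp [tables]
  | cons y L ih =>
    have := ih fun x hx => h x (List.mem_cons_of_mem _ hx)
    rw [tables, List.foldr_cons, List.mem_flatMap]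
    exact ⟨_, this, List.mem_map.2 ⟨f y, h y List.mem_cons_self, rfl⟩⟩

theorem renameMon_congr {Z : Type} {f g : X → Z} {m : Mon X} (h : ∀ v ∈ m, f v.1 = g v.1) :
    renameMon f m = renameMon g m :=
  List.map_congr_left fun v hv => by rw [h v hv]

theorem renamePoly_congr {Z : Type} {K : Type*} {f g : X → Z} {p : Poly K X}
    (h : ∀ t ∈ p, ∀ v ∈ t.2, f v.1 = g v.1) : renamePoly f p = renamePoly g p :=
  List.map_congr_left fun t ht => by rw [renameMon_congr (h t ht)]

section Primcodable

variable [Primcodable X] {C : Cmp X} (A : Arena C)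

/-- All variables of the polynomial code lie in the given window. -/
def PolyInWin (r : ℕ) (p : Poly K X) : Prop := ∀ t ∈ p, ∀ v ∈ t.2, v.1 ∈ A.win r

/-- All variables lie in the given window. -/
def InWin (r : ℕ) (G : List (Mon X × Poly K X)) : Prop :=
  ∀ e ∈ G, (∀ v ∈ e.1, v.1 ∈ A.win r) ∧ PolyInWin A r e.2

variable [Field K]

/-- The pairs of exponents and polynomials denoted by a list. -/
def gens (G : List (Mon X × Poly K X)) : Set ((X →₀ ℕ) × MvPolynomial X K) :=
  {g | ∃ e ∈ G, g = (mon e.1, poly e.2)}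

variable {A}

theorem mem_win_of_mem_vars {r : ℕ} {p : Poly K X} (h : PolyInWin A r p) :
    ∀ x ∈ (poly p).vars, x ∈ A.win r := by
  intro x hx
  obtain ⟨u, hu, hx⟩ := (mem_vars_iff_mem_support _).1 hx
  obtain ⟨t, ht, rfl⟩ := mem_of_mem_support hu
  obtain ⟨v, hv, rfl⟩ := mem_of_mon_ne_zero (Finsupp.mem_support_iff.1 hx)
  exact h t ht v hv

/-- A summand in a representation of an element of a span: a term, the table of a renaming, and
a generator. -/
abbrev Summand (K : Type*) (X : Type) : Type _ :=
  ((K × Mon X) × List (X × X)) × Mon X × Poly K X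

/-- The polynomial code of a summand. -/
noncomputable def Summand.code (s : Summand K X) : Poly K X :=
  mulTerm s.1.1 (renamePoly (app s.1.2) s.2.2)

variable (A)

/-- The summand is a multiple of a generator by an embedding, with bounded leading exponent. -/
def Summand.IsValid (r : ℕ) (G : List (Mon X × Poly K X)) (o : List (Mon X)) (s : Summand K X) :
    Prop :=
  s.2 ∈ G ∧ HomOn C C {x | x ∈ A.win r} (app s.1.2) ∧
    ∀ μ ∈ o, A.mlt (mon (s.1.1.2 ++ renameMon (app s.1.2) s.2.1)) (mon μ)

variable {A}

/-- As the generators lie in a window, embeddings may be replaced by their tables, and `A.ext` turns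
order-preserving tables back into embeddings. An empty list `o` imposes no bound; a singleton gives
the strict bound of Buchberger's criterion. -/
theorem mem_leadSpan_iff {r : ℕ} {G : List (Mon X × Poly K X)} (hG : InWin A r G)
    (o : List (Mon X)) (p : MvPolynomial X K) :
    p ∈ A.leadSpan (gens G) (fun w => ∀ μ ∈ o, A.mlt w (mon μ)) ↔
      ∃ l : List (Summand K X), (∀ s ∈ l, s.IsValid A r G o) ∧
        p = poly (l.flatMap Summand.code) := by
  constructor
  · intro h
    induction h using Submodule.span_induction with
    | mem f hf =>
      obtain ⟨_, ⟨e, he, rfl⟩, κ, hκ, m, hm, rfl⟩ := hf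
      obtain ⟨n, rfl, -⟩ := exists_mon m
      set al := (A.win r).map fun x => (x, κ x)
      have hal : ∀ x ∈ A.win r, app al x = κ x := fun x hx => app_map κ hx
      refine ⟨[(((1, n), al), e)], ?_, ?_⟩
      · simp only [List.mem_singleton, forall_eq]
        refine ⟨he, (HomOn.mono hκ (Set.subset_univ _)).congr hal, fun μ hμ => ?_⟩
        dsimp only
        rw [renameMon_congr fun v hv => hal _ ((hG e he).1 v hv), mon_append, mon_renameMon]
        exact hm μ hμ
      · simp only [List.flatMap_cons, List.flatMap_nil, List.append_nil, Summand.code]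
        rw [renamePoly_congr fun t ht v hv => hal _ ((hG e he).2 t ht v hv), poly_mulTerm,
          poly_renamePoly]
    | zero => exact ⟨[], by simp, by simp⟩
    | add f g _ _ hf hg =>
      obtain ⟨l, hl, rfl⟩ := hf
      obtain ⟨l', hl', rfl⟩ := hg
      refine ⟨l ++ l', fun s hs => ?_, by simp⟩
      exact (List.mem_append.1 hs).elim (hl s) (hl' s)
    | smul a f _ hf =>
      obtain ⟨l, hl, rfl⟩ := hf
      refine ⟨l.map fun s => (((a * s.1.1.1, s.1.1.2), s.1.2), s.2), fun s hs => ?_, ?_⟩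
      · obtain ⟨s', hs', rfl⟩ := List.mem_map.1 hs
        exact hl s' hs'
      · have (l : List (Summand K X)) : a • poly (l.flatMap Summand.code) =
            poly ((l.map fun s => (((a * s.1.1.1, s.1.1.2), s.1.2), s.2)).flatMap
              Summand.code) := by
          induction l with
          | nil => simp
          | cons s l ih =>
          simp only [List.map_cons, List.flatMap_cons, poly_append, smul_add, ih]
          congr 1
          simp only [Summand.code, poly_mulTerm]
          rw [← smul_mul_assoc, smul_monomial, smul_eq_mul]
        exact this l
  · rintro ⟨l, hl, rfl⟩
    induction l with
    | nil => exact zero_mem _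
    | cons s l ih =>
      rw [List.flatMap_cons, poly_append]
      refine add_mem ?_ (ih fun s hs => hl s (List.mem_cons_of_mem _ hs))
      obtain ⟨h1, h2, h3⟩ := hl s List.mem_cons_self
      obtain ⟨κ, hκ, hκ'⟩ := A.ext r _ h2
      have e1 : renameMon (app s.1.2) s.2.1 = renameMon κ s.2.1 :=
        renameMon_congr fun v hv => (hκ' _ ((hG _ h1).1 v hv)).symm
      have e2 : renamePoly (app s.1.2) s.2.2 = renamePoly κ s.2.2 :=
        renamePoly_congr fun t ht v hv => (hκ' _ ((hG _ h1).2 t ht v hv)).symm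
      rw [Summand.code, poly_mulTerm, e2, poly_renamePoly]
      have : monomial (mon s.1.1.2) s.1.1.1 * rename κ (poly s.2.2) =
          s.1.1.1 • (monomial (mon s.1.1.2) 1 * rename κ (poly s.2.2)) := by
        rw [← smul_mul_assoc, smul_monomial, smul_eq_mul, mul_one]
      rw [this]
      refine Submodule.smul_mem _ _ (Submodule.subset_span
        ⟨_, ⟨s.2, h1, rfl⟩, κ, hκ, mon s.1.1.2, fun μ hμ => ?_, rfl⟩)
      have := h3 μ hμ
      rwa [e1, mon_append, mon_renameMon] at this

end Primcodable

section Computability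

variable [Primcodable X] [Primcodable K] {α : Type*} [Primcodable α] {C : Cmp X} (A : Arena C)

theorem computable_app {l : α → List (X × X)} {x : α → X} (hl : Computable l)
    (hx : Computable x) : Computable fun a => app (l a) (x a) := by
  classical
  exact Computable.option_getD
    ((Primrec.listLookup (α := X) (β := X)).to_comp.comp hx hl) hx

theorem computable_renameMon {l : α → List (X × X)} {m : α → Mon X} (hl : Computable l)
    (hm : Computable m) : Computable fun a => renameMon (app (l a)) (m a) :=
  Computable.list_map hm ((computable_app (hl.comp Computable.fst)
    (Computable.fst.comp Computable.snd)).pair (Computable.snd.comp Computable.snd))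

theorem computable_renamePoly {l : α → List (X × X)} {p : α → Poly K X} (hl : Computable l)
    (hp : Computable p) : Computable fun a => renamePoly (app (l a)) (p a) :=
  Computable.list_map hp ((Computable.fst.comp Computable.snd).pair
    (computable_renameMon (hl.comp Computable.fst) (Computable.snd.comp Computable.snd)))

theorem computable_tables {L V : α → List X} (hL : Computable L) (hV : Computable V) :
    Computable fun a => tables (L a) (V a) := by
  have : Primrec₂ (tables : List X → List X → List (List (X × X))) := by
    refine Primrec.list_foldr (f := Prod.fst) (g := fun _ => [[]])
      (h := fun (a : List X × List X) (b : X × List (List (X × X))) =>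
        b.2.flatMap fun l => a.2.map fun y => (b.1, y) :: l) Primrec.fst (Primrec.const _) ?_
    refine Primrec.list_flatMap (Primrec.snd.comp Primrec.snd) ?_
    refine Primrec.list_map (Primrec.snd.comp (Primrec.fst.comp Primrec.fst)) ?_
    exact Primrec.list_cons.comp
      ((Primrec.fst.comp (Primrec.snd.comp (Primrec.fst.comp Primrec.fst))).pair Primrec.snd)
      (Primrec.snd.comp Primrec.fst)
  exact this.to_comp.comp hL hV

theorem computablePred_mem {β : Type*} [Primcodable β] {b : α → β} {l : α → List β}
    (hb : Computable b) (hl : Computable l) : ComputablePred fun a => b a ∈ l a :=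
  (ComputablePred.exists_mem (p := fun a c => b a = c) hl
    (ComputablePred.eq (hb.comp Computable.fst) Computable.snd)).of_eq fun a => by simp

theorem computable_win {r : α → ℕ} (hr : Computable r) : Computable fun a => A.win (r a) :=
  A.win_primrec.to_comp.comp hr

theorem computablePred_homOn {r : α → ℕ} {l : α → List (X × X)} (hr : Computable r)
    (hl : Computable l) :
    ComputablePred fun a => HomOn C C {x | x ∈ A.win (r a)} (app (l a)) := by
  have hw := computable_win A hr
  refine ComputablePred.forall_mem (p := fun a x => ∀ y ∈ A.win (r a),
    C.code (app (l a) x) (app (l a) y) = C.code x y) hw ?_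
  refine ComputablePred.forall_mem (p := fun (b : α × X) y =>
    C.code (app (l b.1) b.2) (app (l b.1) y) = C.code b.2 y) (hw.comp Computable.fst) ?_
  have h1 : Computable fun b : (α × X) × X => b.1.2 := Computable.snd.comp Computable.fst
  have h2 : Computable fun b : (α × X) × X => l b.1.1 :=
    hl.comp (Computable.fst.comp Computable.fst)
  exact ComputablePred.eq (A.code_primrec.to_comp.comp (computable_app h2 h1)
    (computable_app h2 Computable.snd)) (A.code_primrec.to_comp.comp h1 Computable.snd)

theorem computablePred_inWin {r : α → ℕ} {G : α → List (Mon X × Poly K X)} (hr : Computable r)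
    (hG : Computable G) : ComputablePred fun a => InWin A (r a) (G a) := by
  have hw := computable_win A hr
  refine ComputablePred.forall_mem (p := fun a e => (∀ v ∈ e.1, v.1 ∈ A.win (r a)) ∧
    ∀ t ∈ e.2, ∀ v ∈ t.2, v.1 ∈ A.win (r a)) hG (ComputablePred.and ?_ ?_)
  · refine ComputablePred.forall_mem (p := fun (b : α × Mon X × Poly K X) v =>
      v.1 ∈ A.win (r b.1)) (Computable.fst.comp Computable.snd) ?_
    exact computablePred_mem (Computable.fst.comp Computable.snd)
      (hw.comp (Computable.fst.comp Computable.fst))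
  · refine ComputablePred.forall_mem (p := fun (b : α × Mon X × Poly K X) t => ∀ v ∈ t.2,
      v.1 ∈ A.win (r b.1)) (Computable.snd.comp Computable.snd) ?_
    refine ComputablePred.forall_mem (p := fun (b : (α × Mon X × Poly K X) × K × Mon X) v =>
      v.1 ∈ A.win (r b.1.1)) (Computable.snd.comp Computable.snd) ?_
    exact computablePred_mem (Computable.fst.comp Computable.snd)
      (hw.comp (Computable.fst.comp (Computable.fst.comp Computable.fst)))

theorem computablePred_isValid {r : α → ℕ} {G : α → List (Mon X × Poly K X)}
    {o : α → List (Mon X)} {s : α → Summand K X} (hr : Computable r) (hG : Computable G)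
    (ho : Computable o) (hs : Computable s) :
    ComputablePred fun a => (s a).IsValid A (r a) (G a) (o a) := by
  have h1 : Computable fun a => (s a).1.2 := Computable.snd.comp (Computable.fst.comp hs)
  have h2 : Computable fun a => (s a).1.1.2 :=
    Computable.snd.comp (Computable.fst.comp (Computable.fst.comp hs))
  have h3 : Computable fun a => (s a).2.1 := Computable.fst.comp (Computable.snd.comp hs)
  refine ComputablePred.and (computablePred_mem (Computable.snd.comp hs) hG)
    (ComputablePred.and (computablePred_homOn A hr h1) ?_)
  refine ComputablePred.forall_mem (p := fun a μ =>
    A.mlt (mon ((s a).1.1.2 ++ renameMon (app (s a).1.2) (s a).2.1)) (mon μ)) ho ?_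
  exact computablePred_mlt A (Computable.list_append.comp (h2.comp Computable.fst)
    ((computable_renameMon h1 h3).comp Computable.fst)) Computable.snd

variable [Field K]

theorem computable_summandCode (hK : ComputableField K) :
    Computable (Summand.code : Summand K X → Poly K X) :=
  computable_mulTerm hK (Computable.fst.comp Computable.fst)
    (computable_renamePoly (Computable.snd.comp Computable.fst)
      (Computable.snd.comp Computable.snd))

/-- Membership in the span of multiples of generators within a window. -/
def SpanMemb (r : ℕ) (G : List (Mon X × Poly K X)) (o : List (Mon X)) (p : Poly K X) : Prop :=
  InWin A r G ∧ poly p ∈ A.leadSpan (gens G) fun w => ∀ μ ∈ o, A.mlt w (mon μ)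

theorem semidecidable_spanMemb (hK : ComputableField K) {r : α → ℕ}
    {G : α → List (Mon X × Poly K X)} {o : α → List (Mon X)} {p : α → Poly K X}
    (hr : Computable r) (hG : Computable G) (ho : Computable o) (hp : Computable p) :
    Semidecidable fun a => SpanMemb A (r a) (G a) (o a) (p a) := by
  have : Semidecidable fun a => InWin A (r a) (G a) ∧ ∃ l : List (Summand K X),
      (∀ s ∈ l, s.IsValid A (r a) (G a) (o a)) ∧
        poly (p a ++ mulTerm (-1, []) (l.flatMap Summand.code)) = 0 := by
    refine (Semidecidable.of_computable (computablePred_inWin A hr hG)).and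
      (Semidecidable.exists_ (Semidecidable.of_computable (ComputablePred.and ?_ ?_)))
    · refine ComputablePred.forall_mem (p := fun (b : α × List (Summand K X)) s =>
        s.IsValid A (r b.1) (G b.1) (o b.1)) Computable.snd ?_
      have hf : Computable fun b : (α × List (Summand K X)) × Summand K X => b.1.1 :=
        Computable.fst.comp Computable.fst
      exact computablePred_isValid A (hr.comp hf) (hG.comp hf) (ho.comp hf) Computable.snd
    · refine computablePred_poly_eq_zero hK (Computable.list_append.comp
        (hp.comp Computable.fst) (computable_mulTerm hK (Computable.const _)
          (Computable.list_flatMap Computable.snd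
            ((computable_summandCode hK).comp Computable.snd))))
  refine this.of_eq fun a => and_congr_right fun hw => ?_
  rw [mem_leadSpan_iff hw]
  refine exists_congr fun l => and_congr_right fun _ => ?_
  rw [poly_append, poly_mulTerm, mon_nil, monomial_zero', map_neg, C_1, neg_one_mul,
    ← sub_eq_add_neg, sub_eq_zero]

end Computability

end Code

/-! ### Certificates of non-membership. -/

namespace Code

variable {X : Type} {K : Type*} [Field K]

/-- Restore the leading terms of a list of monic polynomials, given by leading monomials and
tails. -/
def monic (G : List (Mon X × Poly K X)) : List (Mon X × Poly K X) :=
  G.map fun e => (e.1, (1, e.1) :: e.2)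

/-- A certificate of non-membership: a window, a Gröbner basis given by leading monomials and
tails, and the leading term and the tail of a normal form. -/
abbrev Certificate (K : Type*) (X : Type) : Type _ :=
  ℕ × List (Mon X × Poly K X) × (K × Mon X) × Poly K X

theorem mem_gens_monic {G : List (Mon X × Poly K X)} {g : (X →₀ ℕ) × MvPolynomial X K} :
    g ∈ gens (monic G) ↔ ∃ e ∈ G, g = (mon e.1, monomial (mon e.1) 1 + poly e.2) := by
  simp [gens, monic]

variable [Primcodable X] {C : Cmp X} (A : Arena C)

/-- The overlap of two generators under two tabulated renamings resolves. -/
def Resolves (r : ℕ) (G : List (Mon X × Poly K X)) (e e' : Mon X × Poly K X)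
    (l l' : List (X × X)) : Prop :=
  ∃ n : Mon X × Mon X,
    mon (n.1 ++ renameMon (app l) e.1) = mon (n.2 ++ renameMon (app l') e'.1) ∧
    (∀ w ∈ n.1, mon n.1 w.1 = 0 ∨ mon n.2 w.1 = 0) ∧
    SpanMemb A r G [n.1 ++ renameMon (app l) e.1]
      (mulTerm (1, n.1) (renamePoly (app l) e.2) ++ mulTerm (-1, n.2) (renamePoly (app l') e'.2))

/-- The certificate shows that `f` does not belong to the ideal generated by `B`. -/
def Refutes (f : Poly K X) (B : List (Poly K X)) (y : Certificate K X) : Prop :=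
  -- The basis is not required to lie in the ideal generated by `B`: excluding `f` from a larger
  -- ideal is enough.
  (∀ e ∈ y.2.1, ∀ s ∈ e.2, A.mlt (mon s.2) (mon e.1)) ∧
  (∀ b ∈ B, SpanMemb A y.1 (monic y.2.1) [] b) ∧
  (∀ e ∈ monic y.2.1, ∀ e' ∈ monic y.2.1,
    ∀ l ∈ tables (A.win y.1) (A.win (2 * (A.win y.1).length)),
    ∀ l' ∈ tables (A.win y.1) (A.win (2 * (A.win y.1).length)),
      (HomOn C C {x | x ∈ A.win y.1} (app l) ∧ HomOn C C {x | x ∈ A.win y.1} (app l')) →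
        Resolves A y.1 (monic y.2.1) e e' l l') ∧
  y.2.2.1.1 ≠ 0 ∧
  (∀ s ∈ y.2.2.2, A.mlt (mon s.2) (mon y.2.2.1.2)) ∧
  SpanMemb A y.1 (monic y.2.1) [] (f ++ mulTerm (-1, []) (y.2.2.1 :: y.2.2.2)) ∧
  ∀ e ∈ y.2.1, ∀ l ∈ tables (A.win y.1) (A.cand y.1 (y.2.2.1.2.map Prod.fst)),
    ¬ (HomOn C C {x | x ∈ A.win y.1} (app l) ∧ mon (renameMon (app l) e.1) ≤ mon y.2.2.1.2)

variable {A}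

theorem isLead_monomial_add {u : X →₀ ℕ} {c : K} (hc : c ≠ 0) {t : Poly K X}
    (h : ∀ s ∈ t, A.mlt (mon s.2) u) :
    coeff u (monomial u c + poly t) = c ∧ A.IsLead u (monomial u c + poly t) := by
  classical
  have ht : ∀ v ∈ (poly t).support, A.mlt v u := by
    intro v hv
    obtain ⟨s, hs, rfl⟩ := mem_of_mem_support hv
    exact h s hs
  have h0 : coeff u (poly t) = 0 := by
    by_contra hne
    exact A.mlt_irrefl u (ht u (mem_support_iff.2 hne))
  have h1 : coeff u (monomial u c + poly t) = c := by
    rw [coeff_add, coeff_monomial, if_pos rfl, h0, add_zero]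
  refine ⟨h1, by rwa [h1], fun v hv => ?_⟩
  rcases Finset.mem_union.1 (support_add hv) with h | h
  · exact Or.inl (Finset.mem_singleton.1 (support_monomial_subset h))
  · exact Or.inr (ht v h)

theorem spanMemb_nil_iff {r : ℕ} {G : List (Mon X × Poly K X)} {p : Poly K X} :
    SpanMemb A r G [] p ↔ InWin A r G ∧ poly p ∈ orbitIdeal A.Emb (Prod.snd '' gens G) := by
  rw [Arena.mem_orbitIdeal_iff, SpanMemb]
  have : (fun w : X →₀ ℕ => ∀ μ ∈ ([] : List (Mon X)), A.mlt w (mon μ)) = fun _ => True := by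
    funext w; simp
  rw [this]

/-- If `f` were a member, so would be its remainder in the ideal of the basis; Buchberger's
criterion would then give a basis element whose renamed leading monomial divides that of the
remainder, and the candidate search would have found such a renaming. -/
theorem not_mem_of_refutes {f : Poly K X} {B : List (Poly K X)} {y : Certificate K X}
    (h : Refutes A f B y) : poly f ∉ orbitIdeal A.Emb {p | ∃ b ∈ B, p = poly b} := by
  obtain ⟨r, G, ⟨c, v⟩, t⟩ := y
  obtain ⟨h1, h2, h3, h4, h5, h6, h7⟩ := h
  dsimp only at h1 h2 h3 h4 h5 h6 h7
  intro hf
  have hmon : A.IsMonic (gens (monic G)) := by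
    intro g hg
    obtain ⟨e, he, rfl⟩ := mem_gens_monic.1 hg
    exact isLead_monomial_add one_ne_zero (h1 e he)
  have hw : InWin A r (monic G) := h6.1
  have hres : A.OverlapsResolve (gens (monic G)) := by
    refine Arena.overlapsResolve_of_window (r := r) le_rfl ?_ ?_
    · rintro _ ⟨e, he, rfl⟩
      refine ⟨fun x hx => ?_, mem_win_of_mem_vars (hw e he).2⟩
      obtain ⟨v, hv, rfl⟩ := mem_of_mon_ne_zero (Finsupp.mem_support_iff.1 hx)
      exact (hw e he).1 v hv
    · rintro _ ⟨e, he, rfl⟩ _ ⟨e', he', rfl⟩ ι ι' hι hι' hN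
      have ha : ∀ x ∈ A.win r, app ((A.win r).map fun x => (x, ι x)) x = ι x :=
        fun x hx => app_map ι hx
      have ha' : ∀ x ∈ A.win r, app ((A.win r).map fun x => (x, ι' x)) x = ι' x :=
        fun x hx => app_map ι' hx
      obtain ⟨n, e1, e2, -, e3⟩ := h3 e he e' he' _ (map_mem_tables ι fun x hx => (hN x hx).1) _
        (map_mem_tables ι' fun x hx => (hN x hx).2) ⟨hι.congr ha, hι'.congr ha'⟩
      rw [renameMon_congr fun v hv => ha _ ((hw e he).1 v hv)] at e1 e3
      rw [renameMon_congr fun v hv => ha' _ ((hw e' he').1 v hv)] at e1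
      rw [renamePoly_congr fun t ht v hv => ha _ ((hw e he).2 t ht v hv),
        renamePoly_congr fun t ht v hv => ha' _ ((hw e' he').2 t ht v hv)] at e3
      refine ⟨mon n.1, mon n.2, by simpa using e1, fun x => ?_, ?_⟩
      · by_cases hx : mon n.1 x = 0
        · exact Or.inl hx
        · obtain ⟨w, hw, rfl⟩ := mem_of_mon_ne_zero hx
          exact e2 w hw
      · simp only [poly_append, poly_mulTerm, poly_renamePoly, List.mem_singleton, forall_eq,
          mon_append, mon_renameMon, map_neg, neg_mul, ← sub_eq_add_neg] at e3
        exact e3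
  have hle : orbitIdeal A.Emb {p | ∃ b ∈ B, p = poly b} ≤
      orbitIdeal A.Emb (Prod.snd '' gens (monic G)) := by
    refine Ideal.span_le.2 ?_
    rintro _ ⟨κ, hκ, _, ⟨b, hb, rfl⟩, rfl⟩
    exact A.rename_mem_orbitIdeal hκ (spanMemb_nil_iff.1 (h2 b hb)).2
  have hf₀ : poly ((c, v) :: t) ∈ orbitIdeal A.Emb (Prod.snd '' gens (monic G)) := by
    have h8 := (spanMemb_nil_iff.1 h6).2
    rw [poly_append, poly_mulTerm, mon_nil, monomial_zero', map_neg, C_1, neg_one_mul,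
      ← sub_eq_add_neg] at h8
    have := sub_mem (hle hf) h8
    rwa [sub_sub_cancel] at this
  obtain ⟨-, hlead⟩ := isLead_monomial_add h4 h5
  rw [← poly_cons (c, v) t] at hlead
  obtain ⟨g, hg, κ, hκ, m, hm⟩ := Arena.exists_lead_of_mem_leadSpan hmon hres
    (Arena.mem_orbitIdeal_iff.1 hf₀) hlead.ne_zero
  obtain ⟨e, he, rfl⟩ := mem_gens_monic.1 hg
  have hmv : m + (mon e.1).mapDomain κ = mon v := by
    rcases hlead.2 _ (mem_support_iff.2 hm.1) with h | h
    · exact h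
    rcases hm.2 _ (mem_support_iff.2 hlead.1) with h' | h'
    · exact h'.symm
    · exact (A.mlt_irrefl _ (A.mlt_trans h h')).elim
  -- Divisibility forces `κ` to send the variables of the leading monomial to variables of `v`,
  -- where `κ'` agrees with `κ`.
  obtain ⟨κ', hκ', hc⟩ := A.cand_spec r (v.map Prod.fst) κ hκ
  have ha : ∀ x ∈ A.win r, app ((A.win r).map fun x => (x, κ' x)) x = κ' x :=
    fun x hx => app_map κ' hx
  have hwe : ∀ w ∈ e.1, w.1 ∈ A.win r := by
    have := (hw (e.1, (1, e.1) :: e.2) (List.mem_map.2 ⟨e, he, rfl⟩)).1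
    exact this
  refine h7 e he _ (map_mem_tables κ' fun x hx => (hc x hx).1) ⟨hκ'.congr ha, ?_⟩
  rw [renameMon_congr fun w hw => ha _ (hwe w hw), mon_renameMon]
  have : (mon e.1).mapDomain κ' = (mon e.1).mapDomain κ := by
    refine Finsupp.mapDomain_congr fun x hx => ?_
    obtain ⟨w, hw, rfl⟩ := mem_of_mon_ne_zero (Finsupp.mem_support_iff.1 hx)
    refine (hc _ (hwe w hw)).2 ?_
    have h8 : mon v (κ w.1) ≠ 0 := by
      rw [← hmv, Finsupp.add_apply, Finsupp.mapDomain_apply (HomOn.injective hκ)]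
      have := Finsupp.mem_support_iff.1 hx
      omega
    obtain ⟨w', hw', h9⟩ := mem_of_mon_ne_zero h8
    exact List.mem_map.2 ⟨w', hw', h9⟩
  rw [this, ← hmv]
  exact le_add_self

variable (A) in
-- Certificates store leading monomial and tail separately, so that monicity holds by construction
-- once the tail is smaller.
theorem exists_monic_code {r : ℕ} {g : (X →₀ ℕ) × MvPolynomial X K} (h1 : g.2.coeff g.1 = 1)
    (h2 : A.IsLead g.1 g.2) (h3 : ∀ x ∈ g.1.support, x ∈ A.win r)
    (h4 : ∀ x ∈ g.2.vars, x ∈ A.win r) :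
    ∃ e : Mon X × Poly K X, mon e.1 = g.1 ∧ monomial (mon e.1) 1 + poly e.2 = g.2 ∧
      (∀ s ∈ e.2, A.mlt (mon s.2) (mon e.1)) ∧ (∀ v ∈ e.1, v.1 ∈ A.win r) ∧
      PolyInWin A r e.2 := by
  classical
  obtain ⟨m, hm, hm'⟩ := exists_mon g.1
  obtain ⟨q, hq, hq'⟩ := exists_poly (g.2 - monomial g.1 1)
  have hsup : ∀ v ∈ (g.2 - monomial g.1 1).support, v ∈ g.2.support ∧ v ≠ g.1 := by
    intro v hv
    have hne : v ≠ g.1 := by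
      rintro rfl
      rw [mem_support_iff, coeff_sub, h1, coeff_monomial, if_pos rfl] at hv
      exact hv (sub_self _)
    refine ⟨?_, hne⟩
    rw [mem_support_iff, coeff_sub, coeff_monomial, if_neg (Ne.symm hne), sub_zero] at hv
    exact mem_support_iff.2 hv
  refine ⟨(m, q), hm, ?_, fun s hs => ?_, fun v hv => h3 _ (hm' v hv), fun t ht v hv => ?_⟩
  · rw [hm, hq, add_sub_cancel]
  · obtain ⟨h5, h6⟩ := hsup _ (hq' s hs).1
    dsimp only
    rw [hm]
    exact (h2.2 _ h5).resolve_left h6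
  · obtain ⟨d, hd, hv⟩ := (mem_vars_iff_mem_support _).1 ((hq' t ht).2 v hv)
    exact h4 _ ((mem_vars_iff_mem_support _).2 ⟨d, (hsup d hd).1, hv⟩)

/-- The certificate consists of a finite Gröbner basis of the ideal generated by `B` and a normal
form of `f`. Overlaps resolve because their leading terms cancel and elements of the ideal have
representations without larger leading exponents. -/
theorem exists_refutes {f : Poly K X} {B : List (Poly K X)}
    (hB : ∃ n, ∀ b ∈ B, PolyInWin A n b)
    (hf : poly f ∉ orbitIdeal A.Emb {p | ∃ b ∈ B, p = poly b}) : ∃ y, Refutes A f B y := by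
  classical
  obtain ⟨n, hB⟩ := hB
  obtain ⟨r, G, hG, hGI, hI⟩ := A.exists_groebner (n := n) (B := {p | ∃ b ∈ B, p = poly b}) (by
    rintro _ ⟨b, hb, rfl⟩
    exact mem_win_of_mem_vars (hB b hb))
  set I := orbitIdeal A.Emb {p | ∃ b ∈ B, p = poly b} with hIdef
  choose! e he1 he2 he3 he4 he5 using fun (g : (X →₀ ℕ) × MvPolynomial X K) (hg : g ∈ G) =>
    exists_monic_code A (hG g hg).1 (hG g hg).2 (hGI g hg).2.1 (hGI g hg).2.2
  have hgens : gens (monic (G.toList.map e)) = (G : Set ((X →₀ ℕ) × MvPolynomial X K)) := by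
    ext g
    rw [mem_gens_monic]
    constructor
    · rintro ⟨_, h, rfl⟩
      obtain ⟨g, hg, rfl⟩ := List.mem_map.1 h
      rw [Finset.mem_toList] at hg
      rw [he2 g hg, he1 g hg]
      exact hg
    · intro hg
      exact ⟨e g, List.mem_map.2 ⟨g, Finset.mem_toList.2 hg, rfl⟩,
        Prod.ext (he1 g hg).symm (he2 g hg).symm⟩
  have hw : InWin A r (monic (G.toList.map e)) := by
    intro a ha
    obtain ⟨b, hb, rfl⟩ := List.mem_map.1 ha
    obtain ⟨g, hg, rfl⟩ := List.mem_map.1 hb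
    rw [Finset.mem_toList] at hg
    refine ⟨he4 g hg, fun t ht => ?_⟩
    rcases List.mem_cons.1 ht with rfl | ht
    · exact he4 g hg
    · exact he5 g hg t ht
  have hGI' : ∀ g ∈ (G : Set ((X →₀ ℕ) × MvPolynomial X K)), ∀ κ ∈ A.Emb, rename κ g.2 ∈ I :=
    fun g hg κ hκ => A.rename_mem_orbitIdeal hκ (hGI g hg).1
  have hspan : ∀ p : Poly K X, poly p ∈ I → SpanMemb A r (monic (G.toList.map e)) [] p := by
    refine fun p hp => ⟨hw, ?_⟩
    rw [hgens]
    exact Arena.mem_leadSpan_of_lead hG hGI' hI (by simp) hp (by simp)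
  obtain ⟨f₀, u, hu1, hu2, hu3⟩ := Arena.exists_normalForm _ hG hGI' hf
  obtain ⟨v, hv, -⟩ := exists_mon u
  obtain ⟨t, ht, ht'⟩ := exists_poly (f₀ - monomial u (coeff u f₀))
  have hf₀ : poly ((coeff u f₀, v) :: t) = f₀ := by
    rw [poly_cons, hv, ht, add_sub_cancel]
  refine ⟨(r, G.toList.map e, (coeff u f₀, v), t), ?_, ?_, ?_, hu2.1, ?_, ?_, ?_⟩
  · intro a ha
    obtain ⟨g, hg, rfl⟩ := List.mem_map.1 ha
    exact he3 g (Finset.mem_toList.1 hg)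
  · intro b hb
    refine hspan b (Ideal.subset_span ⟨id, homOn_id _ _, poly b, ⟨b, hb, rfl⟩, ?_⟩)
    rw [rename_id_apply]
  · rintro a ha a' ha' l - l' - ⟨hl, hl'⟩
    have hg : (mon a.1, poly a.2) ∈ G := by
      have : (mon a.1, poly a.2) ∈ gens (monic (G.toList.map e)) := ⟨a, ha, rfl⟩
      rwa [hgens] at this
    have hg' : (mon a'.1, poly a'.2) ∈ G := by
      have : (mon a'.1, poly a'.2) ∈ gens (monic (G.toList.map e)) := ⟨a', ha', rfl⟩
      rwa [hgens] at this
    obtain ⟨κ, hκ, hκl⟩ := A.ext r _ hl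
    obtain ⟨κ', hκ', hκl'⟩ := A.ext r _ hl'
    have e1 : renameMon (app l) a.1 = renameMon κ a.1 :=
      renameMon_congr fun v hv => (hκl _ ((hw _ ha).1 v hv)).symm
    have e2 : renamePoly (app l) a.2 = renamePoly κ a.2 :=
      renamePoly_congr fun t ht v hv => (hκl _ ((hw _ ha).2 t ht v hv)).symm
    have e1' : renameMon (app l') a'.1 = renameMon κ' a'.1 :=
      renameMon_congr fun v hv => (hκl' _ ((hw _ ha').1 v hv)).symm
    have e2' : renamePoly (app l') a'.2 = renamePoly κ' a'.2 :=
      renamePoly_congr fun t ht v hv => (hκl' _ ((hw _ ha').2 t ht v hv)).symm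
    set w := (mon a.1).mapDomain κ with hwdef
    set w' := (mon a'.1).mapDomain κ' with hwdef'
    -- Truncated differences are the cofactors of the least common multiple.
    obtain ⟨m, hm, -⟩ := exists_mon (w' - w)
    obtain ⟨m', hm', -⟩ := exists_mon (w - w')
    have hmm : mon m + w = mon m' + w' := by
      rw [hm, hm']
      ext x
      simp only [Finsupp.add_apply, Finsupp.tsub_apply]
      omega
    refine ⟨(m, m'), ?_, ?_, hw, ?_⟩
    · simp only [mon_append, e1, e1', mon_renameMon]
      exact hmm
    · intro x _
      simp only [hm, hm', Finsupp.tsub_apply]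
      omega
    · simp only [e1, e2, e2', mon_append, mon_renameMon, poly_append, poly_mulTerm,
        poly_renamePoly, List.mem_singleton, forall_eq, map_neg, neg_mul, ← sub_eq_add_neg, hgens]
      have hl1 := ((hG _ hg).2.rename hκ).monomial_mul (mon m)
      have hl2 := ((hG _ hg').2.rename hκ').monomial_mul (mon m')
      have hc1 : coeff (mon m + w) (monomial (mon m) 1 * rename κ (poly a.2)) = 1 := by
        rw [coeff_monomial_mul, hwdef, coeff_rename_mapDomain _ (HomOn.injective hκ), one_mul]
        exact (hG _ hg).1
      have hc2 : coeff (mon m + w) (monomial (mon m') 1 * rename κ' (poly a'.2)) = 1 := by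
        rw [hmm, coeff_monomial_mul, hwdef', coeff_rename_mapDomain _ (HomOn.injective hκ'),
          one_mul]
        exact (hG _ hg').1
      refine Arena.mem_leadSpan_of_lead hG hGI' hI (fun _ _ h h' => A.mlt_trans h h') ?_ ?_
      · exact sub_mem (Ideal.mul_mem_left _ _ (hGI' _ hg κ hκ))
          (Ideal.mul_mem_left _ _ (hGI' _ hg' κ' hκ'))
      · intro x hx
        have hne : x ≠ mon m + w := by
          rintro rfl
          rw [mem_support_iff, coeff_sub, hc1, hc2] at hx
          exact hx (sub_self _)
        rcases Finset.mem_union.1 (support_sub _ _ _ hx) with h | h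
        · exact (hl1.2 x h).resolve_left hne
        · have := hl2.2 x h
          rw [← hwdef', ← hmm] at this
          exact this.resolve_left hne
  · intro s hs
    have h1 := (ht' s hs).1
    dsimp only
    rw [hv]
    have hne : mon s.2 ≠ u := by
      intro h
      rw [h, mem_support_iff, coeff_sub, coeff_monomial, if_pos rfl] at h1
      exact h1 (sub_self _)
    rw [mem_support_iff, coeff_sub, coeff_monomial, if_neg (Ne.symm hne), sub_zero] at h1
    exact (hu2.2 _ (mem_support_iff.2 h1)).resolve_left hne
  · refine hspan _ ?_
    rw [poly_append, poly_mulTerm, mon_nil, monomial_zero', map_neg, C_1, neg_one_mul,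
      ← sub_eq_add_neg, hf₀]
    exact hu1
  · rintro a ha l - ⟨hl, hle⟩
    obtain ⟨g, hg, rfl⟩ := List.mem_map.1 ha
    rw [Finset.mem_toList] at hg
    obtain ⟨κ, hκ, hκl⟩ := A.ext r _ hl
    rw [renameMon_congr fun v hv => (hκl _ (he4 g hg v hv)).symm, mon_renameMon, he1 g hg] at hle
    dsimp only at hle
    rw [hv] at hle
    exact hu3 ⟨g, hg, κ, hκ, _, tsub_add_cancel_of_le hle⟩

end Code

/-! ### Decidability over arenas. -/

namespace Code

section Decidability

variable {X : Type} {K : Type*} [Primcodable X] [Primcodable K]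
  {α : Type*} [Primcodable α] {C : Cmp X} (A : Arena C)

theorem computablePred_tail_mlt {m : α → Mon X} {t : α → Poly K X} (hm : Computable m)
    (ht : Computable t) : ComputablePred fun a => ∀ s ∈ t a, A.mlt (mon s.2) (mon (m a)) :=
  ComputablePred.forall_mem (p := fun a s => A.mlt (mon s.2) (mon (m a))) ht
    (computablePred_mlt A (Computable.snd.comp Computable.snd) (hm.comp Computable.fst))

variable [Field K]

theorem semidecidable_resolves (hK : ComputableField K) {r : α → ℕ}
    {G : α → List (Mon X × Poly K X)} {e e' : α → Mon X × Poly K X} {l l' : α → List (X × X)}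
    (hr : Computable r) (hG : Computable G) (he : Computable e) (he' : Computable e')
    (hl : Computable l) (hl' : Computable l') :
    Semidecidable fun a => Resolves A (r a) (G a) (e a) (e' a) (l a) (l' a) := by
  have h1 : Computable fun x : α × Mon X × Mon X => x.2.1 := Computable.fst.comp Computable.snd
  have h2 : Computable fun x : α × Mon X × Mon X => x.2.2 := Computable.snd.comp Computable.snd
  have hf : Computable fun x : α × Mon X × Mon X => x.1 := Computable.fst
  have hm : Computable fun x : α × Mon X × Mon X => x.2.1 ++ renameMon (app (l x.1)) (e x.1).1 :=
    Computable.list_append.comp h1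
      (computable_renameMon (hl.comp hf) (Computable.fst.comp (he.comp hf)))
  refine Semidecidable.exists_ (Semidecidable.and (Semidecidable.of_computable ?_)
    (Semidecidable.and (Semidecidable.of_computable ?_) ?_))
  · exact computablePred_mon_eq hm (Computable.list_append.comp h2
      (computable_renameMon (hl'.comp hf) (Computable.fst.comp (he'.comp hf))))
  · refine ComputablePred.forall_mem (p := fun (x : α × Mon X × Mon X) w =>
      mon x.2.1 w.1 = 0 ∨ mon x.2.2 w.1 = 0) h1 (ComputablePred.or ?_ ?_)
    · exact ComputablePred.eq (computable_mon.comp (h1.comp Computable.fst)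
        (Computable.fst.comp Computable.snd)) (Computable.const 0)
    · exact ComputablePred.eq (computable_mon.comp (h2.comp Computable.fst)
        (Computable.fst.comp Computable.snd)) (Computable.const 0)
  · refine semidecidable_spanMemb A hK (hr.comp hf) (hG.comp hf)
      (Computable.list_cons.comp hm (Computable.const [])) (Computable.list_append.comp ?_ ?_)
    · exact computable_mulTerm hK ((Computable.const 1).pair h1)
        (computable_renamePoly (hl.comp hf) (Computable.snd.comp (he.comp hf)))
    · exact computable_mulTerm hK ((Computable.const (-1)).pair h2)
        (computable_renamePoly (hl'.comp hf) (Computable.snd.comp (he'.comp hf)))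

theorem computable_monic {G : α → List (Mon X × Poly K X)} (hG : Computable G) :
    Computable fun a => monic (G a) := by
  have h1 : Computable fun x : α × Mon X × Poly K X => x.2.1 := Computable.fst.comp Computable.snd
  have h2 : Computable fun x : α × Mon X × Poly K X => x.2.2 := Computable.snd.comp Computable.snd
  exact Computable.list_map hG (h1.pair (Computable.list_cons.comp
    ((Computable.const 1).pair h1) h2))

theorem semidecidable_refutes (hK : ComputableField K) {f : α → Poly K X}
    {B : α → List (Poly K X)} {y : α → Certificate K X} (hf : Computable f) (hB : Computable B)
    (hy : Computable y) : Semidecidable fun a => Refutes A (f a) (B a) (y a) := by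
  have hr : Computable fun a => (y a).1 := Computable.fst.comp hy
  have hG : Computable fun a => (y a).2.1 := Computable.fst.comp (Computable.snd.comp hy)
  have hq : Computable fun a => (y a).2.2.1 :=
    Computable.fst.comp (Computable.snd.comp (Computable.snd.comp hy))
  have ht : Computable fun a => (y a).2.2.2 :=
    Computable.snd.comp (Computable.snd.comp (Computable.snd.comp hy))
  have hc : Computable fun a => (y a).2.2.1.1 := Computable.fst.comp hq
  have hv : Computable fun a => (y a).2.2.1.2 := Computable.snd.comp hq
  have hM := computable_monic hG
  have hw := computable_win A hr
  have hT : Computable fun a => tables (A.win (y a).1) (A.win (2 * (A.win (y a).1).length)) :=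
    computable_tables hw (computable_win A
      (Primrec.nat_mul.to_comp.comp (Computable.const 2) (Computable.list_length.comp hw)))
  refine Semidecidable.and (Semidecidable.of_computable ?_) <| Semidecidable.and ?_ <|
    Semidecidable.and ?_ <| Semidecidable.and (Semidecidable.of_computable ?_) <|
    Semidecidable.and (Semidecidable.of_computable ?_) <| Semidecidable.and ?_ <|
    Semidecidable.of_computable ?_
  · exact ComputablePred.forall_mem (p := fun (a : α) (e : Mon X × Poly K X) =>
      ∀ s ∈ e.2, A.mlt (mon s.2) (mon e.1)) hG (computablePred_tail_mlt A
        (Computable.fst.comp Computable.snd) (Computable.snd.comp Computable.snd))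
  · exact Semidecidable.forall_mem (p := fun a b => SpanMemb A (y a).1 (monic (y a).2.1) [] b) hB
      (semidecidable_spanMemb A hK (hr.comp Computable.fst) (hM.comp Computable.fst)
        (Computable.const []) Computable.snd)
  · refine Semidecidable.forall_mem (p := fun a e => ∀ e' ∈ monic (y a).2.1,
      ∀ l ∈ tables (A.win (y a).1) (A.win (2 * (A.win (y a).1).length)),
      ∀ l' ∈ tables (A.win (y a).1) (A.win (2 * (A.win (y a).1).length)),
        (HomOn C C {x | x ∈ A.win (y a).1} (app l) ∧ HomOn C C {x | x ∈ A.win (y a).1} (app l')) →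
        Resolves A (y a).1 (monic (y a).2.1) e e' l l') hM ?_
    refine Semidecidable.forall_mem (p := fun (x : α × Mon X × Poly K X) e' =>
      ∀ l ∈ tables (A.win (y x.1).1) (A.win (2 * (A.win (y x.1).1).length)),
      ∀ l' ∈ tables (A.win (y x.1).1) (A.win (2 * (A.win (y x.1).1).length)),
        (HomOn C C {z | z ∈ A.win (y x.1).1} (app l) ∧
          HomOn C C {z | z ∈ A.win (y x.1).1} (app l')) →
        Resolves A (y x.1).1 (monic (y x.1).2.1) x.2 e' l l') (hM.comp Computable.fst) ?_
    refine Semidecidable.forall_mem (p := fun (x : (α × Mon X × Poly K X) × Mon X × Poly K X) l =>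
      ∀ l' ∈ tables (A.win (y x.1.1).1) (A.win (2 * (A.win (y x.1.1).1).length)),
        (HomOn C C {z | z ∈ A.win (y x.1.1).1} (app l) ∧
          HomOn C C {z | z ∈ A.win (y x.1.1).1} (app l')) →
        Resolves A (y x.1.1).1 (monic (y x.1.1).2.1) x.1.2 x.2 l l')
      (hT.comp (Computable.fst.comp Computable.fst)) ?_
    refine Semidecidable.forall_mem
      (p := fun (x : ((α × Mon X × Poly K X) × Mon X × Poly K X) × List (X × X)) l' =>
        (HomOn C C {z | z ∈ A.win (y x.1.1.1).1} (app x.2) ∧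
          HomOn C C {z | z ∈ A.win (y x.1.1.1).1} (app l')) →
        Resolves A (y x.1.1.1).1 (monic (y x.1.1.1).2.1) x.1.1.2 x.1.2 x.2 l')
      (hT.comp (Computable.fst.comp (Computable.fst.comp Computable.fst))) ?_
    have h0 : Computable fun x : (((α × Mon X × Poly K X) × Mon X × Poly K X) × List (X × X)) ×
        List (X × X) => x.1.1.1.1 :=
      Computable.fst.comp (Computable.fst.comp (Computable.fst.comp Computable.fst))
    have h1 : Computable fun x : (((α × Mon X × Poly K X) × Mon X × Poly K X) × List (X × X)) ×
        List (X × X) => x.1.2 := Computable.snd.comp Computable.fst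
    refine Semidecidable.imp (ComputablePred.and (computablePred_homOn A (hr.comp h0) h1)
      (computablePred_homOn A (hr.comp h0) Computable.snd)) ?_
    exact semidecidable_resolves A hK (hr.comp h0) (hM.comp h0)
      (Computable.snd.comp (Computable.fst.comp (Computable.fst.comp Computable.fst)))
      (Computable.snd.comp (Computable.fst.comp Computable.fst)) h1 Computable.snd
  · exact (ComputablePred.eq hc (Computable.const 0)).not
  · exact computablePred_tail_mlt A hv ht
  · exact semidecidable_spanMemb A hK hr hM (Computable.const []) (Computable.list_append.comp hf
      (computable_mulTerm hK (Computable.const (-1, [])) (Computable.list_cons.comp hq ht)))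
  · have hL : Computable fun a => tables (A.win (y a).1)
        (A.cand (y a).1 ((y a).2.2.1.2.map Prod.fst)) :=
      computable_tables hw (A.cand_primrec.to_comp.comp hr
        (Computable.list_map hv (Computable.fst.comp Computable.snd)))
    refine ComputablePred.forall_mem (p := fun a e => ∀ l ∈ tables (A.win (y a).1)
        (A.cand (y a).1 ((y a).2.2.1.2.map Prod.fst)),
      ¬ (HomOn C C {x | x ∈ A.win (y a).1} (app l) ∧
        mon (renameMon (app l) e.1) ≤ mon (y a).2.2.1.2)) hG ?_
    refine ComputablePred.forall_mem (p := fun (x : α × Mon X × Poly K X) l =>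
      ¬ (HomOn C C {z | z ∈ A.win (y x.1).1} (app l) ∧
        mon (renameMon (app l) x.2.1) ≤ mon (y x.1).2.2.1.2)) (hL.comp Computable.fst) ?_
    have h0 : Computable fun x : (α × Mon X × Poly K X) × List (X × X) => x.1.1 :=
      Computable.fst.comp Computable.fst
    refine ComputablePred.not (ComputablePred.and
      (computablePred_homOn A (hr.comp h0) Computable.snd) (computablePred_mon_le ?_ (hv.comp h0)))
    exact computable_renameMon Computable.snd
      (Computable.fst.comp (Computable.snd.comp Computable.fst))

/-- Membership in equivariant ideals over an arena is decidable, for instances whose generators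
lie in windows. -/
theorem computablePred_mem_orbitIdeal (hK : ComputableField K) {f : α → Poly K X}
    {B : α → List (Poly K X)} (hf : Computable f) (hB : Computable B)
    (hw : ∀ a, ∃ n, ∀ b ∈ B a, PolyInWin A n b) :
    ComputablePred fun a => poly (f a) ∈ orbitIdeal A.Emb {p | ∃ b ∈ B a, p = poly b} := by
  refine Semidecidable.computablePred ?_ ?_
  -- Without a bound on leading exponents the recorded leading monomials play no role, so empty ones
  -- are supplied.
  · have : Semidecidable fun a => ∃ r, SpanMemb A r ((B a).map fun b => ([], b)) [] (f a) :=
      Semidecidable.exists_ (semidecidable_spanMemb A hK Computable.snd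
        ((Computable.list_map (g := fun _ b => (([] : Mon X), b)) hB
          ((Computable.const []).pair Computable.snd)).comp Computable.fst)
        (Computable.const []) (hf.comp Computable.fst))
    refine this.of_eq fun a => ?_
    have hg : Prod.snd '' gens ((B a).map fun b => (([] : Mon X), b)) =
        {p | ∃ b ∈ B a, p = poly b} := by
      ext p
      simp [gens, eq_comm]
    simp only [spanMemb_nil_iff, hg]
    refine ⟨fun ⟨_, _, h⟩ => h, fun h => ?_⟩
    obtain ⟨n, hn⟩ := hw a
    refine ⟨n, ?_, h⟩
    intro e he
    obtain ⟨b, hb, rfl⟩ := List.mem_map.1 he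
    exact ⟨by simp, hn b hb⟩
  · exact (Semidecidable.exists_ (p := fun a y => Refutes A (f a) (B a) y)
      (semidecidable_refutes A hK (hf.comp Computable.fst)
        (hB.comp Computable.fst) Computable.snd)).of_eq fun a =>
        ⟨fun ⟨_, h⟩ => not_mem_of_refutes h, exists_refutes (hw a)⟩

end Decidability

end Code

theorem Code.exists_polyInWin {X : Type} {K : Type*} [Primcodable X] {C : Cmp X} (A : Arena C)
    {B : List (Code.Poly K X)} (h : ∀ b ∈ B, ∀ t ∈ b, ∀ v ∈ t.2, ∃ n, v.1 ∈ A.win n) :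
    ∃ n, ∀ b ∈ B, Code.PolyInWin A n b := by
  refine Filter.Eventually.exists (f := Filter.atTop) ?_
  refine (Filter.eventually_all_finite (List.finite_toSet B)).2 fun b hb => ?_
  refine (Filter.eventually_all_finite (List.finite_toSet b)).2 fun t ht => ?_
  refine (Filter.eventually_all_finite (List.finite_toSet t.2)).2 fun v hv => ?_
  obtain ⟨n, hn⟩ := h b hb t ht v hv
  exact Filter.eventually_atTop.2 ⟨n, fun m hm => A.win_mono n m hm _ hn⟩

/-! ### Ideal membership in terms of comparisons. -/

section Membership

variable {K : Type*} [Field K]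

theorem rename_mem_of_mem_orbitIdeal {X Y Z : Type*} {E : Set (X → Z)} {B : Set (MvPolynomial X K)}
    {I : Ideal (MvPolynomial Y K)} {f : Z → Y} (h : ∀ e ∈ E, ∀ b ∈ B, rename (f ∘ e) b ∈ I)
    {p : MvPolynomial Z K} (hp : p ∈ orbitIdeal E B) : rename f p ∈ I := by
  have : orbitIdeal E B ≤ I.comap (rename f : _ →ₐ[K] _) := by
    refine Ideal.span_le.2 ?_
    rintro _ ⟨e, he, b, hb, rfl⟩
    rw [SetLike.mem_coe, Ideal.mem_comap, rename_rename]
    exact h e he b hb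
  exact this hp

theorem rename_mem_orbitIdeal_of_mem {X Z : Type*} {E : Set (X → Z)} {B : Set (MvPolynomial X K)}
    {e : X → Z} {b : MvPolynomial X K} (he : e ∈ E) (hb : b ∈ B) : rename e b ∈ orbitIdeal E B :=
  Ideal.subset_span ⟨e, he, b, hb, rfl⟩

theorem eqIdealGen_eq_orbitIdeal {D : Domain} (B : Set (MvPolynomial D.Carrier K)) :
    eqIdealGen B = orbitIdeal (Set.range fun (ι : D.Emb) a => ι a) B := by
  unfold eqIdealGen orbitIdeal
  congr 1
  ext f
  constructor
  · rintro ⟨ι, b, hb, rfl⟩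
    exact ⟨_, ⟨ι, rfl⟩, b, hb, rfl⟩
  · rintro ⟨_, ⟨ι, rfl⟩, b, hb, rfl⟩
    exact ⟨ι, b, hb, rfl⟩

theorem Cmp.Realizes.rename_mem_eqIdealGen_iff {Z : Type} {C : Cmp Z} {D : Domain}
    {f : Z → D.Carrier} (h : C.Realizes D f) (hf : Function.Bijective f)
    {B : Set (MvPolynomial Z K)} {p : MvPolynomial Z K} :
    rename f p ∈ eqIdealGen (A := D) (rename f '' B) ↔
      p ∈ orbitIdeal {κ | HomOn C C Set.univ κ} B := by
  rw [eqIdealGen_eq_orbitIdeal]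
  constructor
  · intro hp
    obtain ⟨g, hgf, hfg⟩ := Function.bijective_iff_has_inverse.1 hf
    have : rename g (rename f p) = p := by
      rw [rename_rename, hgf.comp_eq_id, rename_id_apply]
    rw [← this]
    refine rename_mem_of_mem_orbitIdeal ?_ hp
    rintro _ ⟨ι, rfl⟩ _ ⟨b, hb, rfl⟩
    rw [rename_rename]
    exact rename_mem_orbitIdeal_of_mem ((h.exists_emb hf _).2 ⟨ι, fun z => (hfg _).symm⟩) hb
  · refine fun hp => rename_mem_of_mem_orbitIdeal ?_ hp
    intro κ hκ b hb
    obtain ⟨ι, hι⟩ := (h.exists_emb hf _).1 hκ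
    have : f ∘ κ = (fun a => ι a) ∘ f := funext fun z => (hι z).symm
    rw [this, ← rename_rename]
    exact rename_mem_orbitIdeal_of_mem ⟨ι, rfl⟩ ⟨b, hb, rfl⟩

theorem PolyCode.toPoly_eq {D : Domain} (p : PolyCode K D) :
    p.toPoly = rename D.val (Code.poly p) := by
  have h (t : K × Code.Mon D.Code) : C t.1 * (t.2.map fun v => X (D.val v.1) ^ v.2).prod =
      rename D.val (monomial (Code.mon t.2) t.1) := by
    obtain ⟨c, m⟩ := t
    rw [rename_monomial]
    dsimp only
    induction m with
    | nil => simp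
    | cons v m ih =>
      rw [List.map_cons, List.prod_cons, mul_left_comm, ih, X_pow_eq_monomial, monomial_mul,
        one_mul, Code.mon_cons, Finsupp.mapDomain_add, Finsupp.mapDomain_single]
  simp only [PolyCode.toPoly, h]
  simp [Code.poly, map_list_sum, Function.comp_def]

theorem Cmp.Realizes.idealMemb_iff {D : Domain} {Q : Cmp D.Carrier} (h : Q.Realizes D id)
    (x : PolyCode K D × List (PolyCode K D)) :
    IdealMemb K D x ↔ rename D.val (Code.poly x.1) ∈ orbitIdeal {κ | HomOn Q Q Set.univ κ}
      {p | ∃ b ∈ x.2, p = rename D.val (Code.poly b)} := by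
  rw [← h.rename_mem_eqIdealGen_iff Function.bijective_id, rename_id]
  simp [IdealMemb, PolyCode.toPoly_eq]

/-- On the target side codes are unique and can serve as the variables. Fractions are not unique, so
on the source side `idealMemb_iff` keeps the carrier. -/
theorem Cmp.Realizes.idealMemb_iff_of_injective {O : Domain} {C : Cmp O.Code}
    (h : C.Realizes O O.val) (hO : Function.Injective O.val)
    (x : PolyCode K O × List (PolyCode K O)) :
    IdealMemb K O x ↔ Code.poly x.1 ∈ orbitIdeal {κ | HomOn C C Set.univ κ}
      {p | ∃ b ∈ x.2, p = Code.poly b} := by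
  rw [← h.rename_mem_eqIdealGen_iff ⟨hO, O.val_surjective⟩, IdealMemb, PolyCode.toPoly_eq]
  have : {g | ∃ b ∈ x.2, g = PolyCode.toPoly b} =
      rename O.val '' {p : MvPolynomial O.Code K | ∃ b ∈ x.2, p = Code.poly b} := by
    ext g
    simp only [PolyCode.toPoly_eq, Set.mem_ofPred_eq, Set.mem_image]
    constructor
    · rintro ⟨b, hb, rfl⟩
      exact ⟨_, ⟨b, hb, rfl⟩, rfl⟩
    · rintro ⟨_, ⟨b, hb, rfl⟩, rfl⟩
      exact ⟨b, hb, rfl⟩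
  rw [this]

theorem Code.rename_poly_congr {X Z : Type} {f g : X → Z} {p : Code.Poly K X}
    (h : ∀ t ∈ p, ∀ v ∈ t.2, f v.1 = g v.1) :
    rename f (Code.poly p) = rename g (Code.poly p) := by
  rw [← Code.poly_renamePoly, Code.renamePoly_congr h, Code.poly_renamePoly]

end Membership

/-! ### Correctness and computability of the reduction. -/

namespace Reduction

open Code

variable {D : Domain} {Q : Cmp D.Carrier} {X : Type} [Primcodable X] {C : Cmp X} {A : Arena C}
  (ρ : Reduction D Q A) {K : Type*}

/-- A common multiple of the weights of the codes in an instance. -/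
def commonMultiple (x : PolyCode K D × List (PolyCode K D)) : ℕ :=
  ((x.1 :: x.2).flatMap fun p => p.flatMap fun t => t.2.map fun v => ρ.wt v.1).prod

/-- The reduction: the polynomial is placed at high positions, and the generators at low ones. -/
def instanceMap (x : PolyCode K D × List (PolyCode K D)) : Poly K X × List (Poly K X) :=
  (renamePoly (ρ.high (ρ.commonMultiple x)) x.1, x.2.map (renamePoly (ρ.low (ρ.commonMultiple x))))

theorem commonMultiple_pos (x : PolyCode K D × List (PolyCode K D)) : 0 < ρ.commonMultiple x := by
  refine List.prod_pos fun n hn => ?_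
  simp only [List.mem_flatMap, List.mem_map] at hn
  obtain ⟨p, -, t, -, v, -, rfl⟩ := hn
  exact ρ.wt_pos _

theorem wt_dvd_commonMultiple {x : PolyCode K D × List (PolyCode K D)} {p : PolyCode K D}
    (hp : p ∈ x.1 :: x.2) : ∀ t ∈ p, ∀ v ∈ t.2, ρ.wt v.1 ∣ ρ.commonMultiple x := fun t ht v hv =>
  List.dvd_prod (List.mem_flatMap.2 ⟨p, hp, List.mem_flatMap.2 ⟨t, ht, List.mem_map.2 ⟨v, hv, rfl⟩⟩⟩)

theorem computable_instanceMap [Primcodable K] :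
    Computable (ρ.instanceMap : PolyCode K D × List (PolyCode K D) → _) := by
  have hwt := ρ.wt_primrec.to_comp
  have hs : Computable (ρ.commonMultiple : PolyCode K D × List (PolyCode K D) → ℕ) := by
    have h1 : Computable fun x : PolyCode K D × List (PolyCode K D) => (x.1 :: x.2).flatMap fun p =>
        p.flatMap fun t => t.2.map fun v => ρ.wt v.1 := by
      refine Computable.list_flatMap (Computable.list_cons.comp Computable.fst Computable.snd) ?_
      refine Computable.list_flatMap Computable.snd ?_
      refine Computable.list_map (Computable.snd.comp Computable.snd) ?_
      exact hwt.comp (Computable.fst.comp Computable.snd)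
    refine (Computable.list_foldl (g := fun _ => 1) (h := fun _ p => p.1 * p.2) h1
      (Computable.const 1) (Primrec.nat_mul.to_comp.comp (Computable.fst.comp Computable.snd)
        (Computable.snd.comp Computable.snd))).of_eq fun x => ?_
    exact List.prod_eq_foldl.symm
  have key {β : Type _} [Primcodable β] {g : ℕ → D.Code → X} (hg : Primrec₂ g) {N : β → ℕ}
      {p : β → PolyCode K D} (hN : Computable N) (hp : Computable p) :
      Computable fun a => renamePoly (g (N a)) (p a) := by
    refine Computable.list_map hp ((Computable.fst.comp Computable.snd).pair ?_)
    refine Computable.list_map (Computable.snd.comp Computable.snd) (Computable.pair ?_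
      (Computable.snd.comp Computable.snd))
    exact hg.to_comp.comp (hN.comp (Computable.fst.comp Computable.fst))
      (Computable.fst.comp Computable.snd)
  exact (key ρ.high_primrec hs Computable.fst).pair (Computable.list_map Computable.snd
    (key ρ.low_primrec (hs.comp Computable.fst) Computable.snd))

theorem exists_polyInWin_instanceMap [Field K] (x : PolyCode K D × List (PolyCode K D)) :
    ∃ n, ∀ b ∈ (ρ.instanceMap x).2, PolyInWin A n b := by
  refine exists_polyInWin A ?_
  intro _ hb t ht v hv
  obtain ⟨b, hb', rfl⟩ := List.mem_map.1 hb
  obtain ⟨t, ht', rfl⟩ := List.mem_map.1 ht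
  obtain ⟨v, hv', rfl⟩ := List.mem_map.1 hv
  exact ρ.low_mem _ _ (ρ.commonMultiple_pos x)
    (ρ.wt_dvd_commonMultiple (List.mem_cons_of_mem _ hb') t ht' v hv')

theorem mem_orbitIdeal_iff [Field K] (x : PolyCode K D × List (PolyCode K D)) :
    rename D.val (poly x.1) ∈ orbitIdeal {κ | HomOn Q Q Set.univ κ}
        {p | ∃ b ∈ x.2, p = rename D.val (poly b)} ↔
      poly (ρ.instanceMap x).1 ∈ orbitIdeal A.Emb {p | ∃ b ∈ (ρ.instanceMap x).2, p = poly b} := by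
  have hN := ρ.commonMultiple_pos x
  obtain ⟨n, hn⟩ := ρ.exists_polyInWin_instanceMap x
  have hf := ρ.wt_dvd_commonMultiple (x := x) List.mem_cons_self
  have hb {b : PolyCode K D} (h : b ∈ x.2) := ρ.wt_dvd_commonMultiple (x := x) (List.mem_cons_of_mem _ h)
  have hlow {b : PolyCode K D} (h : b ∈ x.2) (t) (ht : t ∈ b) (v) (hv : v ∈ t.2) :
      ρ.low (ρ.commonMultiple x) v.1 ∈ A.win n :=
    hn _ (List.mem_map.2 ⟨b, h, rfl⟩) _ (List.mem_map.2 ⟨t, ht, rfl⟩) _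
      (List.mem_map.2 ⟨v, hv, rfl⟩)
  constructor
  · intro hx
    -- Each generator is the image under `sec` of its low copy, so its orbit over `D` consists of
    -- images of a polynomial in a window.
    have hx' : rename D.val (poly x.1) ∈
        orbitIdeal {e | ∃ σ, HomOn Q Q Set.univ σ ∧ e = σ ∘ ρ.sec (ρ.commonMultiple x)}
          {p | ∃ b ∈ (ρ.instanceMap x).2, p = poly b} := by
      rw [← rename_id_apply (rename D.val (poly x.1))]
      refine rename_mem_of_mem_orbitIdeal ?_ hx
      rintro σ hσ _ ⟨b, h, rfl⟩
      have : rename D.val (poly b) =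
          rename (ρ.sec (ρ.commonMultiple x)) (poly (renamePoly (ρ.low (ρ.commonMultiple x)) b)) := by
        rw [poly_renamePoly, rename_rename]
        exact rename_poly_congr fun t ht v hv => (ρ.sec_low _ _ hN (hb h t ht v hv)).symm
      rw [this, rename_rename]
      exact rename_mem_orbitIdeal_of_mem ⟨σ, hσ, rfl⟩ ⟨_, List.mem_map.2 ⟨b, h, rfl⟩, rfl⟩
    obtain ⟨F, hF⟩ := A.exists_finset_of_mem_orbitIdeal (n := n) (by
      rintro _ ⟨b, h, rfl⟩
      exact mem_win_of_mem_vars (hn b h)) (by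
      rintro _ ⟨σ, hσ, rfl⟩
      exact HomOn.comp_univ hσ (ρ.sec_hom _ hN n)) hx'
    obtain ⟨t, ht, htv⟩ := ρ.down _ hN F
    have h1 := hF t ht
    rw [rename_rename, rename_poly_congr fun s hs v hv => htv _ (hf s hs v hv)] at h1
    rwa [instanceMap, poly_renamePoly]
  · intro hx
    obtain ⟨J, hJ, hJv⟩ := ρ.up _ hN
    rw [← rename_poly_congr (f := J ∘ ρ.high (ρ.commonMultiple x)) fun s hs v hv => hJv _ (hf s hs v hv),
      ← rename_rename, ← poly_renamePoly]
    refine rename_mem_of_mem_orbitIdeal ?_ hx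
    rintro κ hκ _ ⟨_, h', rfl⟩
    obtain ⟨b, h, rfl⟩ := List.mem_map.1 h'
    -- On low positions, `J ∘ κ` is an embedding of `D` composed with `sec`, hence it sends the low
    -- copy of `b` to a renaming of `b`.
    obtain ⟨σ, hσ, hσe⟩ := ρ.ext _ hN (J ∘ κ) (HomOn.comp_univ hJ hκ)
    rw [poly_renamePoly, rename_rename, rename_poly_congr (g := σ ∘ D.val), ← rename_rename]
    · exact rename_mem_orbitIdeal_of_mem hσ ⟨b, h, rfl⟩
    · intro t ht v hv
      rw [Function.comp_apply (f := σ), ← ρ.sec_low _ _ hN (hb h t ht v hv)]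
      exact (hσe n _ (hlow h t ht v hv)).symm

end Reduction

/-! ### Assembly of the corollary. -/

namespace Domain

/-- The orders of `D` and `O` are described by comparisons such that `D` reduces to an arena on
the codes of `O`. -/
def ReducesTo (D O : Domain) : Prop :=
  ∃ (Q : Cmp D.Carrier) (C : Cmp O.Code) (A : Arena C), Nonempty (Reduction D Q A) ∧
    Q.Realizes D id ∧ C.Realizes O O.val ∧ Function.Injective O.val

namespace ReducesTo

theorem rat_omegaSq : rat.ReducesTo omegaSq :=
  ⟨_, _, _, ⟨Reduction.rat⟩, realizes_rat, realizes_omegaSq, toLex.injective⟩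

theorem fin (d : ℕ) : (fin d).ReducesTo (Domain.fin d) :=
  ⟨_, _, _, ⟨Reduction.fin d⟩, realizes_fin d, realizes_fin d, Function.injective_id⟩

theorem lexProd {D D' O O' : Domain} (h : D.ReducesTo O) (h' : D'.ReducesTo O') :
    (D.lexProd D').ReducesTo (O.lexProd O') := by
  obtain ⟨Q, C, A, ⟨ρ⟩, hQ, hC, hO⟩ := h
  obtain ⟨Q', C', A', ⟨ρ'⟩, hQ', hC', hO'⟩ := h'
  refine ⟨Q.prod Q', C.prod C', A.prod A', ⟨ρ.prod ρ'⟩, ?_, hC.prod hC' hO, hO.prodMap hO'⟩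
  intro I u v
  exact hQ.prod hQ' Function.injective_id u v

theorem lexPow {D O : Domain} (h : D.ReducesTo O) : ∀ n, (D.lexPow n).ReducesTo (O.lexPow n)
  | 0 => fin 1
  | 1 => h
  | n + 2 => (lexPow h (n + 1)).lexProd h

variable {K : Type*} [Field K] [Primcodable K] {D O : Domain}

theorem manyOneReducible (h : D.ReducesTo O) :
    ManyOneReducible (IdealMemb K D) (IdealMemb K O) := by
  obtain ⟨Q, C, A, ⟨ρ⟩, hQ, hC, hO⟩ := h
  refine ⟨ρ.instanceMap, ρ.computable_instanceMap, fun x => ?_⟩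
  rw [hQ.idealMemb_iff, hC.idealMemb_iff_of_injective hO]
  exact ρ.mem_orbitIdeal_iff x

/-- Decidability is not drawn from the target problem in general: only the instances produced by the
reduction, whose generators lie in windows, are decided. -/
theorem computablePred (h : D.ReducesTo O) (hK : ComputableField K) :
    ComputablePred (IdealMemb K D) := by
  obtain ⟨Q, C, A, ⟨ρ⟩, hQ, -⟩ := h
  refine (Code.computablePred_mem_orbitIdeal A hK
    (Computable.fst.comp ρ.computable_instanceMap) (Computable.snd.comp ρ.computable_instanceMap)
    ρ.exists_polyInWin_instanceMap).of_eq fun x => ?_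
  rw [hQ.idealMemb_iff, ρ.mem_orbitIdeal_iff]

end ReducesTo

end Domain

theorem mainTheorem7 {K : Type*} [Field K] [Primcodable K] (hK : ComputableField K)
    (d ℓ : ℕ) (hd : 1 ≤ d) (hℓ : 1 ≤ ℓ) :
    ManyOneReducible
        (IdealMemb K ((Domain.rat.lexPow ℓ).lexProd (Domain.fin d)))
        (IdealMemb K ((Domain.omegaSq.lexPow ℓ).lexProd (Domain.fin d))) ∧
      ComputablePred (IdealMemb K ((Domain.rat.lexPow ℓ).lexProd (Domain.fin d))) := by
  have h := (Domain.ReducesTo.rat_omegaSq.lexPow ℓ).lexProd (Domain.ReducesTo.fin d)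
  exact ⟨h.manyOneReducible, h.computablePred hK⟩
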